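/- **Setting (one layer).** For $N\in\mathbb N$ let $S^N_i=\frac12\sum_{k=1}^N\sigma_i^{(k)}$ ($i=x,y,z$), $S^N_\pm=S^N_x\pm iS^N_y$ be the collective spin operators on $(\mathbb C^2)^{\otimes N}$. A strong-coupling BCS layer with parameters $\epsilon\in\mathbb R$, $T_c>0$ has Hamiltonian $H^N=-2\epsilon S^N_z-\frac{2T_c}{N}S^N_+S^N_-$. Let $\langle\cdot\rangle^N_\beta$ be its Gibbs state at inverse temperature $\beta>0$. A number $\Delta>0$ is the modulus of the gap of the layer if for every phase $\phi$ the Gibbs state $\langle\!\langle\cdot\rangle\!\rangle$ at inverse temperature $\beta$ of the mean-field Hamiltonian $-2\epsilon S^N_z-2T_c\Delta\,(e^{-i\phi}S^N_++e^{i\phi}S^N_-)$ satisfies $\langle\!\langle S^N_+\rangle\!\rangle/N=\Delta e^{i\phi}$ for all $N\ge1$. **Setting (two layers).** Consider two layers $L,R$ with parameters $\epsilon_{L},T_c^{L}$ and $\epsilon_R,T_c^R$ ($T_c^L,T_c^R>0$), a common $\beta>0$, and gaps $\Delta_L,\Delta_R>0$ as above. Each layer is purified on $\mathbb C^{2^N}\otimes\mathbb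 C^{2^N}$, by the vector $\sum_i\sqrt{\rho_i}\,|i\rangle\otimes|i\rangle$, where $\rho_i$ and $|i\rangle$ are the eigenvalues and real orthonormal eigenvectors of its Gibbs state; $|\Omega^N_\beta\rangle$ is the tensor product of the two purifications, and $\langle X\rangle^N=\langle\Omega^N_\beta|X|\Omega^N_\beta\rangle$. For given $\mathfrak c_L,\mathfrak c_R>0$ and $j\in\{L,R\}$, on the factors of layer $j$, put $p^N_j=S^N_z\otimes 1-1\otimes S^N_z$ and $E^N_{j,\pm}=\frac{S^N_\pm}{\mathfrak c_jN}\otimes1$. For real $\lambda,\mathcal E_C,n_g$ let $$\mathfrak H^N=\sum_{j=L,R}\bigl(H^N_j\otimes1-1\otimes H^N_j\bigr)+\lambda\mathfrak c_L\mathfrak c_R\bigl(E^N_{L,+}E^N_{R,-}+E^N_{L,-}E^N_{R,+}\bigr)+\mathcal E_C\Bigl(\frac{p^N_L-p^N_R}2-n_g\Bigr)^2,\qquad U^N(t)=e^{-it\mathfrak H^N}.$$ **Mesoscopic system and limit.** On $L^2$ of the product of two circles with angles $\theta_L,\theta_R$, let $e^{i k\hat\varphi_{j}}$ ($k\in\mathbb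 Z$) be multiplication by $e^{ik\theta_j}$, $\hat p_{j}=-i\partial_{\theta_j}$, and $|0\rangle$ the normalized constant function. With $G^N(a,a',b,b')=(E^N_{L,-})^{a}(E^N_{L,+})^{a'}(E^N_{R,-})^{b}(E^N_{R,+})^{b'}$, one says that operators $X^N$ converge in the mesoscopic limit to the bounded operator $X$ if, for all $n_L,n_L',n_R,n_R',m_L,m_L',m_R,m_R'\in\mathbb N$, $$\lim_{N\to\infty}\bigl\langle G^N(n_L,n_L',n_R,n_R')^\dagger\,X^N\,G^N(m_L,m_L',m_R,m_R')\bigr\rangle^N=\langle0|e^{-i(n_L'-n_L)\hat\varphi_L}e^{-i(n_R'-n_R)\hat\varphi_R}\,X\,e^{i(m_R'-m_R)\hat\varphi_R}e^{i(m_L'-m_L)\hat\varphi_L}|0\rangle .$$ **Theorem.** The limits $\mathfrak c_j^2=\lim_{N\to\infty}\frac1{N^2}\langle S^N_+S^N_-\rangle^N_{\beta,j}$, $j\in\{L,R\}$, exist and are positive; let $\mathfrak c_j>0$. The operator $$\mathfrak H=\mathcal E_C\Bigl(\frac{\hat p_L-\hat p_R}2-n_g\Bigr)^2+\mathcal E_J\cos(\hat\varphi_L-\hat\varphi_R),\qquad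 \mathcal E_J=2\lambda\,\mathfrak c_L\mathfrak c_R,$$ (with the domain of the first term, taken as a function of the commuting operators $\hat p_L,\hat p_R$) generates a strongly continuous unitary group $e^{-it\mathfrak H}$, and for every $t\in\mathbb R$ the operators $U^N(t)$, formed with these $\mathfrak c_L,\mathfrak c_R$, converge in the mesoscopic limit to $e^{-it\mathfrak H}$. Moreover $\mathfrak c_L=\Delta_L$ and $\mathfrak c_R=\Delta_R$, so that $\mathcal E_J=2\lambda\Delta_L\Delta_R$. -/

import Mathlib

open Filter Topology MeasureTheory
open scoped Matrix Kronecker ENNReal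

namespace ChargeQubit

noncomputable section

/-! ### Quasi-spins -/

/-- Labels of the computational basis of `(ℂ²)^{⊗ N}`; the value `0` is spin up, `1` spin down. -/
abbrev Spins (N : ℕ) : Type := Fin N → Fin 2

/-- Operators (matrices) on the `2 ^ N`-dimensional Hilbert space of `N` quasi-spins. -/
abbrev SpinOp (N : ℕ) : Type := Matrix (Spins N) (Spins N) ℂ

def pauliX : Matrix (Fin 2) (Fin 2) ℂ := !![0, 1; 1, 0]

def pauliY : Matrix (Fin 2) (Fin 2) ℂ := !![0, -Complex.I; Complex.I, 0]

def pauliZ : Matrix (Fin 2) (Fin 2) ℂ := !![1, 0; 0, -1]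

/-- The one-site matrix `a` acting on the `k`-th tensor factor, the identity on the others. -/
def siteOp {N : ℕ} (a : Matrix (Fin 2) (Fin 2) ℂ) (k : Fin N) : SpinOp N :=
  Matrix.of fun σ τ => if ∀ j, j ≠ k → σ j = τ j then a (σ k) (τ k) else 0

/-- The collective operator `(1/2) ∑ₖ a⁽ᵏ⁾`. -/
def collective (N : ℕ) (a : Matrix (Fin 2) (Fin 2) ℂ) : SpinOp N :=
  (1 / 2 : ℂ) • ∑ k : Fin N, siteOp a k

def Sx (N : ℕ) : SpinOp N := collective N pauliX

def Sy (N : ℕ) : SpinOp N := collective N pauliY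

def Sz (N : ℕ) : SpinOp N := collective N pauliZ

def Splus (N : ℕ) : SpinOp N := Sx N + Complex.I • Sy N

def Sminus (N : ℕ) : SpinOp N := Sx N - Complex.I • Sy N

/-- The parameters of one strong-coupling BCS layer: the level energy and the coupling (critical
temperature). -/
structure BCSLayer where
  ε : ℝ
  Tc : ℝ

/-- The strong-coupling BCS Hamiltonian `-2 ε S_z - (2 T_c / N) S_+ S_-`. -/
def bcsHamiltonian (l : BCSLayer) (N : ℕ) : SpinOp N :=
  -((2 * l.ε : ℝ) : ℂ) • Sz N - ((2 * l.Tc / N : ℝ) : ℂ) • (Splus N * Sminus N)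

/-- The expectation of `X` in the Gibbs state of `H` at inverse temperature `β`. -/
def gibbs {n : Type*} [Fintype n] [DecidableEq n] (β : ℝ) (H X : Matrix n n ℂ) : ℂ :=
  (NormedSpace.exp (-(β : ℂ) • H) * X).trace / (NormedSpace.exp (-(β : ℂ) • H)).trace

/-- The mean-field BCS Hamiltonian with order parameter `z` (the value of `⟨⟨S_+⟩⟩ / N`):
`-2 ε S_z - 2 T_c (z̄ S_+ + z S_-)`. -/
def meanFieldHamiltonian (l : BCSLayer) (N : ℕ) (z : ℂ) : SpinOp N :=
  -((2 * l.ε : ℝ) : ℂ) • Sz N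
    - ((2 * l.Tc : ℝ) : ℂ) • (star z • Splus N + z • Sminus N)

/-- `Δ` is the (nonvanishing, dimensionless) gap modulus of the layer at inverse temperature `β`:
for every phase `φ`, the order parameter `Δ e^{iφ}` is reproduced by the Gibbs state of the
mean-field Hamiltonian that it defines, `⟨⟨S_+⟩⟩ / N = Δ e^{iφ}`. -/
def IsGap (β : ℝ) (l : BCSLayer) (Δ : ℝ) : Prop :=
  0 < Δ ∧ ∀ (N : ℕ) (φ : ℝ), 1 ≤ N →
    gibbs β (meanFieldHamiltonian l N (Δ * Complex.exp (Complex.I * φ))) (Splus N) / N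
      = Δ * Complex.exp (Complex.I * φ)

/-! ### The GNS representation of two layers

The GNS space of one layer is `ℂ^{2^N} ⊗ ℂ^{2^N}` (algebra factor, commutant factor); that of two
layers is the tensor product of the space of the left layer with that of the right layer. -/

abbrev LayerOp (N : ℕ) : Type := Matrix (Spins N × Spins N) (Spins N × Spins N) ℂ

abbrev JunctionOp (N : ℕ) : Type :=
  Matrix ((Spins N × Spins N) × (Spins N × Spins N)) ((Spins N × Spins N) × (Spins N × Spins N)) ℂ

/-- The purification of the Gibbs state `ρ` of `H`: the vector of `ℂ^n ⊗ ℂ^n` whose components are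
the matrix entries of `√ρ`. It equals `∑ᵢ √ρᵢ |i⟩ ⊗ |i⟩` for every orthonormal eigenbasis of `ρ`
with real components, such as the basis `|s, s_z⟩_α` for the Gibbs state of the BCS Hamiltonian. -/
def purifiedGibbs {n : Type*} [Fintype n] [DecidableEq n] (β : ℝ) (H : Matrix n n ℂ) :
    n × n → ℂ :=
  fun p => NormedSpace.exp (-((β / 2 : ℝ) : ℂ) • H) p.1 p.2 /
    (Real.sqrt (NormedSpace.exp (-(β : ℂ) • H)).trace.re : ℂ)

/-- The GNS cyclic vector of the two-layer system. -/
def gnsVector (β : ℝ) (L R : BCSLayer) (N : ℕ) : (Spins N × Spins N) × (Spins N × Spins N) → ℂ :=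
  fun p => purifiedGibbs β (bcsHamiltonian L N) p.1 * purifiedGibbs β (bcsHamiltonian R N) p.2

/-- The expectation of `X` in the GNS cyclic vector. -/
def gnsExpect (β : ℝ) (L R : BCSLayer) (N : ℕ) (X : JunctionOp N) : ℂ :=
  star (gnsVector β L R N) ⬝ᵥ (X *ᵥ gnsVector β L R N)

/-- An operator of a single layer in the GNS representation, renormalized by its commutant
counterpart: `A ⊗ 1 - 1 ⊗ A`. -/
def renormalized {N : ℕ} (A : SpinOp N) : LayerOp N := A ⊗ₖ 1 - 1 ⊗ₖ A

/-- The momentum fluctuation operators of the left and of the right layer. -/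
def pL (N : ℕ) : JunctionOp N := renormalized (Sz N) ⊗ₖ 1

def pR (N : ℕ) : JunctionOp N := 1 ⊗ₖ renormalized (Sz N)

/-- The phase fluctuation operator `S / (𝔠 N)` of one layer, for `S = S_+` or `S = S_-`. -/
def phaseFluct {N : ℕ} (c : ℝ) (S : SpinOp N) : LayerOp N :=
  (((c * N : ℝ) : ℂ)⁻¹ • S) ⊗ₖ 1

def ELplus (cL : ℝ) (N : ℕ) : JunctionOp N := phaseFluct cL (Splus N) ⊗ₖ 1

def ELminus (cL : ℝ) (N : ℕ) : JunctionOp N := phaseFluct cL (Sminus N) ⊗ₖ 1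

def ERplus (cR : ℝ) (N : ℕ) : JunctionOp N := 1 ⊗ₖ phaseFluct cR (Splus N)

def ERminus (cR : ℝ) (N : ℕ) : JunctionOp N := 1 ⊗ₖ phaseFluct cR (Sminus N)

/-- The free GNS Hamiltonian of the two uncoupled layers. -/
def freeHamiltonian (L R : BCSLayer) (N : ℕ) : JunctionOp N :=
  renormalized (bcsHamiltonian L N) ⊗ₖ 1 + 1 ⊗ₖ renormalized (bcsHamiltonian R N)

/-- The tunnelling Hamiltonian. -/
def tunnelHamiltonian (lam cL cR : ℝ) (N : ℕ) : JunctionOp N :=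
  ((lam * cL * cR : ℝ) : ℂ) • (ELplus cL N * ERminus cR N + ELminus cL N * ERplus cR N)

/-- The capacitive Hamiltonian `𝓔_C ((p_L - p_R)/2 - n_g)²`. -/
def capacitiveHamiltonian (EC ng : ℝ) (N : ℕ) : JunctionOp N :=
  (EC : ℂ) • ((1 / 2 : ℂ) • (pL N - pR N) - (ng : ℂ) • (1 : JunctionOp N)) ^ 2

/-- The microscopic charge-qubit Hamiltonian. -/
def microHamiltonian (L R : BCSLayer) (lam cL cR EC ng : ℝ) (N : ℕ) : JunctionOp N :=
  freeHamiltonian L R N + tunnelHamiltonian lam cL cR N + capacitiveHamiltonian EC ng N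

/-- The microscopic evolution operator `exp (-i t 𝔥^N)`. -/
def microEvolution (L R : BCSLayer) (lam cL cR EC ng t : ℝ) (N : ℕ) : JunctionOp N :=
  NormedSpace.exp ((-Complex.I * (t : ℂ)) • microHamiltonian L R lam cL cR EC ng N)

/-! ### The circle representation of the mesoscopic system -/

/-- The normalized Haar measure on the product of two circles. A point `x` of the torus has the
angles `θ_L = 2π x 0` and `θ_R = 2π x 1`. -/
abbrev torusMeasure : Measure (UnitAddTorus (Fin 2)) :=
  Measure.pi fun _ => (AddCircle.haarAddCircle : Measure UnitAddCircle)

/-- The mesoscopic Hilbert space: square integrable functions of the two angles. -/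
abbrev MesoSpace : Type := Lp ℂ 2 torusMeasure

/-- The Hilbert basis of plane waves `e^{i (n_L θ_L + n_R θ_R)}`, `n_L = n 0`, `n_R = n 1`. -/
def planeWaves : HilbertBasis (Fin 2 → ℤ) ℂ MesoSpace := UnitAddTorus.mFourierBasis

/-- The vacuum: the normalized constant function. -/
def vacuum : MesoSpace := UnitAddTorus.mFourierLp 2 0

/-- The operator of multiplication by a continuous function of the two angles. -/
def mulOp (g : C(UnitAddTorus (Fin 2), ℂ)) : MesoSpace →L[ℂ] MesoSpace :=
  (ContinuousLinearMap.mul ℂ ℂ).holderL torusMeasure ∞ 2 2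
    (ContinuousMap.toLp ∞ torusMeasure ℂ g)

/-- The Weyl operator `e^{i (k_L φ̂_L + k_R φ̂_R)}`. -/
def weylPhase (kL kR : ℤ) : MesoSpace →L[ℂ] MesoSpace := mulOp (UnitAddTorus.mFourier ![kL, kR])

/-- The operator `cos (φ̂_L - φ̂_R)`. -/
def cosPhaseDiff : MesoSpace →L[ℂ] MesoSpace :=
  (1 / 2 : ℂ) • (weylPhase 1 (-1) + weylPhase (-1) 1)

/-- The sequence of Fourier coefficients of `ψ`, multiplied by `f (n 0) (n 1)`. -/
def momentumCoeff (f : ℤ → ℤ → ℝ) (ψ : MesoSpace) (n : Fin 2 → ℤ) : ℂ :=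
  (f (n 0) (n 1) : ℂ) * planeWaves.repr ψ n

theorem momentumCoeff_add (f : ℤ → ℤ → ℝ) (ψ χ : MesoSpace) :
    momentumCoeff f (ψ + χ) = momentumCoeff f ψ + momentumCoeff f χ := by
  funext n
  simp only [momentumCoeff, map_add, lp.coeFn_add, Pi.add_apply, mul_add]

theorem momentumCoeff_smul (f : ℤ → ℤ → ℝ) (c : ℂ) (ψ : MesoSpace) :
    momentumCoeff f (c • ψ) = c • momentumCoeff f ψ := by
  funext n
  simp only [momentumCoeff, map_smul, lp.coeFn_smul, Pi.smul_apply, smul_eq_mul, mul_left_comm]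

/-- The (in general unbounded) operator `f (p̂_L, p̂_R)`. The momenta `p̂ = -i ∂/∂θ` have the plane
waves as complete set of joint eigenvectors, with eigenvalues `n 0` and `n 1`; so `f (p̂_L, p̂_R)`
multiplies the `n`-th Fourier coefficient by `f (n 0) (n 1)`, and its domain consists of all `ψ` for
which the result is square summable. -/
def momentumFunction (f : ℤ → ℤ → ℝ) : MesoSpace →ₗ.[ℂ] MesoSpace where
  domain :=
    { carrier := {ψ | Memℓp (momentumCoeff f ψ) 2}
      add_mem' := fun {a b} ha hb => by
        rw [Set.mem_ofPred_eq, momentumCoeff_add]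
        exact Memℓp.add ha hb
      zero_mem' := by
        have h := momentumCoeff_smul f 0 0
        rw [zero_smul, zero_smul] at h
        rw [Set.mem_ofPred_eq, h]
        exact zero_memℓp
      smul_mem' := fun c a ha => by
        rw [Set.mem_ofPred_eq, momentumCoeff_smul]
        exact Memℓp.const_smul ha c }
  toFun :=
    { toFun := fun ψ => planeWaves.repr.symm ⟨momentumCoeff f ψ.1, ψ.2⟩
      map_add' := fun a b => by
        rw [← map_add]
        exact congrArg _ (Subtype.ext (momentumCoeff_add f a.1 b.1))
      map_smul' := fun c a => by
        rw [RingHom.id_apply, ← map_smul]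
        exact congrArg _ (Subtype.ext (momentumCoeff_smul f c a.1)) }

/-- The mesoscopic charge-qubit Hamiltonian
`𝓔_C ((p̂_L - p̂_R)/2 - n_g)² + 𝓔_J cos (φ̂_L - φ̂_R)`. -/
def qubitHamiltonian (EC ng EJ : ℝ) : MesoSpace →ₗ.[ℂ] MesoSpace :=
  (((EJ : ℂ) • cosPhaseDiff : MesoSpace →L[ℂ] MesoSpace) : MesoSpace →ₗ[ℂ] MesoSpace) +ᵥ
    momentumFunction fun nL nR => EC * (((nL : ℝ) - nR) / 2 - ng) ^ 2

/-- `U t = exp (-i t A)` for all `t`: `U` is the strongly continuous one-parameter unitary group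
whose generator (in the sense of Stone, domain included) is `A`. This determines `U` by `A`. -/
structure IsUnitaryGroupOf {E : Type*} [NormedAddCommGroup E] [InnerProductSpace ℂ E]
    [CompleteSpace E] (A : E →ₗ.[ℂ] E) (U : ℝ → E →L[ℂ] E) : Prop where
  unitary : ∀ t, U t ∈ unitary (E →L[ℂ] E)
  zero : U 0 = 1
  add : ∀ s t, U (s + t) = U s * U t
  continuous : ∀ ψ, Continuous fun t => U t ψ
  generator : ∀ ψ χ, HasDerivAt (fun t => U t ψ) χ 0 ↔
    ∃ h : ψ ∈ A.domain, χ = -Complex.I • A ⟨ψ, h⟩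

/-! ### The mesoscopic limit -/

/-- `G^N = (E_{L,-})^{a} (E_{L,+})^{a'} (E_{R,-})^{b} (E_{R,+})^{b'}`. -/
def excitation (cL cR : ℝ) (N a a' b b' : ℕ) : JunctionOp N :=
  ELminus cL N ^ a * ELplus cL N ^ a' * ERminus cR N ^ b * ERplus cR N ^ b'

/-- The mesoscopic limit of a sequence of two-layer operators `X N` is `Y`: all matrix elements
between the vectors `G^N |Ω^N_β⟩` converge to those of `Y` between the corresponding plane waves. -/
def IsMesoscopicLimit (β : ℝ) (L R : BCSLayer) (cL cR : ℝ) (X : (N : ℕ) → JunctionOp N)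
    (Y : MesoSpace →L[ℂ] MesoSpace) : Prop :=
  ∀ nL nL' nR nR' mL mL' mR mR' : ℕ,
    Tendsto
      (fun N => gnsExpect β L R N
        ((excitation cL cR N nL nL' nR nR')ᴴ * X N * excitation cL cR N mL mL' mR mR'))
      atTop
      (𝓝 (inner ℂ vacuum
        ((weylPhase (-((nL' : ℤ) - nL)) 0 * weylPhase 0 (-((nR' : ℤ) - nR)) * Y *
          weylPhase 0 ((mR' : ℤ) - mR) * weylPhase ((mL' : ℤ) - mL) 0) vacuum)))

end

end ChargeQubit

open ChargeQubit

/-! In a condensed layer `S₊` has asymptotically the fixed modulus `Δ N`, and only its phase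
fluctuates. Hence `E = S₊ / (Δ N)` acts asymptotically unitarily on the GNS vector, while it raises
the momentum `p` exactly by one. Integer powers of the two phase operators, with adjoints as
negative powers, produce from the GNS vector a family `modeVector` labelled by `ℤ²` which is
asymptotically orthonormal. On it the free Hamiltonian tends to zero, the capacitive term is exactly
diagonal, and tunnelling is a hop by `±(1, -1)` with amplitude `g = λ 𝔠_L 𝔠_R`. The mesoscopic
Hamiltonian acts in this way on plane waves, since the cosine is half the sum of two shifts.

The charging energies are unbounded, so convergence of the generators on these vectors must still be
turned into convergence of the evolutions. This is done by a Dyson expansion in the hopping. Its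
coefficients depend only on the on-site energies and `g`, and their `ℓ¹` norm at order `n` is at
most `(2 |g| |t|) ^ n / n!` whatever the on-site energies are (`sum_norm_dysonCoeff_le`). One finite
sum with the same coefficients therefore approximates both evolutions, and matrix elements reduce to
finitely many inner products (`eventually_norm_evolution_sub_dysonVector_le`,
`tendsto_inner_evolution`). Applied to Hamiltonians with cut-off on-site energies, the same
expansion constructs the limiting unitary group and leads to its generator
(`isUnitaryGroupOf_limit_evolution`).

The thermal input is a law of large numbers. The BCS Hamiltonian is a function of `S_z` and `S₊ S₋`,
so thermal expectations are averages over labels of total spin and weight. The multiplicities come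
from cyclicity of the trace between neighbouring weight spaces (`trace_weightProj_aeval`). The
statistical weights are exponentially peaked (`tendsto_bcsAverage_zero`) where twice the spin per
site is the root `r` of `tanh (β T_c r) = r` and twice the weight per site is `ε / T_c`. The gap
equation supplies this `r`, with `Δ² = (r² - (ε / T_c)²) / 4`, which is the limit of `S₊ S₋ / N²`;
hence `𝔠 = Δ`.

Concentration also gives `E E* Ω → Ω` and shows that the energy cost of a pair, the operator `Z` in
`[H, S₊] = S₊ Z`, tends to zero on `Ω`. The operators `H ⊗ 1 - 1 ⊗ H` and `p` annihilate the
purification exactly. -/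

namespace ChargeQubit
noncomputable section

/-! ### Bounded Hamiltonians and approximate solutions of the Schrödinger equation -/

section Evolution

variable {𝓗 : Type*} [NormedAddCommGroup 𝓗] [InnerProductSpace ℂ 𝓗] [CompleteSpace 𝓗]

/-- The evolution `exp (-i t A)` generated by a bounded operator. -/
def evolution (A : 𝓗 →L[ℂ] 𝓗) (t : ℝ) : 𝓗 →L[ℂ] 𝓗 :=
  NormedSpace.exp ((-Complex.I * (t : ℂ)) • A)

theorem evolution_zero (A : 𝓗 →L[ℂ] 𝓗) : evolution A 0 = 1 := by
  simp [evolution]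

theorem evolution_add (A : 𝓗 →L[ℂ] 𝓗) (s t : ℝ) :
    evolution A (s + t) = evolution A s * evolution A t := by
  unfold evolution
  let _ : NormedAlgebra ℚ (𝓗 →L[ℂ] 𝓗) := NormedAlgebra.restrictScalars ℚ ℂ _
  rw [← NormedSpace.exp_add_of_commute (((Commute.refl A).smul_left _).smul_right _), ← add_smul]
  push_cast
  rw [mul_add]

theorem star_evolution {A : 𝓗 →L[ℂ] 𝓗} (hA : IsSelfAdjoint A) (t : ℝ) :
    star (evolution A t) = evolution A (-t) := by
  unfold evolution
  rw [NormedSpace.star_exp, star_smul, hA.star_eq]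
  simp

theorem evolution_neg_mul (A : 𝓗 →L[ℂ] 𝓗) (t : ℝ) : evolution A (-t) * evolution A t = 1 := by
  rw [← evolution_add, neg_add_cancel, evolution_zero]

theorem inner_evolution {A : 𝓗 →L[ℂ] 𝓗} (hA : IsSelfAdjoint A) (t : ℝ) (x y : 𝓗) :
    inner ℂ (evolution A t x) y = inner ℂ x (evolution A (-t) y) := by
  rw [← star_evolution hA, ContinuousLinearMap.star_eq_adjoint,
    ContinuousLinearMap.adjoint_inner_right]

theorem norm_evolution {A : 𝓗 →L[ℂ] 𝓗} (hA : IsSelfAdjoint A) (t : ℝ) (x : 𝓗) :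
    ‖evolution A t x‖ = ‖x‖ := by
  have h : inner ℂ (evolution A t x) (evolution A t x) = inner ℂ x x := by
    rw [inner_evolution hA, ← mul_apply_eq_comp, evolution_neg_mul]
    rfl
  rw [inner_self_eq_norm_sq_to_K, inner_self_eq_norm_sq_to_K] at h
  have h' : ‖evolution A t x‖ ^ 2 = ‖x‖ ^ 2 := by exact_mod_cast h
  exact (pow_left_inj₀ (norm_nonneg _) (norm_nonneg _) two_ne_zero).1 h'

theorem hasDerivAt_evolution (A : 𝓗 →L[ℂ] 𝓗) (t : ℝ) :
    HasDerivAt (evolution A) (evolution A t * (-Complex.I • A)) t := by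
  have h := hasDerivAt_exp_smul_const (𝕂 := ℝ) (-Complex.I • A) t
  refine h.congr_of_eventuallyEq ?_ |>.congr_deriv ?_
  · refine Eventually.of_forall fun s => ?_
    simp only [evolution]
    rw [mul_comm, mul_smul]
    rfl
  · simp only [evolution]
    rw [mul_comm (-Complex.I), mul_smul]
    rfl

theorem hasDerivAt_evolution_apply (A : 𝓗 →L[ℂ] 𝓗) (x : 𝓗) (t : ℝ) :
    HasDerivAt (fun t => evolution A t x) (evolution A t (-Complex.I • A x)) t := by
  simpa [Function.comp_def] using ((ContinuousLinearMap.restrictScalarsL ℂ 𝓗 𝓗 ℝ ℝ).hasFDerivAt.comp_hasDerivAt t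
    (hasDerivAt_evolution A t)).clm_apply (hasDerivAt_const t x)

/-- Duhamel's principle: in the interaction picture `exp (i s A) w(s)` moves only with the residual
`r`, and unitarity preserves the size of the residual. The mean value inequality does the rest, for
both signs of the time. -/
theorem norm_evolution_sub_le {A : 𝓗 →L[ℂ] 𝓗} (hA : IsSelfAdjoint A) {w r : ℝ → 𝓗} {C T : ℝ}
    (hw : ∀ t, |t| ≤ T → HasDerivAt w (-Complex.I • A (w t) + r t) t)
    (hr : ∀ t, |t| ≤ T → ‖r t‖ ≤ C) {t : ℝ} (ht : |t| ≤ T) :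
    ‖evolution A t (w 0) - w t‖ ≤ C * |t| := by
  have hT : 0 ≤ T := (abs_nonneg t).trans ht
  have hd : ∀ s, |s| ≤ T →
      HasDerivAt (fun s => evolution A (-s) (w s)) (evolution A (-s) (r s)) s := by
    intro s hs
    have h1 : HasDerivAt (fun s : ℝ => evolution A (-s))
        (-(evolution A (-s) * (-Complex.I • A))) s := by
      simpa [Function.comp_def] using
        HasDerivAt.scomp s (hasDerivAt_evolution A (-s)) (hasDerivAt_neg s)
    have h2 : HasDerivAt (fun s => evolution A (-s) (w s)) _ s :=
      ((ContinuousLinearMap.restrictScalarsL ℂ 𝓗 𝓗 ℝ ℝ).hasFDerivAt.comp_hasDerivAt s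
        h1).clm_apply (hw s hs)
    refine h2.congr_deriv ?_
    simp
  have hb := Convex.norm_image_sub_le_of_norm_hasDerivWithin_le
    (f := fun s => evolution A (-s) (w s)) (f' := fun s => evolution A (-s) (r s)) (C := C)
    (s := Set.Icc (-T) T) (x := 0) (y := t)
    (fun s hs => (hd s (abs_le.2 hs)).hasDerivWithinAt)
    (fun s hs => (norm_evolution hA _ _).le.trans (hr s (abs_le.2 hs)))
    (convex_Icc _ _) ⟨by linarith, hT⟩ (abs_le.1 ht)
  have he : evolution A t (w 0) - w t
      = -(evolution A t (evolution A (-t) (w t) - evolution A (-0) (w 0))) := by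
    have : evolution A t (evolution A (-t) (w t)) = w t := by
      rw [← mul_apply_eq_comp, ← evolution_add, add_neg_cancel, evolution_zero]
      rfl
    rw [map_sub, this, neg_zero, evolution_zero]
    simp
  rw [he, norm_neg, norm_evolution hA]
  simpa using hb

end Evolution

/-! ### The Dyson expansion of a tight-binding chain -/

/-- The `n`-th order of the Dyson expansion, in the hopping `g`, of the amplitude at site `j` of a
chain with on-site energies `κ`, for the initial state localized at the origin. -/
def dysonCoeff (κ : ℤ → ℝ) (g : ℝ) : ℕ → ℤ → ℝ → ℂ
  | 0, j, t => if j = 0 then Complex.exp (-(Complex.I * κ j * t)) else 0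
  | n + 1, j, t => Complex.exp (-(Complex.I * κ j * t)) *
      ∫ s in (0 : ℝ)..t, -(Complex.I * g * Complex.exp (Complex.I * κ j * s)) *
        (dysonCoeff κ g n (j + 1) s + dysonCoeff κ g n (j - 1) s)

section Dyson

variable (κ : ℤ → ℝ) (g : ℝ)

theorem continuous_dysonCoeff (n : ℕ) (j : ℤ) : Continuous (dysonCoeff κ g n j) := by
  induction n generalizing j with
  | zero =>
    by_cases h : j = 0
    · simp only [dysonCoeff, h, if_true]
      fun_prop
    · simp only [dysonCoeff, h, if_false]
      fun_prop
  | succ n ih =>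
    simp only [dysonCoeff]
    refine Continuous.mul (by fun_prop) ?_
    refine intervalIntegral.continuous_primitive (fun a b => ?_) 0
    refine Continuous.intervalIntegrable ?_ _ _
    exact (by fun_prop : Continuous fun s : ℝ =>
      -(Complex.I * g * Complex.exp (Complex.I * κ j * s))).mul ((ih _).add (ih _))

theorem hasDerivAt_exp_phase (j : ℤ) (t : ℝ) :
    HasDerivAt (fun t : ℝ => Complex.exp (-(Complex.I * κ j * t)))
      (-(Complex.I * κ j) * Complex.exp (-(Complex.I * κ j * t))) t := by
  have h : HasDerivAt (fun t : ℝ => -(Complex.I * κ j * (t : ℂ))) (-(Complex.I * κ j)) t := by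
    simpa using ((Complex.ofRealCLM.hasDerivAt (x := t)).const_mul (Complex.I * κ j)).fun_neg
  exact (h.cexp).congr_deriv (mul_comm _ _)

theorem hasDerivAt_dysonCoeff_zero (j : ℤ) (t : ℝ) :
    HasDerivAt (dysonCoeff κ g 0 j) (-(Complex.I * κ j) * dysonCoeff κ g 0 j t) t := by
  by_cases h : j = 0
  · have : dysonCoeff κ g 0 j = fun t : ℝ => Complex.exp (-(Complex.I * κ j * t)) := by
      funext t
      simp [dysonCoeff, h]
    rw [this]
    exact hasDerivAt_exp_phase κ j t
  · have : dysonCoeff κ g 0 j = fun _ => 0 := by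
      funext t
      simp [dysonCoeff, h]
    rw [this]
    simpa using hasDerivAt_const t (0 : ℂ)

/-- Order `n` feeds order `n + 1` through the hopping term of the Schrödinger equation of the chain.
The phase in front of the integral produces the on-site term and cancels the opposite phase of the
integrand. -/
theorem hasDerivAt_dysonCoeff_succ (n : ℕ) (j : ℤ) (t : ℝ) :
    HasDerivAt (dysonCoeff κ g (n + 1) j)
      (-(Complex.I * κ j) * dysonCoeff κ g (n + 1) j t
        - Complex.I * g * (dysonCoeff κ g n (j + 1) t + dysonCoeff κ g n (j - 1) t)) t := by
  have hc : Continuous fun s : ℝ => -(Complex.I * g * Complex.exp (Complex.I * κ j * s)) *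
      (dysonCoeff κ g n (j + 1) s + dysonCoeff κ g n (j - 1) s) :=
    (by fun_prop : Continuous fun s : ℝ =>
      -(Complex.I * g * Complex.exp (Complex.I * κ j * s))).mul
      ((continuous_dysonCoeff κ g n _).add (continuous_dysonCoeff κ g n _))
  have h := (hasDerivAt_exp_phase κ j t).mul (hc.integral_hasStrictDerivAt 0 t).hasDerivAt
  have : dysonCoeff κ g (n + 1) j = fun t : ℝ => Complex.exp (-(Complex.I * κ j * t)) *
      ∫ s in (0 : ℝ)..t, -(Complex.I * g * Complex.exp (Complex.I * κ j * s)) *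
        (dysonCoeff κ g n (j + 1) s + dysonCoeff κ g n (j - 1) s) := by
    funext t
    simp [dysonCoeff]
  rw [this]
  refine h.congr_deriv ?_
  have he : Complex.exp (-(Complex.I * κ j * t)) * Complex.exp (Complex.I * κ j * t) = 1 := by
    rw [← Complex.exp_add, neg_add_cancel, Complex.exp_zero]
  linear_combination (-(Complex.I * g) *
    (dysonCoeff κ g n (j + 1) t + dysonCoeff κ g n (j - 1) t)) * he

/-- Each order of the expansion is one hop, so after `n` hops the walker is within distance `n` of
the origin. -/
theorem dysonCoeff_eq_zero {n : ℕ} {j : ℤ} (hj : j ∉ Finset.Icc (-(n : ℤ)) n) (t : ℝ) :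
    dysonCoeff κ g n j t = 0 := by
  induction n generalizing j t with
  | zero =>
    have : j ≠ 0 := by
      rintro rfl
      simp at hj
    simp [dysonCoeff, this]
  | succ n ih =>
    have h1 : ∀ s, dysonCoeff κ g n (j + 1) s = 0 :=
      ih (by simp only [Finset.mem_Icc] at hj ⊢; push_cast at hj; omega)
    have h2 : ∀ s, dysonCoeff κ g n (j - 1) s = 0 :=
      ih (by simp only [Finset.mem_Icc] at hj ⊢; push_cast at hj; omega)
    simp [dysonCoeff, h1, h2]

theorem norm_exp_phase (x t : ℝ) : ‖Complex.exp (Complex.I * x * t)‖ = 1 := by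
  rw [mul_assoc, mul_comm, ← Complex.ofReal_mul, Complex.norm_exp_ofReal_mul_I]

theorem norm_exp_neg_phase (x t : ℝ) : ‖Complex.exp (-(Complex.I * x * t))‖ = 1 := by
  rw [Complex.exp_neg, norm_inv, norm_exp_phase, inv_one]

/-- The on-site energies enter only through phases of modulus one, and one hop multiplies the `ℓ¹`
norm by at most `2 |g|`; the iterated time integrals give `|t| ^ n / n!`. The bound is uniform in
`κ`, which is what makes unbounded charging energies harmless. -/
theorem sum_norm_dysonCoeff_le (n : ℕ) (S : Finset ℤ) (t : ℝ) :
    ∑ j ∈ S, ‖dysonCoeff κ g n j t‖ ≤ (2 * |g| * |t|) ^ n / n.factorial := by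
  induction n generalizing S t with
  | zero =>
    have : ∀ j ∈ S, ‖dysonCoeff κ g 0 j t‖ ≤ if j = 0 then 1 else 0 := by
      intro j _
      by_cases h : j = 0
      · simp only [dysonCoeff, h, if_true, norm_exp_neg_phase, le_refl]
      · simp [dysonCoeff, h]
    refine (Finset.sum_le_sum this).trans ?_
    rw [Finset.sum_ite_eq']
    split_ifs <;> simp
  | succ n ih =>
    have hc : ∀ j, Continuous fun s : ℝ => -(Complex.I * g * Complex.exp (Complex.I * κ j * s)) *
        (dysonCoeff κ g n (j + 1) s + dysonCoeff κ g n (j - 1) s) := fun j =>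
      (by fun_prop : Continuous fun s : ℝ =>
        -(Complex.I * g * Complex.exp (Complex.I * κ j * s))).mul
        ((continuous_dysonCoeff κ g n _).add (continuous_dysonCoeff κ g n _))
    set F : ℤ → ℝ → ℂ := fun j s => -(Complex.I * g * Complex.exp (Complex.I * κ j * s)) *
        (dysonCoeff κ g n (j + 1) s + dysonCoeff κ g n (j - 1) s) with hF
    have hsum : ∀ s, ∑ j ∈ S, ‖F j s‖ ≤ 2 * |g| * ((2 * |g| * |s|) ^ n / n.factorial) := by
      intro s
      have h1 := ih (S.map (Equiv.addRight (1 : ℤ)).toEmbedding) s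
      have h2 := ih (S.map (Equiv.addRight (-1 : ℤ)).toEmbedding) s
      simp only [Finset.sum_map, Equiv.coe_toEmbedding, Equiv.coe_addRight] at h1 h2
      calc ∑ j ∈ S, ‖F j s‖ ≤ ∑ j ∈ S, |g| * (‖dysonCoeff κ g n (j + 1) s‖
            + ‖dysonCoeff κ g n (j + -1) s‖) := by
            refine Finset.sum_le_sum fun j _ => ?_
            simp only [hF, norm_mul, norm_neg, Complex.norm_I, norm_exp_phase, one_mul, mul_one,
              Complex.norm_real, Real.norm_eq_abs]
            exact mul_le_mul_of_nonneg_left (norm_add_le _ _) (abs_nonneg g)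
        _ = |g| * (∑ j ∈ S, ‖dysonCoeff κ g n (j + 1) s‖
            + ∑ j ∈ S, ‖dysonCoeff κ g n (j + -1) s‖) := by
            rw [← Finset.mul_sum, Finset.sum_add_distrib]
        _ ≤ |g| * ((2 * |g| * |s|) ^ n / n.factorial + (2 * |g| * |s|) ^ n / n.factorial) :=
            mul_le_mul_of_nonneg_left (add_le_add h1 h2) (abs_nonneg g)
        _ = _ := by ring
    -- Rescaling the integration variable to `[0, 1]` treats both signs of `t` at once; the
    -- integrand is then bounded by a multiple of `u ^ n`, which supplies the factor `1 / (n + 1)`.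
    have hint : ∀ j, ‖dysonCoeff κ g (n + 1) j t‖ ≤ |t| * ∫ u in (0 : ℝ)..1, ‖F j (t * u)‖ := by
      intro j
      have : dysonCoeff κ g (n + 1) j t
          = Complex.exp (-(Complex.I * κ j * t)) * ∫ s in (0 : ℝ)..t, F j s := rfl
      rw [this, norm_mul, norm_exp_neg_phase, one_mul]
      have h0 := intervalIntegral.smul_integral_comp_mul_left (a := 0) (b := 1) (F j) t
      rw [mul_zero, mul_one] at h0
      rw [← h0, norm_smul, Real.norm_eq_abs]
      exact mul_le_mul_of_nonneg_left
        (intervalIntegral.norm_integral_le_integral_norm zero_le_one) (abs_nonneg t)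
    have hcF : ∀ j, Continuous fun u : ℝ => ‖F j (t * u)‖ := fun j =>
      ((hc j).comp (continuous_const.mul continuous_id)).norm
    calc ∑ j ∈ S, ‖dysonCoeff κ g (n + 1) j t‖
        ≤ ∑ j ∈ S, |t| * ∫ u in (0 : ℝ)..1, ‖F j (t * u)‖ := Finset.sum_le_sum fun j _ => hint j
      _ = |t| * ∫ u in (0 : ℝ)..1, ∑ j ∈ S, ‖F j (t * u)‖ := by
          rw [← Finset.mul_sum, intervalIntegral.integral_finsetSum]
          exact fun j _ => (hcF j).intervalIntegrable _ _
      _ ≤ |t| * ∫ u in (0 : ℝ)..1, 2 * |g| * (2 * |g| * |t|) ^ n / n.factorial * u ^ n := by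
          refine mul_le_mul_of_nonneg_left ?_ (abs_nonneg t)
          refine intervalIntegral.integral_mono_on zero_le_one
            ((continuous_finsetSum _ fun j _ => hcF j).intervalIntegrable _ _)
            (Continuous.intervalIntegrable (by fun_prop) _ _) fun u hu => ?_
          refine (hsum (t * u)).trans_eq ?_
          rw [abs_mul, abs_of_nonneg hu.1]
          ring
      _ = (2 * |g| * |t|) ^ (n + 1) / (n + 1).factorial := by
          rw [intervalIntegral.integral_const_mul, integral_pow, Nat.factorial_succ]
          push_cast
          have : (n.factorial : ℝ) ≠ 0 := by positivity
          field_simp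
          simp only [one_pow, zero_pow (Nat.succ_ne_zero n), sub_zero, mul_one]
          ring

/-- The Dyson expansion up to order `n - 1`. -/
def dysonSum (n : ℕ) (j : ℤ) (t : ℝ) : ℂ := ∑ i ∈ Finset.range n, dysonCoeff κ g i j t

theorem dysonSum_eq_zero {n : ℕ} {j : ℤ} (hj : j ∉ Finset.Icc (-(n : ℤ)) n) (t : ℝ) :
    dysonSum κ g n j t = 0 := by
  refine Finset.sum_eq_zero fun i hi => dysonCoeff_eq_zero κ g ?_ t
  rw [Finset.mem_range] at hi
  simp only [Finset.mem_Icc] at hj ⊢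
  omega

theorem dysonSum_succ_apply_zero (n : ℕ) (j : ℤ) :
    dysonSum κ g (n + 1) j 0 = if j = 0 then 1 else 0 := by
  rw [dysonSum, Finset.sum_range_succ']
  simp [dysonCoeff]

theorem hasDerivAt_dysonSum_succ (n : ℕ) (j : ℤ) (t : ℝ) :
    HasDerivAt (dysonSum κ g (n + 1) j)
      (-(Complex.I * κ j) * dysonSum κ g (n + 1) j t
        - Complex.I * g * (dysonSum κ g n (j + 1) t + dysonSum κ g n (j - 1) t)) t := by
  have h : HasDerivAt (fun t => ∑ i ∈ Finset.range n, dysonCoeff κ g (i + 1) j t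
      + dysonCoeff κ g 0 j t) _ t :=
    (HasDerivAt.fun_sum fun i _ => hasDerivAt_dysonCoeff_succ κ g i j t).add
      (hasDerivAt_dysonCoeff_zero κ g j t)
  have he : dysonSum κ g (n + 1) j = fun t => ∑ i ∈ Finset.range n, dysonCoeff κ g (i + 1) j t
      + dysonCoeff κ g 0 j t := by
    funext t
    rw [dysonSum, Finset.sum_range_succ']
  rw [he]
  refine h.congr_deriv ?_
  simp only [dysonSum, mul_add, Finset.mul_sum, Finset.sum_sub_distrib, Finset.sum_add_distrib]
  ring

theorem sum_norm_dysonSum_le (n : ℕ) (S : Finset ℤ) (t : ℝ) :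
    ∑ j ∈ S, ‖dysonSum κ g n j t‖ ≤ Real.exp (2 * |g| * |t|) := by
  calc ∑ j ∈ S, ‖dysonSum κ g n j t‖
      ≤ ∑ j ∈ S, ∑ i ∈ Finset.range n, ‖dysonCoeff κ g i j t‖ :=
        Finset.sum_le_sum fun j _ => norm_sum_le _ _
    _ = ∑ i ∈ Finset.range n, ∑ j ∈ S, ‖dysonCoeff κ g i j t‖ := Finset.sum_comm
    _ ≤ ∑ i ∈ Finset.range n, (2 * |g| * |t|) ^ i / i.factorial :=
        Finset.sum_le_sum fun i _ => sum_norm_dysonCoeff_le κ g i S t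
    _ ≤ Real.exp (2 * |g| * |t|) := Real.sum_le_exp_of_nonneg (by positivity) n

/-- Both sides are sums over all of `ℤ`: the window is one site wider on each side than the support
of `c`, so a shift by `|d| ≤ 1` never leaves it. -/
theorem sum_Icc_smul_comp_add {E : Type*} [AddCommGroup E] [Module ℂ E] [TopologicalSpace E]
    [T2Space E] (c : ℤ → ℂ) (f : ℤ → E) {n : ℕ}
    (hc : ∀ j, j ∉ Finset.Icc (-(n : ℤ)) n → c j = 0) (d : ℤ) (hd : |d| ≤ 1) :
    ∑ j ∈ Finset.Icc (-((n + 1 : ℕ) : ℤ)) (n + 1 : ℕ), c (j + d) • f j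
      = ∑ j ∈ Finset.Icc (-((n + 1 : ℕ) : ℤ)) (n + 1 : ℕ), c j • f (j - d) := by
  rw [abs_le] at hd
  rw [← tsum_eq_sum (L := .unconditional ℤ) (f := fun j => c (j + d) • f j),
    ← tsum_eq_sum (L := .unconditional ℤ) (f := fun j => c j • f (j - d)),
    ← (Equiv.addRight d).tsum_eq (fun j => c j • f (j - d))]
  · simp
  · intro j hj
    rw [hc j (by simp only [Finset.mem_Icc] at hj ⊢; push_cast at hj; omega), zero_smul]
  · intro j hj
    rw [hc (j + d) (by simp only [Finset.mem_Icc] at hj ⊢; push_cast at hj; omega), zero_smul]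

end Dyson

/-! ### Approximation of evolutions by finite Dyson sums. -/

section DysonApproximation

variable {𝓗 : Type*} [NormedAddCommGroup 𝓗] [InnerProductSpace ℂ 𝓗]

/-- The approximate evolution, to order `n`, of the vector `f 0`. -/
def dysonVector (κ : ℤ → ℝ) (g : ℝ) (n : ℕ) (f : ℤ → 𝓗) (t : ℝ) : 𝓗 :=
  ∑ j ∈ Finset.Icc (-((n + 1 : ℕ) : ℤ)) (n + 1 : ℕ), dysonSum κ g (n + 1) j t • f j

theorem dysonVector_apply_zero (κ : ℤ → ℝ) (g : ℝ) (n : ℕ) (f : ℤ → 𝓗) :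
    dysonVector κ g n f 0 = f 0 := by
  simp only [dysonVector, dysonSum_succ_apply_zero, ite_smul, one_smul, zero_smul]
  rw [Finset.sum_ite_eq', if_pos]
  simp only [Finset.mem_Icc]
  omega

/-- The truncated expansion fails to solve the Schrödinger equation for two reasons, displayed
separately: `A` need not act on the `f j` exactly as a chain, and the hop out of the last order is
missing. -/
theorem hasDerivAt_dysonVector (κ : ℤ → ℝ) (g : ℝ) (n : ℕ) (f : ℤ → 𝓗) (A : 𝓗 →L[ℂ] 𝓗) (t : ℝ) :
    HasDerivAt (dysonVector κ g n f) (-Complex.I • A (dysonVector κ g n f t) +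
      (∑ j ∈ Finset.Icc (-((n + 1 : ℕ) : ℤ)) (n + 1 : ℕ),
        (Complex.I * dysonSum κ g (n + 1) j t) •
          (A (f j) - ((κ j : ℂ) • f j + (g : ℂ) • (f (j + 1) + f (j - 1))))
      + ∑ j ∈ Finset.Icc (-((n + 1 : ℕ) : ℤ)) (n + 1 : ℕ),
        (Complex.I * g * dysonCoeff κ g n j t) • (f (j + 1) + f (j - 1)))) t := by
  have h : HasDerivAt (dysonVector κ g n f) _ t := HasDerivAt.fun_sum fun j _ =>
    (hasDerivAt_dysonSum_succ κ g n j t).smul_const (f j)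
  refine h.congr_deriv ?_
  have h1 := sum_Icc_smul_comp_add (fun j => dysonSum κ g n j t) f
    (fun j hj => dysonSum_eq_zero κ g hj t) 1 (by norm_num)
  have h2 := sum_Icc_smul_comp_add (fun j => dysonSum κ g n j t) f
    (fun j hj => dysonSum_eq_zero κ g hj t) (-1) (by norm_num)
  simp only [sub_neg_eq_add, ← sub_eq_add_neg] at h1 h2
  have hs : ∀ j, dysonSum κ g (n + 1) j t = dysonSum κ g n j t + dysonCoeff κ g n j t := fun j =>
    Finset.sum_range_succ _ _
  calc ∑ j ∈ Finset.Icc (-((n + 1 : ℕ) : ℤ)) (n + 1 : ℕ),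
        (-(Complex.I * κ j) * dysonSum κ g (n + 1) j t
          - Complex.I * g * (dysonSum κ g n (j + 1) t + dysonSum κ g n (j - 1) t)) • f j
      = ∑ j ∈ Finset.Icc (-((n + 1 : ℕ) : ℤ)) (n + 1 : ℕ),
          (-(Complex.I * κ j) * dysonSum κ g (n + 1) j t) • f j
        - (Complex.I * g) • (∑ j ∈ Finset.Icc (-((n + 1 : ℕ) : ℤ)) (n + 1 : ℕ),
            dysonSum κ g n (j + 1) t • f j
          + ∑ j ∈ Finset.Icc (-((n + 1 : ℕ) : ℤ)) (n + 1 : ℕ), dysonSum κ g n (j - 1) t • f j) := by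
        rw [← Finset.sum_add_distrib, Finset.smul_sum, ← Finset.sum_sub_distrib]
        refine Finset.sum_congr rfl fun j _ => ?_
        module
    _ = _ := by
        rw [h1, h2, ← Finset.sum_add_distrib, Finset.smul_sum, ← Finset.sum_sub_distrib,
          dysonVector, map_sum, Finset.smul_sum, ← Finset.sum_add_distrib,
          ← Finset.sum_add_distrib]
        refine Finset.sum_congr rfl fun j _ => ?_
        rw [map_smul, hs]
        module

/-- The two residuals are bounded by the `ℓ¹` norms of the whole Dyson sum and of its last order.
The norm bound on `f` is needed one site beyond the summation window, because the truncation
residual contains both neighbours. -/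
theorem norm_evolution_sub_dysonVector_le [CompleteSpace 𝓗] {A : 𝓗 →L[ℂ] 𝓗} (hA : IsSelfAdjoint A) (κ : ℤ → ℝ)
    (g : ℝ) (n : ℕ) (f : ℤ → 𝓗) {η B T : ℝ} (hη : 0 ≤ η)
    (hf : ∀ j ∈ Finset.Icc (-((n + 2 : ℕ) : ℤ)) (n + 2 : ℕ), ‖f j‖ ≤ B)
    (herr : ∀ j ∈ Finset.Icc (-((n + 1 : ℕ) : ℤ)) (n + 1 : ℕ),
      ‖A (f j) - ((κ j : ℂ) • f j + (g : ℂ) • (f (j + 1) + f (j - 1)))‖ ≤ η) {t : ℝ} (ht : |t| ≤ T) :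
    ‖evolution A t (f 0) - dysonVector κ g n f t‖
      ≤ (Real.exp (2 * |g| * T) * η + 2 * |g| * B * ((2 * |g| * T) ^ n / n.factorial)) * T := by
  have hT : 0 ≤ T := (abs_nonneg t).trans ht
  have hB : 0 ≤ B := (norm_nonneg _).trans (hf 0 (by simp only [Finset.mem_Icc]; omega))
  have key := norm_evolution_sub_le hA (w := dysonVector κ g n f) (T := T)
    (C := Real.exp (2 * |g| * T) * η + 2 * |g| * B * ((2 * |g| * T) ^ n / n.factorial))
    (fun s _ => hasDerivAt_dysonVector κ g n f A s) (fun s hs => ?_) ht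
  · rw [dysonVector_apply_zero] at key
    refine key.trans (mul_le_mul_of_nonneg_left ht (by positivity))
  · refine (norm_add_le _ _).trans (add_le_add ?_ ?_)
    · calc ‖∑ j ∈ Finset.Icc (-((n + 1 : ℕ) : ℤ)) (n + 1 : ℕ), (Complex.I * dysonSum κ g (n + 1) j s) •
            (A (f j) - ((κ j : ℂ) • f j + (g : ℂ) • (f (j + 1) + f (j - 1))))‖
          ≤ ∑ j ∈ Finset.Icc (-((n + 1 : ℕ) : ℤ)) (n + 1 : ℕ), ‖dysonSum κ g (n + 1) j s‖ * η := by
            refine norm_sum_le_of_le _ fun j hj => ?_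
            rw [norm_smul, norm_mul, Complex.norm_I, one_mul]
            exact mul_le_mul_of_nonneg_left (herr j hj) (norm_nonneg _)
        _ ≤ Real.exp (2 * |g| * |s|) * η := by
            rw [← Finset.sum_mul]
            exact mul_le_mul_of_nonneg_right (sum_norm_dysonSum_le κ g _ _ s) hη
        _ ≤ Real.exp (2 * |g| * T) * η := by gcongr
    · calc ‖∑ j ∈ Finset.Icc (-((n + 1 : ℕ) : ℤ)) (n + 1 : ℕ),
            (Complex.I * g * dysonCoeff κ g n j s) • (f (j + 1) + f (j - 1))‖
          ≤ ∑ j ∈ Finset.Icc (-((n + 1 : ℕ) : ℤ)) (n + 1 : ℕ),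
              ‖dysonCoeff κ g n j s‖ * (2 * |g| * B) := by
            refine norm_sum_le_of_le _ fun j hj => ?_
            have h1 : ‖f (j + 1) + f (j - 1)‖ ≤ B + B := by
              refine norm_add_le_of_le (hf _ ?_) (hf _ ?_) <;>
              · simp only [Finset.mem_Icc] at hj ⊢
                push_cast at hj ⊢
                omega
            rw [norm_smul, norm_mul, norm_mul, Complex.norm_I, one_mul, Complex.norm_real,
              Real.norm_eq_abs]
            calc |g| * ‖dysonCoeff κ g n j s‖ * ‖f (j + 1) + f (j - 1)‖
                ≤ |g| * ‖dysonCoeff κ g n j s‖ * (B + B) := by gcongr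
              _ = _ := by ring
        _ ≤ (2 * |g| * |s|) ^ n / n.factorial * (2 * |g| * B) := by
            rw [← Finset.sum_mul]
            exact mul_le_mul_of_nonneg_right (sum_norm_dysonCoeff_le κ g _ _ s) (by positivity)
        _ ≤ (2 * |g| * T) ^ n / n.factorial * (2 * |g| * B) := by gcongr
        _ = _ := by ring

/-- Along a family of bounded Hamiltonians which act on the vectors `f i j`, asymptotically, as a
tight-binding chain, the Dyson expansion approximates the evolution, uniformly for bounded times. -/
theorem eventually_norm_evolution_sub_dysonVector_le {I : Type*} {l : Filter I} {𝓗 : I → Type*}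
    [∀ i, NormedAddCommGroup (𝓗 i)] [∀ i, InnerProductSpace ℂ (𝓗 i)] [∀ i, CompleteSpace (𝓗 i)]
    {A : ∀ i, 𝓗 i →L[ℂ] 𝓗 i} (hA : ∀ i, IsSelfAdjoint (A i)) (κ : ℤ → ℝ) (g : ℝ)
    (f : ∀ i, ℤ → 𝓗 i) (hf : ∀ j, ∀ᶠ i in l, ‖f i j‖ ≤ 2)
    (herr : ∀ j, Tendsto (fun i =>
      ‖A i (f i j) - ((κ j : ℂ) • f i j + (g : ℂ) • (f i (j + 1) + f i (j - 1)))‖) l (𝓝 0))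
    (T : ℝ) {η : ℝ} (hη : 0 < η) :
    ∀ᶠ n : ℕ in atTop, ∀ᶠ i in l, ∀ t, |t| ≤ T →
      ‖evolution (A i) t (f i 0) - dysonVector κ g n (f i) t‖ ≤ η := by
  rcases lt_or_ge T 0 with hT | hT
  · exact Eventually.of_forall fun n => Eventually.of_forall fun i t ht =>
      absurd ((abs_nonneg t).trans ht) (not_le.2 hT)
  have h1 : Tendsto (fun n : ℕ => 2 * |g| * 2 * ((2 * |g| * T) ^ n / n.factorial) * T) atTop
      (𝓝 0) := by
    simpa using ((FloorSemiring.tendsto_pow_div_factorial_atTop (2 * |g| * T)).const_mul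
      (2 * |g| * 2)).mul_const T
  have h2 : Tendsto (fun δ : ℝ => Real.exp (2 * |g| * T) * δ * T) (𝓝[>] 0) (𝓝 0) := by
    have : Continuous fun δ : ℝ => Real.exp (2 * |g| * T) * δ * T := by fun_prop
    have := (this.tendsto 0).mono_left (nhdsWithin_le_nhds (s := Set.Ioi (0 : ℝ)))
    simpa using this
  -- The tolerance `δ` for the chain relation is fixed before the order `n`: the exponential bound
  -- on the `ℓ¹` norm of the Dyson sum does not grow with `n`, which afterwards has to control only
  -- the truncation.
  obtain ⟨δ, hδ, hδ0⟩ :=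
    ((h2.eventually (gt_mem_nhds (half_pos hη))).and self_mem_nhdsWithin).exists
  filter_upwards [h1.eventually (gt_mem_nhds (half_pos hη))] with n hn
  have e1 : ∀ᶠ i in l, ∀ j ∈ Finset.Icc (-((n + 2 : ℕ) : ℤ)) (n + 2 : ℕ), ‖f i j‖ ≤ 2 :=
    (Filter.eventually_all_finset _).2 fun j _ => hf j
  have e2 : ∀ᶠ i in l, ∀ j ∈ Finset.Icc (-((n + 1 : ℕ) : ℤ)) (n + 1 : ℕ),
      ‖A i (f i j) - ((κ j : ℂ) • f i j + (g : ℂ) • (f i (j + 1) + f i (j - 1)))‖ ≤ δ :=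
    (Filter.eventually_all_finset _).2 fun j _ =>
      ((herr j).eventually (gt_mem_nhds hδ0)).mono fun i hi => hi.le
  filter_upwards [e1, e2] with i h1 h2 t ht
  refine (norm_evolution_sub_dysonVector_le (hA i) κ g n (f i) (le_of_lt hδ0) h1 h2 ht).trans ?_
  rw [add_mul]
  linarith

end DysonApproximation

/-! ### Unitary groups of lattice Hamiltonians with unbounded on-site energies -/

section Lattice

variable {𝓗 : Type*} [NormedAddCommGroup 𝓗] [InnerProductSpace ℂ 𝓗]

/-- The Hamiltonian with the on-site energies `κ` restricted to a finite set of sites. -/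
def cutoffHamiltonian {ι : Type*} (e : HilbertBasis ι ℂ 𝓗) (κ : ι → ℝ) (V : 𝓗 →L[ℂ] 𝓗)
    (F : Finset ι) : 𝓗 →L[ℂ] 𝓗 :=
  ∑ k ∈ F, (κ k : ℂ) • InnerProductSpace.rankOne ℂ (e k) (e k) + V

theorem cutoffHamiltonian_basis {ι : Type*} (e : HilbertBasis ι ℂ 𝓗) (κ : ι → ℝ)
    (V : 𝓗 →L[ℂ] 𝓗) {F : Finset ι} {k : ι} (hk : k ∈ F) :
    cutoffHamiltonian e κ V F (e k) = (κ k : ℂ) • e k + V (e k) := by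
  classical
  have h : ∀ j, inner ℂ (e j) (e k) = if j = k then (1 : ℂ) else 0 :=
    fun j => orthonormal_iff_ite.1 e.orthonormal j k
  simp [cutoffHamiltonian, InnerProductSpace.rankOne_apply, h, hk]

variable [CompleteSpace 𝓗]

theorem isSelfAdjoint_cutoffHamiltonian {ι : Type*} (e : HilbertBasis ι ℂ 𝓗) (κ : ι → ℝ)
    {V : 𝓗 →L[ℂ] 𝓗} (hV : IsSelfAdjoint V) (F : Finset ι) :
    IsSelfAdjoint (cutoffHamiltonian e κ V F) := by
  refine IsSelfAdjoint.add ?_ hV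
  refine isSelfAdjoint_sum _ fun k _ => ?_
  refine IsSelfAdjoint.smul (Complex.conj_ofReal _) ?_
  rw [ContinuousLinearMap.isSelfAdjoint_iff', InnerProductSpace.adjoint_rankOne]

variable {ι : Type*} {e : HilbertBasis ι ℂ 𝓗} {κ : ι → ℝ} {V : 𝓗 →L[ℂ] 𝓗}

/-- Once the finite set contains the site `k + j • δ`, the chain relation holds exactly there. The
approximating vector does not involve the cut-off `F`. -/
theorem eventually_dysonVector_cutoff [AddCommGroup ι] {g : ℝ} {δ : ι} (hVs : IsSelfAdjoint V)
    (hV : ∀ k, V (e k) = (g : ℂ) • (e (k + δ) + e (k - δ))) (k : ι) (T : ℝ) {η : ℝ} (hη : 0 < η) :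
    ∀ᶠ n : ℕ in atTop, ∀ᶠ F in atTop, ∀ t, |t| ≤ T →
      ‖evolution (cutoffHamiltonian e κ V F) t (e k)
        - dysonVector (fun j => κ (k + j • δ)) g n (fun j => e (k + j • δ)) t‖ ≤ η := by
  classical
  have h := eventually_norm_evolution_sub_dysonVector_le (l := atTop)
    (A := fun F : Finset ι => cutoffHamiltonian e κ V F)
    (isSelfAdjoint_cutoffHamiltonian e κ hVs) (fun j => κ (k + j • δ)) g
    (fun _ j => e (k + j • δ))
    (fun j => Eventually.of_forall fun _ => by rw [e.orthonormal.1]; norm_num) (fun j => ?_) T hη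
  · simpa using h
  · refine tendsto_const_nhds.congr' ?_
    filter_upwards [eventually_ge_atTop {k + j • δ}] with F hF
    rw [cutoffHamiltonian_basis e κ V (Finset.singleton_subset_iff.1 hF), hV, add_smul, sub_smul,
      one_smul, ← add_assoc, ← add_sub_assoc, sub_self, norm_zero]

/-- On a basis vector, the evolutions with two large cut-offs are close to the same Dyson vector.
Linearity extends this to the span of the basis, and density with unitarity to every vector. -/
theorem cutoff_evolution_cauchy [AddCommGroup ι] {g : ℝ} {δ : ι} (hVs : IsSelfAdjoint V)
    (hV : ∀ k, V (e k) = (g : ℂ) • (e (k + δ) + e (k - δ))) (T : ℝ) (ψ : 𝓗) :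
    ∀ η > 0, ∃ F₀ : Finset ι, ∀ F ≥ F₀, ∀ G ≥ F₀, ∀ t, |t| ≤ T →
      ‖evolution (cutoffHamiltonian e κ V F) t ψ - evolution (cutoffHamiltonian e κ V G) t ψ‖
        ≤ η := by
  classical
  have hspan : ∀ y ∈ Submodule.span ℂ (Set.range e), ∀ η > 0, ∃ F₀ : Finset ι, ∀ F ≥ F₀,
      ∀ G ≥ F₀, ∀ t, |t| ≤ T → ‖evolution (cutoffHamiltonian e κ V F) t y
        - evolution (cutoffHamiltonian e κ V G) t y‖ ≤ η := by
    intro y hy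
    induction hy using Submodule.span_induction with
    | mem x hx =>
      obtain ⟨k, rfl⟩ := hx
      intro η hη
      obtain ⟨n, hn⟩ := (eventually_dysonVector_cutoff (κ := κ) hVs hV k T (half_pos hη)).exists
      obtain ⟨F₀, h⟩ := eventually_atTop.1 hn
      refine ⟨F₀, fun F hF G hG t ht => ?_⟩
      have h1 := norm_sub_le_of_le (h F hF t ht) (h G hG t ht)
      rw [sub_sub_sub_cancel_right] at h1
      linarith
    | zero => exact fun η hη => ⟨∅, fun F _ G _ t _ => by simpa using hη.le⟩
    | add x y _ _ hx hy =>
      intro η hη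
      obtain ⟨F₁, h1⟩ := hx (η / 2) (half_pos hη)
      obtain ⟨F₂, h2⟩ := hy (η / 2) (half_pos hη)
      refine ⟨F₁ ∪ F₂, fun F hF G hG t ht => ?_⟩
      have := norm_add_le_of_le (h1 F (Finset.subset_union_left.trans hF) G
        (Finset.subset_union_left.trans hG) t ht) (h2 F (Finset.subset_union_right.trans hF) G
        (Finset.subset_union_right.trans hG) t ht)
      rw [map_add, map_add, add_sub_add_comm]
      linarith
    | smul c x _ hx =>
      intro η hη
      obtain ⟨F₁, h1⟩ := hx (η / (‖c‖ + 1)) (by positivity)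
      refine ⟨F₁, fun F hF G hG t ht => ?_⟩
      rw [map_smul, map_smul, ← smul_sub, norm_smul]
      calc ‖c‖ * _ ≤ ‖c‖ * (η / (‖c‖ + 1)) := by gcongr; exact h1 F hF G hG t ht
        _ ≤ (‖c‖ + 1) * (η / (‖c‖ + 1)) := by gcongr; linarith
        _ = η := by field_simp
  intro η hη
  have hd : Dense (Submodule.span ℂ (Set.range e) : Set 𝓗) := by
    rw [dense_iff_closure_eq, ← Submodule.topologicalClosure_coe, e.dense_span, Submodule.top_coe]
  obtain ⟨y, hy, hy'⟩ := hd.exists_dist_lt ψ (by positivity : 0 < η / 3)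
  obtain ⟨F₀, h⟩ := hspan y hy (η / 3) (by positivity)
  refine ⟨F₀, fun F hF G hG t ht => ?_⟩
  have hsa := isSelfAdjoint_cutoffHamiltonian e κ hVs
  have h3 := norm_evolution (hsa F) t (ψ - y)
  have h4 := norm_evolution (hsa G) t (ψ - y)
  rw [dist_eq_norm] at hy'
  have h5 := norm_add_le_of_le (h F hF G hG t ht) (norm_sub_le_of_le h3.le h4.le)
  simp only [map_sub] at h5
  refine le_trans (le_of_eq ?_) (h5.trans (by linarith))
  congr 1
  abel

/-- The evolutions with cut-off on-site energies converge, uniformly for bounded times. -/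
theorem exists_limit_cutoff_evolution [AddCommGroup ι] {g : ℝ} {δ : ι} (hVs : IsSelfAdjoint V)
    (hV : ∀ k, V (e k) = (g : ℂ) • (e (k + δ) + e (k - δ))) :
    ∃ U : ℝ → 𝓗 →L[ℂ] 𝓗, ∀ ψ T, TendstoUniformlyOn
      (fun F t => evolution (cutoffHamiltonian e κ V F) t ψ) (fun t => U t ψ) atTop
      (Set.Icc (-T) T) := by
  classical
  have hc : ∀ ψ T, UniformCauchySeqOn (fun F t => evolution (cutoffHamiltonian e κ V F) t ψ) atTop
      (Set.Icc (-T) T) := by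
    intro ψ T
    rw [Metric.uniformCauchySeqOn_iff]
    intro η hη
    obtain ⟨F₀, h⟩ := cutoff_evolution_cauchy (κ := κ) hVs hV T ψ (η / 2) (half_pos hη)
    refine ⟨F₀, fun F hF G hG t ht => ?_⟩
    rw [dist_eq_norm]
    exact (h F hF G hG t (abs_le.2 ht)).trans_lt (half_lt_self hη)
  have hl : ∀ ψ t, ∃ φ, Tendsto (fun F => evolution (cutoffHamiltonian e κ V F) t ψ) atTop
      (𝓝 φ) := fun ψ t => cauchySeq_tendsto_of_complete
    ((hc ψ |t|).cauchySeq (abs_le.1 le_rfl))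
  choose φ hφ using hl
  have hsa := isSelfAdjoint_cutoffHamiltonian e κ hVs
  let U : ℝ → 𝓗 →L[ℂ] 𝓗 := fun t => LinearMap.mkContinuous
    { toFun := fun ψ => φ ψ t
      map_add' := fun x y => tendsto_nhds_unique (hφ (x + y) t) (by
        simpa only [map_add] using (hφ x t).add (hφ y t))
      map_smul' := fun c x => tendsto_nhds_unique (hφ (c • x) t) (by
        simpa only [map_smul, RingHom.id_apply] using (hφ x t).const_smul c) } 1
    (fun x => by
      refine le_of_tendsto (hφ x t).norm (Eventually.of_forall fun F => ?_)
      rw [norm_evolution (hsa F), one_mul])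
  exact ⟨U, fun ψ T => (hc ψ T).tendstoUniformlyOn_of_tendsto fun t _ => hφ ψ t⟩

/-! ### The limiting unitary group, its generator and its matrix elements. -/

section Group

variable {U : ℝ → 𝓗 →L[ℂ] 𝓗}

theorem tendsto_cutoff_evolution (hU : ∀ ψ T, TendstoUniformlyOn
      (fun F t => evolution (cutoffHamiltonian e κ V F) t ψ) (fun t => U t ψ) atTop
      (Set.Icc (-T) T)) (ψ : 𝓗) (t : ℝ) :
    Tendsto (fun F => evolution (cutoffHamiltonian e κ V F) t ψ) atTop (𝓝 (U t ψ)) :=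
  (hU ψ |t|).tendsto_at (abs_le.1 le_rfl)

theorem norm_limit_evolution (hVs : IsSelfAdjoint V)
    (hU : ∀ ψ T, TendstoUniformlyOn
      (fun F t => evolution (cutoffHamiltonian e κ V F) t ψ) (fun t => U t ψ) atTop
      (Set.Icc (-T) T)) (ψ : 𝓗) (t : ℝ) : ‖U t ψ‖ = ‖ψ‖ := by
  refine tendsto_nhds_unique (tendsto_cutoff_evolution hU ψ t).norm ?_
  simp only [norm_evolution (isSelfAdjoint_cutoffHamiltonian e κ hVs _)]
  exact tendsto_const_nhds

theorem limit_evolution_zero (hU : ∀ ψ T, TendstoUniformlyOn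
      (fun F t => evolution (cutoffHamiltonian e κ V F) t ψ) (fun t => U t ψ) atTop
      (Set.Icc (-T) T)) : U 0 = 1 := by
  ext ψ
  refine tendsto_nhds_unique (tendsto_cutoff_evolution hU ψ 0) ?_
  simp only [evolution_zero]
  exact tendsto_const_nhds

/-- Strong limits can be multiplied here because the cut-off evolutions are isometric: replacing the
inner evolution by its limit costs only the norm of the difference. -/
theorem limit_evolution_add (hVs : IsSelfAdjoint V)
    (hU : ∀ ψ T, TendstoUniformlyOn
      (fun F t => evolution (cutoffHamiltonian e κ V F) t ψ) (fun t => U t ψ) atTop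
      (Set.Icc (-T) T)) (s t : ℝ) : U (s + t) = U s * U t := by
  ext ψ
  refine tendsto_nhds_unique (tendsto_cutoff_evolution hU ψ (s + t)) ?_
  have h1 := tendsto_cutoff_evolution hU (U t ψ) s
  have h2 : Tendsto (fun F => evolution (cutoffHamiltonian e κ V F) s
      (evolution (cutoffHamiltonian e κ V F) t ψ - U t ψ)) atTop (𝓝 0) := by
    rw [tendsto_zero_iff_norm_tendsto_zero]
    simp only [norm_evolution (isSelfAdjoint_cutoffHamiltonian e κ hVs _)]
    rw [← tendsto_zero_iff_norm_tendsto_zero, tendsto_sub_nhds_zero_iff]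
    exact tendsto_cutoff_evolution hU ψ t
  have h3 := h2.add h1
  rw [zero_add] at h3
  refine h3.congr fun F => ?_
  rw [← map_add, sub_add_cancel, evolution_add]
  rfl

theorem inner_limit_evolution (hVs : IsSelfAdjoint V)
    (hU : ∀ ψ T, TendstoUniformlyOn
      (fun F t => evolution (cutoffHamiltonian e κ V F) t ψ) (fun t => U t ψ) atTop
      (Set.Icc (-T) T)) (t : ℝ) (x y : 𝓗) : inner ℂ (U t x) y = inner ℂ x (U (-t) y) := by
  have h1 := (tendsto_cutoff_evolution hU x t).inner (tendsto_const_nhds (x := y)) (𝕜 := ℂ)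
  have h2 := (tendsto_const_nhds (x := x)).inner (tendsto_cutoff_evolution hU y (-t)) (𝕜 := ℂ)
  simp only [inner_evolution (isSelfAdjoint_cutoffHamiltonian e κ hVs _)] at h1
  exact tendsto_nhds_unique h1 h2

theorem limit_evolution_mem_unitary (hVs : IsSelfAdjoint V)
    (hU : ∀ ψ T, TendstoUniformlyOn
      (fun F t => evolution (cutoffHamiltonian e κ V F) t ψ) (fun t => U t ψ) atTop
      (Set.Icc (-T) T)) (t : ℝ) : U t ∈ unitary (𝓗 →L[ℂ] 𝓗) := by
  have h : star (U t) = U (-t) := by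
    rw [ContinuousLinearMap.star_eq_adjoint, eq_comm, ContinuousLinearMap.eq_adjoint_iff]
    intro x y
    rw [inner_limit_evolution hVs hU, neg_neg]
  rw [Unitary.mem_iff, h, ← limit_evolution_add hVs hU, ← limit_evolution_add hVs hU,
    neg_add_cancel, add_neg_cancel, limit_evolution_zero hU]
  exact ⟨rfl, rfl⟩

/-- A cut-off containing `k` does not change the Hamiltonian on `e k`, so the derivatives are
cut-off evolutions of one fixed vector, which converge locally uniformly in time. -/
theorem hasDerivAt_limit_evolution_basis
    (hU : ∀ ψ T, TendstoUniformlyOn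
      (fun F t => evolution (cutoffHamiltonian e κ V F) t ψ) (fun t => U t ψ) atTop
      (Set.Icc (-T) T)) (k : ι) (t : ℝ) :
    HasDerivAt (fun t => U t (e k)) (U t (-Complex.I • ((κ k : ℂ) • e k + V (e k)))) t := by
  classical
  have hs : Set.Ioo (-(|t| + 1)) (|t| + 1) ⊆ Set.Icc (-(|t| + 1)) (|t| + 1) := Set.Ioo_subset_Icc_self
  refine hasDerivAt_of_tendstoUniformlyOn
    (f := fun F t => evolution (cutoffHamiltonian e κ V F) t (e k))
    (f' := fun F t => evolution (cutoffHamiltonian e κ V F) t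
      (-Complex.I • ((κ k : ℂ) • e k + V (e k)))) (s := Set.Ioo (-(|t| + 1)) (|t| + 1))
    (g' := fun t => U t (-Complex.I • ((κ k : ℂ) • e k + V (e k))))
    (l := atTop) isOpen_Ioo ((hU _ _).mono hs) ?_ (fun s _ => tendsto_cutoff_evolution hU _ s)
    (abs_lt.1 (lt_add_one _))
  filter_upwards [eventually_ge_atTop {k}] with F hF s _
  rw [← cutoffHamiltonian_basis e κ V (Finset.singleton_subset_iff.1 hF)]
  exact hasDerivAt_evolution_apply _ _ _

theorem continuous_limit_evolution
    (hU : ∀ ψ T, TendstoUniformlyOn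
      (fun F t => evolution (cutoffHamiltonian e κ V F) t ψ) (fun t => U t ψ) atTop
      (Set.Icc (-T) T)) (ψ : 𝓗) : Continuous fun t => U t ψ := by
  rw [continuous_iff_continuousAt]
  intro t
  have h : ContinuousOn (fun t => U t ψ) (Set.Icc (-(|t| + 1)) (|t| + 1)) :=
    (hU ψ (|t| + 1)).continuousOn (Eventually.of_forall fun F =>
      (continuous_iff_continuousAt.2 fun s =>
        (hasDerivAt_evolution_apply _ ψ s).continuousAt).continuousOn).frequently
  refine h.continuousAt (Icc_mem_nhds ?_ ?_)
  · exact (abs_lt.1 (lt_add_one |t|)).1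
  · exact (abs_lt.1 (lt_add_one |t|)).2

/-- The hypothesis says in coordinates that `χ` is the full Hamiltonian applied to `ψ`. Partial sums
of the basis expansions of `ψ` and of `χ - V ψ` reduce the claim to basis vectors; isometry of `U`
makes the convergence of the derivatives uniform in time. -/
theorem hasDerivAt_limit_evolution (hVs : IsSelfAdjoint V)
    (hU : ∀ ψ T, TendstoUniformlyOn
      (fun F t => evolution (cutoffHamiltonian e κ V F) t ψ) (fun t => U t ψ) atTop
      (Set.Icc (-T) T)) {ψ χ : 𝓗} (h : ∀ k, e.repr (χ - V ψ) k = κ k * e.repr ψ k) (t : ℝ) :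
    HasDerivAt (fun t => U t ψ) (U t (-Complex.I • χ)) t := by
  have hψ : Tendsto (fun S : Finset ι => ∑ k ∈ S, e.repr ψ k • e k) atTop (𝓝 ψ) :=
    e.hasSum_repr ψ
  have hχ : Tendsto (fun S : Finset ι => ∑ k ∈ S, e.repr (χ - V ψ) k • e k) atTop
      (𝓝 (χ - V ψ)) := e.hasSum_repr _
  have hh : Tendsto (fun S : Finset ι => ∑ k ∈ S,
      e.repr ψ k • (-Complex.I • ((κ k : ℂ) • e k + V (e k)))) atTop (𝓝 (-Complex.I • χ)) := by
    have := (hχ.add ((V.continuous.tendsto ψ).comp hψ)).const_smul (-Complex.I)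
    rw [sub_add_cancel] at this
    refine this.congr fun S => ?_
    simp only [Function.comp_apply, map_sum, ← Finset.sum_add_distrib, Finset.smul_sum, h, map_smul]
    refine Finset.sum_congr rfl fun k _ => ?_
    module
  refine hasDerivAt_of_tendstoUniformly (l := atTop)
    (f := fun (S : Finset ι) t => U t (∑ k ∈ S, e.repr ψ k • e k))
    (f' := fun (S : Finset ι) t =>
      U t (∑ k ∈ S, e.repr ψ k • (-Complex.I • ((κ k : ℂ) • e k + V (e k)))))
    (g' := fun t => U t (-Complex.I • χ)) ?_ (Eventually.of_forall fun S s => ?_) (fun s => ?_) t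
  · rw [Metric.tendstoUniformly_iff]
    intro η hη
    filter_upwards [Metric.tendsto_nhds.1 hh η hη] with S hS s
    rw [dist_comm, dist_eq_norm, ← map_sub, norm_limit_evolution hVs hU, ← dist_eq_norm]
    exact hS
  · simp only [map_sum, map_smul (U _)]
    refine HasDerivAt.fun_sum fun k _ => ?_
    exact ((hasDerivAt_limit_evolution_basis hU k s).fun_const_smul (e.repr ψ k)).congr_deriv
      (by rw [map_smul (U s)])
  · exact ((U s).continuous.tendsto _).comp hψ

/-- The hypotheses identify `A` as `V` plus multiplication by `κ` on its maximal domain. If an orbit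
is differentiable at zero, testing it against the basis determines the coordinates of the
derivative, and their square summability puts the vector into that domain. -/
theorem isUnitaryGroupOf_limit_evolution (hVs : IsSelfAdjoint V)
    (hU : ∀ ψ T, TendstoUniformlyOn
      (fun F t => evolution (cutoffHamiltonian e κ V F) t ψ) (fun t => U t ψ) atTop
      (Set.Icc (-T) T)) {A : 𝓗 →ₗ.[ℂ] 𝓗}
    (hdom : ∀ ψ, ψ ∈ A.domain ↔ Memℓp (fun k => (κ k : ℂ) * e.repr ψ k) 2)
    (hA : ∀ (ψ : A.domain) (k : ι), e.repr (A ψ - V ψ) k = κ k * e.repr (ψ : 𝓗) k) :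
    IsUnitaryGroupOf A U where
  unitary := limit_evolution_mem_unitary hVs hU
  zero := limit_evolution_zero hU
  add := limit_evolution_add hVs hU
  continuous := continuous_limit_evolution hU
  generator ψ χ := by
    have hU0 : ∀ x, U 0 x = x := fun x => by rw [limit_evolution_zero hU]; rfl
    constructor
    · intro hd
      -- The function `⟨e k, U t ψ⟩` is differentiated twice over: directly, and after moving the
      -- evolution to `e k`, where the derivative is known.
      have key : ∀ k, e.repr (Complex.I • χ - V ψ) k = κ k * e.repr ψ k := by
        intro k
        have h1 : HasDerivAt (fun t => inner ℂ (e k) (U t ψ)) (inner ℂ (e k) χ) 0 := by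
          simpa using (hasDerivAt_const (0 : ℝ) (e k)).inner ℂ hd
        have h2 : HasDerivAt (fun t : ℝ => U (-t) (e k))
            (-(-Complex.I • ((κ k : ℂ) • e k + V (e k)))) 0 := by
          have h := hasDerivAt_limit_evolution_basis hU k (-0)
          rw [neg_zero, hU0, ← neg_zero] at h
          exact (HasDerivAt.scomp (0 : ℝ) h (hasDerivAt_neg 0)).congr_deriv (neg_one_smul _ _)
        have h3 : HasDerivAt (fun t : ℝ => inner ℂ (U (-t) (e k)) ψ)
            (inner ℂ (-(-Complex.I • ((κ k : ℂ) • e k + V (e k)))) ψ) 0 := by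
          refine (h2.inner ℂ (hasDerivAt_const (0 : ℝ) ψ)).congr_deriv ?_
          rw [inner_zero_right, zero_add]
        have h4 : (fun t : ℝ => inner ℂ (U (-t) (e k)) ψ) = fun t => inner ℂ (e k) (U t ψ) := by
          funext t
          rw [inner_limit_evolution hVs hU, neg_neg]
        rw [h4] at h3
        have h5 := h1.unique h3
        have h6 : inner ℂ (V (e k)) ψ = inner ℂ (e k) (V ψ) := by
          rw [← ContinuousLinearMap.adjoint_inner_right, ← ContinuousLinearMap.star_eq_adjoint,
            hVs.star_eq]
        rw [neg_smul, neg_neg, inner_smul_left, inner_add_left, inner_smul_left, h6,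
          Complex.conj_I, Complex.conj_ofReal] at h5
        simp only [e.repr_apply_apply, inner_sub_right, inner_smul_right]
        rw [h5]
        linear_combination (-(↑(κ k) * inner ℂ (e k) ψ + inner ℂ (e k) (V ψ))) * Complex.I_sq
      have hmem : ψ ∈ A.domain := by
        rw [hdom]
        have h := lp.memℓp (e.repr (Complex.I • χ - V ψ))
        rwa [funext key] at h
      refine ⟨hmem, ?_⟩
      have : A ⟨ψ, hmem⟩ - V ψ = Complex.I • χ - V ψ := by
        apply e.repr.injective
        ext k
        rw [key, hA ⟨ψ, hmem⟩ k]
      rw [sub_left_inj.1 this, smul_smul]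
      simp
    · rintro ⟨hmem, rfl⟩
      have := hasDerivAt_limit_evolution hVs hU (hA ⟨ψ, hmem⟩) 0
      rwa [hU0] at this

theorem eventually_dysonVector_limit_evolution [AddCommGroup ι] {g : ℝ} {δ : ι}
    (hVs : IsSelfAdjoint V) (hV : ∀ k, V (e k) = (g : ℂ) • (e (k + δ) + e (k - δ)))
    (hU : ∀ ψ T, TendstoUniformlyOn
      (fun F t => evolution (cutoffHamiltonian e κ V F) t ψ) (fun t => U t ψ) atTop
      (Set.Icc (-T) T)) (k : ι) (t : ℝ) {η : ℝ} (hη : 0 < η) :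
    ∀ᶠ n : ℕ in atTop, ‖U t (e k)
        - dysonVector (fun j => κ (k + j • δ)) g n (fun j => e (k + j • δ)) t‖ ≤ η := by
  filter_upwards [eventually_dysonVector_cutoff (κ := κ) hVs hV k |t| hη] with n hn
  exact le_of_tendsto ((tendsto_cutoff_evolution hU _ t).sub_const _).norm
    (hn.mono fun F hF => hF t le_rfl)

/-- Matrix elements of the evolutions of bounded Hamiltonians that act asymptotically as a lattice
Hamiltonian on asymptotically orthonormal vectors. -/
theorem tendsto_inner_evolution [AddCommGroup ι] [DecidableEq ι] {g : ℝ} {δ : ι}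
    (hVs : IsSelfAdjoint V) (hV : ∀ k, V (e k) = (g : ℂ) • (e (k + δ) + e (k - δ)))
    (hU : ∀ ψ T, TendstoUniformlyOn
      (fun F t => evolution (cutoffHamiltonian e κ V F) t ψ) (fun t => U t ψ) atTop
      (Set.Icc (-T) T)) {I : Type*} {l : Filter I}
    {𝓚 : I → Type*} [∀ i, NormedAddCommGroup (𝓚 i)] [∀ i, InnerProductSpace ℂ (𝓚 i)]
    [∀ i, CompleteSpace (𝓚 i)] {A : ∀ i, 𝓚 i →L[ℂ] 𝓚 i} (hA : ∀ i, IsSelfAdjoint (A i))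
    {f : ∀ i, ι → 𝓚 i}
    (hf : ∀ k m, Tendsto (fun i => inner ℂ (f i k) (f i m)) l (𝓝 (if k = m then 1 else 0)))
    (hAf : ∀ k, Tendsto (fun i => ‖A i (f i k)
      - ((κ k : ℂ) • f i k + (g : ℂ) • (f i (k + δ) + f i (k - δ)))‖) l (𝓝 0))
    {x y : ∀ i, 𝓚 i} {k m : ι} (hx : Tendsto (fun i => ‖x i - f i k‖) l (𝓝 0))
    (hy : Tendsto (fun i => ‖y i - f i m‖) l (𝓝 0)) (t : ℝ) :
    Tendsto (fun i => inner ℂ (x i) (evolution (A i) t (y i))) l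
      (𝓝 (inner ℂ (e k) (U t (e m)))) := by
  have hnorm : ∀ k, ∀ᶠ i in l, ‖f i k‖ ≤ 2 := by
    intro k
    have h := (hf k k).norm
    rw [if_pos rfl, norm_one] at h
    filter_upwards [h.eventually (gt_mem_nhds (by norm_num : (1 : ℝ) < 4))] with i hi
    rw [inner_self_eq_norm_sq_to_K, norm_pow, RCLike.norm_ofReal, abs_norm] at hi
    nlinarith [norm_nonneg (f i k)]
  have main : Tendsto (fun i => inner ℂ (f i k) (evolution (A i) t (f i m))) l
      (𝓝 (inner ℂ (e k) (U t (e m)))) := by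
    rw [Metric.tendsto_nhds]
    intro η hη
    have e1 := eventually_dysonVector_limit_evolution (κ := κ) hVs hV hU m t
      (by positivity : 0 < η / 4)
    have e2 := eventually_norm_evolution_sub_dysonVector_le (l := l) hA
      (fun j => κ (m + j • δ)) g (fun i j => f i (m + j • δ)) (fun j => hnorm _)
      (fun j => by
        have := hAf (m + j • δ)
        simpa only [add_smul, sub_smul, one_smul, add_assoc, add_sub_assoc] using this) |t| (by positivity : 0 < η / 8)
    -- One order `n` serves both sides. The two Dyson vectors have the same coefficients, so at
    -- fixed `n` their pairings with `f i k` and `e k` are the same finite combination of inner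
    -- products and its limit.
    obtain ⟨n, h1, h2⟩ := (e1.and e2).exists
    have h3 : Tendsto (fun i => inner ℂ (f i k)
        (dysonVector (fun j => κ (m + j • δ)) g n (fun j => f i (m + j • δ)) t)) l
        (𝓝 (inner ℂ (e k)
          (dysonVector (fun j => κ (m + j • δ)) g n (fun j => e (m + j • δ)) t))) := by
      simp only [dysonVector, inner_sum, inner_smul_right]
      refine tendsto_finsetSum _ fun j _ => ?_
      rw [orthonormal_iff_ite.1 e.orthonormal k]
      exact (hf k _).const_mul _
    filter_upwards [h2, hnorm k, Metric.tendsto_nhds.1 h3 (η / 4) (by positivity)]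
      with i hi1 hi2 hi3
    rw [dist_eq_norm] at hi3 ⊢
    set w := dysonVector (fun j => κ (m + j • δ)) g n (fun j => f i (m + j • δ)) t
    set z := dysonVector (fun j => κ (m + j • δ)) g n (fun j => e (m + j • δ)) t
    have b1 : ‖inner ℂ (f i k) (evolution (A i) t (f i m) - w)‖ ≤ 2 * (η / 8) := by
      refine (norm_inner_le_norm _ _).trans ?_
      have h := hi1 t le_rfl
      simp only [zero_smul, add_zero] at h
      gcongr
    have b2 : ‖inner ℂ (e k) (U t (e m) - z)‖ ≤ 1 * (η / 4) := by
      refine (norm_inner_le_norm _ _).trans ?_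
      rw [e.orthonormal.1]
      gcongr
    have : inner ℂ (f i k) (evolution (A i) t (f i m)) - inner ℂ (e k) (U t (e m))
        = inner ℂ (f i k) (evolution (A i) t (f i m) - w)
          + (inner ℂ (f i k) w - inner ℂ (e k) z) - inner ℂ (e k) (U t (e m) - z) := by
      rw [inner_sub_right, inner_sub_right]
      ring
    rw [this]
    have := norm_sub_le_of_le (norm_add_le_of_le b1 hi3.le) b2
    linarith
  have hzero : Tendsto (fun i => inner ℂ (x i - f i k) (evolution (A i) t (y i))
      + inner ℂ (f i k) (evolution (A i) t (y i - f i m))) l (𝓝 0) := by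
    rw [tendsto_zero_iff_norm_tendsto_zero]
    have hb : Tendsto (fun i => ‖x i - f i k‖ * (‖y i - f i m‖ + 2) + 2 * ‖y i - f i m‖) l
        (𝓝 0) := by
      have := (hx.mul (hy.add_const 2)).add (hy.const_mul 2)
      simpa using this
    refine squeeze_zero' (Eventually.of_forall fun _ => norm_nonneg _) ?_ hb
    filter_upwards [hnorm k, hnorm m] with i h1 h2
    refine norm_add_le_of_le ((norm_inner_le_norm _ _).trans ?_)
      ((norm_inner_le_norm _ _).trans ?_)
    · rw [norm_evolution (hA i)]
      gcongr
      calc ‖y i‖ = ‖(y i - f i m) + f i m‖ := by rw [sub_add_cancel]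
        _ ≤ _ := norm_add_le_of_le le_rfl h2
    · rw [norm_evolution (hA i)]
      gcongr
  have := main.add hzero
  rw [add_zero] at this
  refine this.congr fun i => ?_
  rw [inner_sub_left, map_sub, inner_sub_right]
  ring

end Group

end Lattice

/-! ### The mesoscopic Hamiltonian -/

theorem planeWaves_apply (n : Fin 2 → ℤ) : planeWaves n = UnitAddTorus.mFourierLp 2 n := by
  rw [planeWaves, UnitAddTorus.coe_mFourierBasis]

theorem vacuum_eq_planeWaves : vacuum = planeWaves 0 := (planeWaves_apply 0).symm

theorem weylPhase_planeWaves (a b : ℤ) (n : Fin 2 → ℤ) :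
    weylPhase a b (planeWaves n) = planeWaves (![a, b] + n) := by
  rw [planeWaves_apply, planeWaves_apply]
  apply Lp.ext
  have h1 := ContinuousLinearMap.coeFn_holder (r := 2) (ContinuousLinearMap.mul ℂ ℂ)
    (ContinuousMap.toLp ∞ torusMeasure ℂ (UnitAddTorus.mFourier ![a, b]))
    (UnitAddTorus.mFourierLp 2 n)
  have h2 := ContinuousMap.coeFn_toLp (p := ∞) torusMeasure (𝕜 := ℂ)
    (UnitAddTorus.mFourier ![a, b])
  have h3 := UnitAddTorus.coeFn_mFourierLp (d := Fin 2) 2 n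
  have h4 := UnitAddTorus.coeFn_mFourierLp (d := Fin 2) 2 (![a, b] + n)
  refine h1.trans ?_
  filter_upwards [h2, h3, h4] with x h2 h3 h4
  rw [h2, h4, UnitAddTorus.mFourier_add]
  erw [h3]
  rfl

/-- Both operators permute the plane waves, so their matrix elements are Kronecker deltas, and the
two index conditions are equivalent. -/
theorem star_weylPhase (a b : ℤ) : star (weylPhase a b) = weylPhase (-a) (-b) := by
  have hd : Dense (Submodule.span ℂ (Set.range planeWaves) : Set MesoSpace) := by
    rw [dense_iff_closure_eq, ← Submodule.topologicalClosure_coe, planeWaves.dense_span,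
      Submodule.top_coe]
  refine ContinuousLinearMap.ext_on hd ?_
  rintro _ ⟨n, rfl⟩
  apply planeWaves.repr.injective
  ext m
  have h : ∀ i j, inner ℂ (planeWaves i) (planeWaves j) = if i = j then (1 : ℂ) else 0 :=
    orthonormal_iff_ite.1 planeWaves.orthonormal
  rw [planeWaves.repr_apply_apply, planeWaves.repr_apply_apply,
    ContinuousLinearMap.star_eq_adjoint, ContinuousLinearMap.adjoint_inner_right,
    weylPhase_planeWaves, weylPhase_planeWaves, h, h]
  have : ![-a, -b] = -![a, b] := by simp
  rw [this]
  refine if_congr ⟨fun h => ?_, fun h => ?_⟩ rfl rfl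
  · rw [← h]; abel
  · rw [h]; abel

theorem isSelfAdjoint_cosPhaseDiff : IsSelfAdjoint cosPhaseDiff := by
  rw [IsSelfAdjoint, cosPhaseDiff, star_smul, star_add, star_weylPhase, star_weylPhase,
    neg_neg, add_comm]
  simp

theorem cosPhaseDiff_planeWaves (n : Fin 2 → ℤ) :
    cosPhaseDiff (planeWaves n)
      = (1 / 2 : ℂ) • (planeWaves (n + ![1, -1]) + planeWaves (n - ![1, -1])) := by
  have : ![-1, 1] = -![1, (-1 : ℤ)] := by simp
  simp only [cosPhaseDiff, _root_.smul_apply, _root_.add_apply,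
    weylPhase_planeWaves]
  rw [this, add_comm _ n, add_comm _ n, ← sub_eq_add_neg]

/-- The charging energy of the plane wave `n`. -/
def chargingEnergy (EC ng : ℝ) (n : Fin 2 → ℤ) : ℝ := EC * (((n 0 : ℝ) - n 1) / 2 - ng) ^ 2

theorem mem_domain_qubitHamiltonian (EC ng EJ : ℝ) (ψ : MesoSpace) :
    ψ ∈ (qubitHamiltonian EC ng EJ).domain ↔
      Memℓp (fun k => (chargingEnergy EC ng k : ℂ) * planeWaves.repr ψ k) 2 := Iff.rfl

theorem repr_qubitHamiltonian (EC ng EJ : ℝ) (ψ : (qubitHamiltonian EC ng EJ).domain)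
    (k : Fin 2 → ℤ) :
    planeWaves.repr (qubitHamiltonian EC ng EJ ψ - ((EJ : ℂ) • cosPhaseDiff) (ψ : MesoSpace)) k
      = chargingEnergy EC ng k * planeWaves.repr (ψ : MesoSpace) k := by
  have h : qubitHamiltonian EC ng EJ ψ - ((EJ : ℂ) • cosPhaseDiff) (ψ : MesoSpace)
      = planeWaves.repr.symm ⟨momentumCoeff (fun nL nR => EC * (((nL : ℝ) - nR) / 2 - ng) ^ 2)
        (ψ : MesoSpace), ψ.2⟩ := by
    rw [sub_eq_iff_eq_add']
    rfl
  rw [h, LinearIsometryEquiv.apply_symm_apply]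
  rfl

theorem weylPhase_mul_vacuum (a b : ℤ) :
    (weylPhase 0 b * weylPhase a 0) vacuum = planeWaves ![a, b] := by
  rw [vacuum_eq_planeWaves, mul_apply_eq_comp, weylPhase_planeWaves, weylPhase_planeWaves]
  simp

/-- The Weyl operators to the left of `Y` are the adjoints of those that build the plane wave out of
the vacuum. -/
theorem inner_vacuum_weylPhase (a b : ℤ) (Y : MesoSpace →L[ℂ] MesoSpace) (ψ : MesoSpace) :
    inner ℂ vacuum ((weylPhase (-a) 0 * weylPhase 0 (-b) * Y) ψ)
      = inner ℂ (planeWaves ![a, b]) (Y ψ) := by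
  have h1 : weylPhase (-a) 0 = star (weylPhase a 0) := by rw [star_weylPhase, neg_zero]
  have h2 : weylPhase 0 (-b) = star (weylPhase 0 b) := by rw [star_weylPhase, neg_zero]
  rw [← weylPhase_mul_vacuum, h1, h2, mul_apply_eq_comp, mul_apply_eq_comp,
    ContinuousLinearMap.star_eq_adjoint, ContinuousLinearMap.star_eq_adjoint,
    ContinuousLinearMap.adjoint_inner_right, ContinuousLinearMap.adjoint_inner_right,
    mul_apply_eq_comp]

/-! ### Condensates: asymptotically unitary phase operators -/

section Condensate

theorem tendsto_norm_add {I : Type*} {l : Filter I} {𝓗 : I → Type*} [∀ i, NormedAddCommGroup (𝓗 i)]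
    {x y : ∀ i, 𝓗 i} (hx : Tendsto (fun i => ‖x i‖) l (𝓝 0))
    (hy : Tendsto (fun i => ‖y i‖) l (𝓝 0)) : Tendsto (fun i => ‖x i + y i‖) l (𝓝 0) :=
  squeeze_zero (fun _ => norm_nonneg _) (fun _ => norm_add_le _ _) (by simpa using hx.add hy)

variable {I : Type*} {l : Filter I} {𝓗 : I → Type*} [∀ i, NormedAddCommGroup (𝓗 i)]
  [∀ i, InnerProductSpace ℂ (𝓗 i)]

theorem tendsto_norm_clm_apply {T : ∀ i, 𝓗 i →L[ℂ] 𝓗 i} (hT : ∃ C, ∀ i, ‖T i‖ ≤ C)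
    {x : ∀ i, 𝓗 i} (hx : Tendsto (fun i => ‖x i‖) l (𝓝 0)) :
    Tendsto (fun i => ‖T i (x i)‖) l (𝓝 0) := by
  obtain ⟨C, hC⟩ := hT
  refine squeeze_zero (fun _ => norm_nonneg _) (fun i => ?_) (by simpa using hx.const_mul C)
  exact (T i).le_of_opNorm_le (hC i) _

theorem tendsto_norm_clm_apply_of_bounded {T : ∀ i, 𝓗 i →L[ℂ] 𝓗 i}
    (hT : Tendsto (fun i => ‖T i‖) l (𝓝 0)) {x : ∀ i, 𝓗 i} (hx : ∃ C, ∀ᶠ i in l, ‖x i‖ ≤ C) :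
    Tendsto (fun i => ‖T i (x i)‖) l (𝓝 0) := by
  obtain ⟨C, hC⟩ := hx
  refine squeeze_zero' (Eventually.of_forall fun _ => norm_nonneg _) ?_
    (by simpa using hT.mul_const C)
  filter_upwards [hC] with i hi
  exact ((T i).le_opNorm _).trans (by gcongr)

theorem tendsto_norm_smul {x : ∀ i, 𝓗 i} (hx : Tendsto (fun i => ‖x i‖) l (𝓝 0)) (c : ℂ) :
    Tendsto (fun i => ‖c • x i‖) l (𝓝 0) := by
  simp only [norm_smul]
  simpa using hx.const_mul ‖c‖

theorem exists_norm_pow_le {T : ∀ i, 𝓗 i →L[ℂ] 𝓗 i} (hT : ∃ C, ∀ i, ‖T i‖ ≤ C) (n : ℕ) :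
    ∃ C, ∀ i, ‖T i ^ n‖ ≤ C := by
  obtain ⟨C, hC⟩ := hT
  induction n with
  | zero => exact ⟨1, fun i => by rw [pow_zero]; exact ContinuousLinearMap.norm_id_le⟩
  | succ n ih =>
    obtain ⟨B, hB⟩ := ih
    refine ⟨B * C, fun i => ?_⟩
    rw [pow_succ]
    exact (norm_mul_le _ _).trans
      (mul_le_mul (hB i) (hC i) (norm_nonneg _) ((norm_nonneg _).trans (hB i)))

variable [∀ i, CompleteSpace (𝓗 i)]

/-- A layer with the phase operator `E`, the momentum `P`, the free Hamiltonian `D`, and the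
detuning `Z`, which measures the energy carried by `E`. -/
structure PhaseLayer (l : Filter I) (E P D Z : ∀ i, 𝓗 i →L[ℂ] 𝓗 i) (τ : I → ℝ) : Prop where
  bounded : ∃ C, ∀ i, ‖E i‖ ≤ C
  normal : Tendsto (fun i => ‖E i * star (E i) - star (E i) * E i‖) l (𝓝 0)
  selfAdjoint_momentum : ∀ i, IsSelfAdjoint (P i)
  selfAdjoint_energy : ∀ i, IsSelfAdjoint (D i)
  selfAdjoint_detuning : ∀ i, IsSelfAdjoint (Z i)
  momentum : ∀ i, P i * E i = E i * P i + E i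
  energy : ∀ i, D i * E i = E i * D i + E i * Z i
  detuning : ∀ i, Z i * E i = E i * Z i + (τ i : ℂ) • E i
  tendsto_zero : Tendsto τ l (𝓝 0)

/-- The vectors `Ω` are asymptotically condensed states of the layer, without excitations. -/
structure IsCondensate (l : Filter I) (E P D Z : ∀ i, 𝓗 i →L[ℂ] 𝓗 i) (Ω : ∀ i, 𝓗 i) :
    Prop where
  norm : Tendsto (fun i => ‖Ω i‖) l (𝓝 1)
  pairing : Tendsto (fun i => ‖E i (star (E i) (Ω i)) - Ω i‖) l (𝓝 0)
  momentum : ∀ i, P i (Ω i) = 0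
  energy : Tendsto (fun i => ‖D i (Ω i)‖) l (𝓝 0)
  detuning : Tendsto (fun i => ‖Z i (Ω i)‖) l (𝓝 0)

variable {E P D Z : ∀ i, 𝓗 i →L[ℂ] 𝓗 i} {τ : I → ℝ} {Ω : ∀ i, 𝓗 i}

/-- Exchanging raising and lowering is a symmetry of the relations. The detuning becomes `τ - Z`
because commuting `Z` past `E*` costs a further `τ`. Every statement about positive powers thereby
yields the one about negative powers. -/
theorem PhaseLayer.conj (h : PhaseLayer l E P D Z τ) :
    PhaseLayer l (fun i => star (E i)) (fun i => -P i) D (fun i => (τ i : ℂ) • 1 - Z i) τ where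
  bounded := by simpa only [norm_star] using h.bounded
  normal := by
    refine h.normal.congr fun i => ?_
    rw [star_star, norm_sub_rev]
  selfAdjoint_momentum i := (h.selfAdjoint_momentum i).neg
  selfAdjoint_energy := h.selfAdjoint_energy
  selfAdjoint_detuning i :=
    (IsSelfAdjoint.smul (Complex.conj_ofReal _) (IsSelfAdjoint.one _)).sub (h.selfAdjoint_detuning i)
  momentum i := by
    have := congrArg star (h.momentum i)
    simp only [star_mul, star_add, (h.selfAdjoint_momentum i).star_eq] at this
    rw [mul_neg, this]
    noncomm_ring
  energy i := by
    have h1 := congrArg star (h.energy i)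
    have h2 := congrArg star (h.detuning i)
    simp only [star_mul, star_add, (h.selfAdjoint_energy i).star_eq, star_smul,
      (h.selfAdjoint_detuning i).star_eq, Complex.star_def, Complex.conj_ofReal] at h1 h2
    rw [h1, mul_sub, h2, mul_smul_comm, mul_one]
    abel
  detuning i := by
    have h2 := congrArg star (h.detuning i)
    simp only [star_mul, star_add, star_smul,
      (h.selfAdjoint_detuning i).star_eq, Complex.star_def, Complex.conj_ofReal] at h2
    rw [mul_sub, sub_mul, h2, smul_mul_assoc, one_mul, mul_smul_comm, mul_one]
    abel
  tendsto_zero := h.tendsto_zero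

theorem IsCondensate.exists_norm_le (hΩ : IsCondensate l E P D Z Ω) :
    ∃ C, ∀ᶠ i in l, ‖Ω i‖ ≤ C :=
  ⟨2, (hΩ.norm.eventually (gt_mem_nhds one_lt_two)).mono fun _ h => h.le⟩

/-- Asymptotic normality is what converts `E E* Ω → Ω` into `E* E Ω → Ω`. -/
theorem IsCondensate.conj (h : PhaseLayer l E P D Z τ) (hΩ : IsCondensate l E P D Z Ω) :
    IsCondensate l (fun i => star (E i)) (fun i => -P i) D (fun i => (τ i : ℂ) • 1 - Z i) Ω where
  norm := hΩ.norm
  pairing := by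
    have h1 := tendsto_norm_add hΩ.pairing (tendsto_norm_smul
      (tendsto_norm_clm_apply_of_bounded h.normal hΩ.exists_norm_le) (-1))
    refine h1.congr fun i => congrArg _ ?_
    simp only [_root_.sub_apply, mul_apply_eq_comp, star_star]
    module
  momentum i := by rw [_root_.neg_apply, hΩ.momentum, neg_zero]
  energy := hΩ.energy
  detuning := by
    have h1 : Tendsto (fun i => ‖(τ i : ℂ) • Ω i‖) l (𝓝 0) := by
      simp only [norm_smul, Complex.norm_real]
      simpa using h.tendsto_zero.norm.mul hΩ.norm
    refine (tendsto_norm_add h1 (tendsto_norm_smul hΩ.detuning (-1))).congr fun i =>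
      congrArg _ ?_
    simp only [_root_.sub_apply, _root_.smul_apply, one_apply_eq_self]
    module

theorem exists_norm_pow_apply_le (h : PhaseLayer l E P D Z τ) (hΩ : IsCondensate l E P D Z Ω)
    (n : ℕ) : ∃ C, ∀ᶠ i in l, ‖(E i ^ n) (Ω i)‖ ≤ C := by
  obtain ⟨B, hB⟩ := exists_norm_pow_le h.bounded n
  obtain ⟨C, hC⟩ := hΩ.exists_norm_le
  refine ⟨B * C, hC.mono fun i hi => ?_⟩
  exact ((E i ^ n).le_of_opNorm_le (hB i) _).trans
    (mul_le_mul_of_nonneg_left hi ((norm_nonneg _).trans (hB i)))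

theorem clm_commute_apply {V : Type*} [NormedAddCommGroup V] [InnerProductSpace ℂ V]
    {S T : V →L[ℂ] V} (h : Commute S T) (x : V) : S (T x) = T (S x) := by
  rw [← mul_apply_eq_comp, h.eq, mul_apply_eq_comp]

theorem clm_pow_succ_apply {V : Type*} [NormedAddCommGroup V] [InnerProductSpace ℂ V]
    (T : V →L[ℂ] V) (n : ℕ) (x : V) : (T ^ (n + 1)) x = T ((T ^ n) x) := by
  rw [pow_succ', mul_apply_eq_comp]

theorem PhaseLayer.momentum_pow (h : PhaseLayer l E P D Z τ) (hΩ : IsCondensate l E P D Z Ω)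
    (n : ℕ) (i : I) : P i ((E i ^ n) (Ω i)) = (n : ℂ) • (E i ^ n) (Ω i) := by
  induction n with
  | zero => simp [hΩ.momentum]
  | succ n ih =>
    rw [clm_pow_succ_apply, ← mul_apply_eq_comp, h.momentum, _root_.add_apply, mul_apply_eq_comp, ih, map_smul]
    push_cast
    module

/-- Each factor `E` shifts `Z` by `τ`, and a fixed number of vanishing shifts is negligible. -/
theorem PhaseLayer.detuning_pow (h : PhaseLayer l E P D Z τ) (hΩ : IsCondensate l E P D Z Ω)
    (n : ℕ) : Tendsto (fun i => ‖Z i ((E i ^ n) (Ω i))‖) l (𝓝 0) := by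
  induction n with
  | zero => simpa using hΩ.detuning
  | succ n ih =>
    have h1 : Tendsto (fun i => ‖(τ i : ℂ) • (E i ^ (n + 1)) (Ω i)‖) l (𝓝 0) := by
      obtain ⟨C, hC⟩ := exists_norm_pow_apply_le h hΩ (n + 1)
      refine squeeze_zero' (Eventually.of_forall fun _ => norm_nonneg _) ?_
        (by simpa using h.tendsto_zero.norm.mul_const C)
      filter_upwards [hC] with i hi
      rw [norm_smul, Complex.norm_real]
      exact mul_le_mul_of_nonneg_left hi (norm_nonneg _)
    refine (tendsto_norm_add (tendsto_norm_clm_apply h.bounded ih) h1).congr fun i =>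
      congrArg _ ?_
    have := congrArg (fun T => T ((E i ^ n) (Ω i))) (h.detuning i)
    rw [clm_pow_succ_apply]
    exact this.symm

/-- Commuting `D` through one `E` leaves the term `E Z E ^ n Ω`, which is small because the detuning
is small on excited vectors too. -/
theorem PhaseLayer.energy_pow (h : PhaseLayer l E P D Z τ) (hΩ : IsCondensate l E P D Z Ω)
    (n : ℕ) : Tendsto (fun i => ‖D i ((E i ^ n) (Ω i))‖) l (𝓝 0) := by
  induction n with
  | zero => simpa using hΩ.energy
  | succ n ih =>
    refine (tendsto_norm_add (tendsto_norm_clm_apply h.bounded ih)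
      (tendsto_norm_clm_apply h.bounded (h.detuning_pow hΩ n))).congr fun i => congrArg _ ?_
    have := congrArg (fun T => T ((E i ^ n) (Ω i))) (h.energy i)
    rw [clm_pow_succ_apply]
    exact this.symm

/-- By normality `E* E` may be replaced by `E E*` on bounded vectors; the claim at `n` then gives `E
E* E ^ (n + 1) Ω ≈ E ^ (n + 1) Ω`, which is the input of `key` at the next order. -/
theorem PhaseLayer.lower_pow (h : PhaseLayer l E P D Z τ) (hΩ : IsCondensate l E P D Z Ω)
    (n : ℕ) : Tendsto (fun i => ‖star (E i) ((E i ^ (n + 1)) (Ω i)) - (E i ^ n) (Ω i)‖) l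
      (𝓝 0) := by
  have key : ∀ n, Tendsto (fun i => ‖E i (star (E i) ((E i ^ n) (Ω i))) - (E i ^ n) (Ω i)‖) l
      (𝓝 0) → Tendsto (fun i => ‖star (E i) ((E i ^ (n + 1)) (Ω i)) - (E i ^ n) (Ω i)‖) l
      (𝓝 0) := by
    intro n hn
    refine (tendsto_norm_add hn (tendsto_norm_smul (tendsto_norm_clm_apply_of_bounded h.normal
      (exists_norm_pow_apply_le h hΩ n)) (-1))).congr fun i => congrArg _ ?_
    rw [clm_pow_succ_apply]
    simp only [_root_.sub_apply, mul_apply_eq_comp]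
    module
  induction n with
  | zero => exact key 0 (by simpa using hΩ.pairing)
  | succ n ih =>
    refine key _ ((tendsto_norm_clm_apply h.bounded ih).congr fun i => congrArg _ ?_)
    rw [map_sub, ← clm_pow_succ_apply]

/-- The squared norm at order `n + 1` is the inner product of `E ^ n Ω` with `E* E ^ (n + 1) Ω ≈ E ^
n Ω`. -/
theorem PhaseLayer.norm_pow (h : PhaseLayer l E P D Z τ) (hΩ : IsCondensate l E P D Z Ω)
    (n : ℕ) : Tendsto (fun i => ‖(E i ^ n) (Ω i)‖) l (𝓝 1) := by
  induction n with
  | zero => simpa using hΩ.norm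
  | succ n ih =>
    have h1 : Tendsto (fun i => ‖inner ℂ ((E i ^ n) (Ω i))
        (star (E i) ((E i ^ (n + 1)) (Ω i)) - (E i ^ n) (Ω i))‖) l (𝓝 0) := by
      refine squeeze_zero (fun _ => norm_nonneg _) (fun i => norm_inner_le_norm _ _) ?_
      simpa using ih.mul (h.lower_pow hΩ n)
    have h2 : Tendsto (fun i => ‖(E i ^ (n + 1)) (Ω i)‖ ^ 2 - ‖(E i ^ n) (Ω i)‖ ^ 2) l (𝓝 0) := by
      rw [tendsto_zero_iff_norm_tendsto_zero]
      refine h1.congr fun i => ?_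
      rw [inner_sub_right, ContinuousLinearMap.star_eq_adjoint,
        ContinuousLinearMap.adjoint_inner_right, ← clm_pow_succ_apply,
        inner_self_eq_norm_sq_to_K, inner_self_eq_norm_sq_to_K]
      norm_cast
    have h3 : Tendsto (fun i => ‖(E i ^ (n + 1)) (Ω i)‖ ^ 2) l (𝓝 1) := by
      simpa using h2.add (ih.pow 2)
    have h4 := (Real.continuous_sqrt.tendsto 1).comp h3
    rw [Real.sqrt_one] at h4
    exact h4.congr fun i => Real.sqrt_sq (norm_nonneg _)

/-- Integer powers, with the adjoint in the role of the inverse. -/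
def ladder {V : Type*} [NormedAddCommGroup V] [InnerProductSpace ℂ V] [CompleteSpace V]
    (T : V →L[ℂ] V) : ℤ → V →L[ℂ] V
  | Int.ofNat n => T ^ n
  | Int.negSucc n => star T ^ (n + 1)

theorem ladder_commute {V : Type*} [NormedAddCommGroup V] [InnerProductSpace ℂ V]
    [CompleteSpace V] {T S : V →L[ℂ] V} (h : Commute S T) (h' : Commute S (star T)) (k : ℤ) :
    Commute S (ladder T k) := by
  cases k with
  | ofNat n => exact h.pow_right n
  | negSucc n => exact h'.pow_right (n + 1)

theorem exists_norm_ladder_le {T : ∀ i, 𝓗 i →L[ℂ] 𝓗 i} (hT : ∃ C, ∀ i, ‖T i‖ ≤ C) (k : ℤ) :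
    ∃ C, ∀ i, ‖ladder (T i) k‖ ≤ C := by
  cases k with
  | ofNat n => exact exists_norm_pow_le hT n
  | negSucc n =>
    exact exists_norm_pow_le (T := fun i => star (T i)) (by simpa only [norm_star] using hT) _

theorem PhaseLayer.momentum_ladder (h : PhaseLayer l E P D Z τ) (hΩ : IsCondensate l E P D Z Ω)
    (k : ℤ) (i : I) : P i (ladder (E i) k (Ω i)) = (k : ℂ) • ladder (E i) k (Ω i) := by
  cases k with
  | ofNat n => exact h.momentum_pow hΩ n i
  | negSucc n =>
    have := h.conj.momentum_pow (hΩ.conj h) (n + 1) i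
    rw [_root_.neg_apply, neg_eq_iff_eq_neg, ← neg_smul] at this
    simpa [ladder] using this

theorem PhaseLayer.energy_ladder (h : PhaseLayer l E P D Z τ) (hΩ : IsCondensate l E P D Z Ω)
    (k : ℤ) : Tendsto (fun i => ‖D i (ladder (E i) k (Ω i))‖) l (𝓝 0) := by
  cases k with
  | ofNat n => exact h.energy_pow hΩ n
  | negSucc n => exact h.conj.energy_pow (hΩ.conj h) (n + 1)

theorem PhaseLayer.norm_ladder (h : PhaseLayer l E P D Z τ) (hΩ : IsCondensate l E P D Z Ω)
    (k : ℤ) : Tendsto (fun i => ‖ladder (E i) k (Ω i)‖) l (𝓝 1) := by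
  cases k with
  | ofNat n => exact h.norm_pow hΩ n
  | negSucc n => exact h.conj.norm_pow (hΩ.conj h) (n + 1)

/-- For nonnegative `k` this is the definition of a power. For negative `k` the operator `E` undoes
one adjoint, which is `PhaseLayer.lower_pow` for the conjugate layer. -/
theorem PhaseLayer.raise_ladder (h : PhaseLayer l E P D Z τ) (hΩ : IsCondensate l E P D Z Ω)
    (k : ℤ) :
    Tendsto (fun i => ‖E i (ladder (E i) k (Ω i)) - ladder (E i) (k + 1) (Ω i)‖) l (𝓝 0) := by
  match k with
  | Int.ofNat n =>
    refine tendsto_const_nhds.congr fun i => ?_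
    have : ladder (E i) (Int.ofNat n + 1) = E i ^ (n + 1) := rfl
    rw [this, clm_pow_succ_apply]
    simp [ladder]
  | Int.negSucc 0 =>
    refine (h.conj.lower_pow (hΩ.conj h) 0).congr fun i => ?_
    have : ladder (E i) (Int.negSucc 0 + 1) = E i ^ 0 := rfl
    rw [this]
    simp [ladder]
  | Int.negSucc (n + 1) =>
    refine (h.conj.lower_pow (hΩ.conj h) (n + 1)).congr fun i => ?_
    have : ladder (E i) (Int.negSucc (n + 1) + 1) = star (E i) ^ (n + 1) := rfl
    rw [this]
    simp [ladder]

theorem PhaseLayer.lower_ladder (h : PhaseLayer l E P D Z τ) (hΩ : IsCondensate l E P D Z Ω)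
    (k : ℤ) :
    Tendsto (fun i => ‖star (E i) (ladder (E i) k (Ω i)) - ladder (E i) (k - 1) (Ω i)‖) l
      (𝓝 0) := by
  match k with
  | Int.ofNat 0 =>
    refine tendsto_const_nhds.congr fun i => ?_
    have : ladder (E i) (Int.ofNat 0 - 1) = star (E i) ^ (0 + 1) := rfl
    rw [this, clm_pow_succ_apply]
    simp [ladder]
  | Int.ofNat (n + 1) =>
    refine (h.lower_pow hΩ n).congr fun i => ?_
    have h0 : Int.ofNat (n + 1) - 1 = Int.ofNat n := by simp
    rw [h0]
    rfl
  | Int.negSucc n =>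
    refine tendsto_const_nhds.congr fun i => ?_
    have h0 : Int.negSucc n - 1 = Int.negSucc (n + 1) := by omega
    have : ladder (E i) (Int.negSucc (n + 1)) = star (E i) ^ (n + 1 + 1) := rfl
    rw [h0, this, clm_pow_succ_apply (star (E i)) (n + 1)]
    simp [ladder]

theorem PhaseLayer.excitation (h : PhaseLayer l E P D Z τ) (hΩ : IsCondensate l E P D Z Ω)
    (a a' : ℕ) : Tendsto (fun i => ‖(star (E i) ^ a * E i ^ a') (Ω i)
      - ladder (E i) ((a' : ℤ) - a) (Ω i)‖) l (𝓝 0) := by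
  induction a with
  | zero =>
    refine tendsto_const_nhds.congr fun i => ?_
    have : ladder (E i) ((a' : ℤ) - (0 : ℕ)) = E i ^ a' := by
      rw [Nat.cast_zero, sub_zero]
      rfl
    rw [this]
    simp
  | succ a ih =>
    have h1 := tendsto_norm_clm_apply h.conj.bounded ih
    refine (tendsto_norm_add h1 (h.lower_ladder hΩ ((a' : ℤ) - a))).congr fun i => congrArg _ ?_
    rw [pow_succ', mul_assoc, mul_apply_eq_comp (star (E i)), map_sub, Nat.cast_succ, ← sub_sub]
    abel

/-- Here `E'` is the phase operator of the other layer: excitations created there commute with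
everything in this layer and leave its condensate intact, so the single-layer results can be applied
twice. -/
theorem IsCondensate.ladder_apply {E' : ∀ i, 𝓗 i →L[ℂ] 𝓗 i} {k : ℤ}
    (hΩ : IsCondensate l E P D Z Ω) (hb : ∃ C, ∀ i, ‖E' i‖ ≤ C)
    (hn : Tendsto (fun i => ‖ladder (E' i) k (Ω i)‖) l (𝓝 1))
    (hE : ∀ i, Commute (E i) (ladder (E' i) k)) (hE' : ∀ i, Commute (star (E i)) (ladder (E' i) k))
    (hP : ∀ i, Commute (P i) (ladder (E' i) k)) (hD : ∀ i, Commute (D i) (ladder (E' i) k))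
    (hZ : ∀ i, Commute (Z i) (ladder (E' i) k)) :
    IsCondensate l E P D Z (fun i => ladder (E' i) k (Ω i)) where
  norm := hn
  pairing := by
    refine (tendsto_norm_clm_apply (exists_norm_ladder_le hb k) hΩ.pairing).congr fun i =>
      congrArg _ ?_
    rw [map_sub, clm_commute_apply (hE' i), clm_commute_apply (hE i)]
  momentum i := by
    rw [clm_commute_apply (hP i), hΩ.momentum, map_zero]
  energy := by
    refine (tendsto_norm_clm_apply (exists_norm_ladder_le hb k) hΩ.energy).congr fun i => ?_
    rw [clm_commute_apply (hD i)]
  detuning := by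
    refine (tendsto_norm_clm_apply (exists_norm_ladder_le hb k) hΩ.detuning).congr fun i => ?_
    rw [clm_commute_apply (hZ i)]

end Condensate

/-! ### Two condensed layers -/

section Junction

variable {I : Type*} {l : Filter I} {𝓗 : I → Type*} [∀ i, NormedAddCommGroup (𝓗 i)]
  [∀ i, InnerProductSpace ℂ (𝓗 i)] [∀ i, CompleteSpace (𝓗 i)]
  {E₁ P₁ D₁ Z₁ E₂ P₂ D₂ Z₂ : ∀ i, 𝓗 i →L[ℂ] 𝓗 i} {τ₁ τ₂ : I → ℝ} {Ω : ∀ i, 𝓗 i}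

/-- Two commuting condensed layers. -/
structure CondensedJunction (l : Filter I) (E₁ P₁ D₁ Z₁ E₂ P₂ D₂ Z₂ : ∀ i, 𝓗 i →L[ℂ] 𝓗 i)
    (τ₁ τ₂ : I → ℝ) (Ω : ∀ i, 𝓗 i) : Prop where
  left : PhaseLayer l E₁ P₁ D₁ Z₁ τ₁
  right : PhaseLayer l E₂ P₂ D₂ Z₂ τ₂
  condensate_left : IsCondensate l E₁ P₁ D₁ Z₁ Ω
  condensate_right : IsCondensate l E₂ P₂ D₂ Z₂ Ω
  commute_phase : ∀ i, Commute (E₁ i) (E₂ i)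
  commute_phase_star : ∀ i, Commute (E₁ i) (star (E₂ i))
  commute_momentum_left : ∀ i, Commute (P₁ i) (E₂ i)
  commute_energy_left : ∀ i, Commute (D₁ i) (E₂ i)
  commute_detuning_left : ∀ i, Commute (Z₁ i) (E₂ i)
  commute_momentum_right : ∀ i, Commute (P₂ i) (E₁ i)
  commute_energy_right : ∀ i, Commute (D₂ i) (E₁ i)

/-- The vector with `k 0` and `k 1` quanta of momentum in the left and the right layer. -/
def modeVector (E₁ E₂ : ∀ i, 𝓗 i →L[ℂ] 𝓗 i) (Ω : ∀ i, 𝓗 i) (i : I) (k : Fin 2 → ℤ) : 𝓗 i :=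
  ladder (E₁ i) (k 0) (ladder (E₂ i) (k 1) (Ω i))

theorem IsSelfAdjoint.commute_star {V : Type*} [NormedAddCommGroup V] [InnerProductSpace ℂ V]
    [CompleteSpace V] {S T : V →L[ℂ] V} (hS : IsSelfAdjoint S) (h : Commute S T) :
    Commute S (star T) := by
  have := h.star_star
  rwa [hS.star_eq] at this

theorem CondensedJunction.condensate_ladder
    (h : CondensedJunction l E₁ P₁ D₁ Z₁ E₂ P₂ D₂ Z₂ τ₁ τ₂ Ω) (m : ℤ) :
    IsCondensate l E₁ P₁ D₁ Z₁ (fun i => ladder (E₂ i) m (Ω i)) := by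
  refine h.condensate_left.ladder_apply h.right.bounded
    (h.right.norm_ladder h.condensate_right m) (fun i => ?_) (fun i => ?_) (fun i => ?_)
    (fun i => ?_) (fun i => ?_)
  · exact ladder_commute (h.commute_phase i) (h.commute_phase_star i) m
  · refine ladder_commute ?_ ?_ m
    · simpa using (h.commute_phase_star i).star_star
    · exact (h.commute_phase i).star_star
  · exact ladder_commute (h.commute_momentum_left i)
      (IsSelfAdjoint.commute_star (h.left.selfAdjoint_momentum i) (h.commute_momentum_left i)) m
  · exact ladder_commute (h.commute_energy_left i)
      (IsSelfAdjoint.commute_star (h.left.selfAdjoint_energy i) (h.commute_energy_left i)) m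
  · exact ladder_commute (h.commute_detuning_left i)
      (IsSelfAdjoint.commute_star (h.left.selfAdjoint_detuning i) (h.commute_detuning_left i)) m

theorem CondensedJunction.momentum_left
    (h : CondensedJunction l E₁ P₁ D₁ Z₁ E₂ P₂ D₂ Z₂ τ₁ τ₂ Ω) (k : Fin 2 → ℤ) (i : I) :
    P₁ i (modeVector E₁ E₂ Ω i k) = (k 0 : ℂ) • modeVector E₁ E₂ Ω i k :=
  h.left.momentum_ladder (h.condensate_ladder (k 1)) (k 0) i

theorem CondensedJunction.momentum_right
    (h : CondensedJunction l E₁ P₁ D₁ Z₁ E₂ P₂ D₂ Z₂ τ₁ τ₂ Ω) (k : Fin 2 → ℤ) (i : I) :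
    P₂ i (modeVector E₁ E₂ Ω i k) = (k 1 : ℂ) • modeVector E₁ E₂ Ω i k := by
  have hc : Commute (P₂ i) (ladder (E₁ i) (k 0)) := ladder_commute (h.commute_momentum_right i)
    (IsSelfAdjoint.commute_star (h.right.selfAdjoint_momentum i) (h.commute_momentum_right i)) _
  rw [modeVector, clm_commute_apply hc,
    h.right.momentum_ladder h.condensate_right, map_smul]

theorem CondensedJunction.energy
    (h : CondensedJunction l E₁ P₁ D₁ Z₁ E₂ P₂ D₂ Z₂ τ₁ τ₂ Ω) (k : Fin 2 → ℤ) :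
    Tendsto (fun i => ‖(D₁ i + D₂ i) (modeVector E₁ E₂ Ω i k)‖) l (𝓝 0) := by
  have h1 := h.left.energy_ladder (h.condensate_ladder (k 1)) (k 0)
  have h2 := tendsto_norm_clm_apply (exists_norm_ladder_le h.left.bounded (k 0))
    (h.right.energy_ladder h.condensate_right (k 1))
  refine (tendsto_norm_add h1 h2).congr fun i => congrArg _ ?_
  have hc : Commute (D₂ i) (ladder (E₁ i) (k 0)) := ladder_commute (h.commute_energy_right i)
    (IsSelfAdjoint.commute_star (h.right.selfAdjoint_energy i) (h.commute_energy_right i)) _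
  rw [← clm_commute_apply hc]
  rfl

theorem CondensedJunction.norm_modeVector
    (h : CondensedJunction l E₁ P₁ D₁ Z₁ E₂ P₂ D₂ Z₂ τ₁ τ₂ Ω) (k : Fin 2 → ℤ) :
    Tendsto (fun i => ‖modeVector E₁ E₂ Ω i k‖) l (𝓝 1) :=
  h.left.norm_ladder (h.condensate_ladder (k 1)) (k 0)

theorem inner_eq_zero_of_eigenvalue_ne {V : Type*} [NormedAddCommGroup V] [InnerProductSpace ℂ V]
    [CompleteSpace V] {P : V →L[ℂ] V} (hP : IsSelfAdjoint P) {x y : V} {a b : ℤ}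
    (hx : P x = (a : ℂ) • x) (hy : P y = (b : ℂ) • y) (hab : a ≠ b) : inner ℂ x y = 0 := by
  have h1 : inner ℂ (P x) y = inner ℂ x (P y) := by
    rw [← ContinuousLinearMap.adjoint_inner_right, ← ContinuousLinearMap.star_eq_adjoint,
      hP.star_eq]
  rw [hx, hy, inner_smul_left, inner_smul_right, map_intCast, ← sub_eq_zero, ← sub_mul,
    mul_eq_zero, sub_eq_zero] at h1
  exact h1.resolve_left (by exact_mod_cast hab)

/-- Different labels are exactly orthogonal, being different eigenvalues of one of the self-adjoint
momenta; only the normalization is asymptotic. -/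
theorem CondensedJunction.tendsto_inner
    (h : CondensedJunction l E₁ P₁ D₁ Z₁ E₂ P₂ D₂ Z₂ τ₁ τ₂ Ω) (k m : Fin 2 → ℤ) :
    Tendsto (fun i => inner ℂ (modeVector E₁ E₂ Ω i k) (modeVector E₁ E₂ Ω i m)) l
      (𝓝 (if k = m then 1 else 0)) := by
  by_cases hkm : k = m
  · rw [if_pos hkm, hkm]
    simp only [inner_self_eq_norm_sq_to_K]
    have := (h.norm_modeVector m).pow 2
    rw [one_pow] at this
    have h2 := (Complex.continuous_ofReal.tendsto 1).comp this
    simpa [Function.comp_def] using h2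
  · rw [if_neg hkm]
    refine tendsto_const_nhds.congr fun i => ?_
    by_cases h0 : k 0 = m 0
    · have h1 : k 1 ≠ m 1 := fun h1 => hkm (by ext j; fin_cases j; exacts [h0, h1])
      exact (inner_eq_zero_of_eigenvalue_ne (h.right.selfAdjoint_momentum i)
        (h.momentum_right k i) (h.momentum_right m i) h1).symm
    · exact (inner_eq_zero_of_eigenvalue_ne (h.left.selfAdjoint_momentum i)
        (h.momentum_left k i) (h.momentum_left m i) h0).symm

theorem CondensedJunction.excitation
    (h : CondensedJunction l E₁ P₁ D₁ Z₁ E₂ P₂ D₂ Z₂ τ₁ τ₂ Ω) (a a' b b' : ℕ) :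
    Tendsto (fun i => ‖(star (E₁ i) ^ a * E₁ i ^ a' * star (E₂ i) ^ b * E₂ i ^ b') (Ω i)
      - modeVector E₁ E₂ Ω i ![(a' : ℤ) - a, (b' : ℤ) - b]‖) l (𝓝 0) := by
  have h1 := tendsto_norm_clm_apply (exists_norm_pow_le h.left.conj.bounded a)
    (tendsto_norm_clm_apply (exists_norm_pow_le h.left.bounded a')
      (h.right.excitation h.condensate_right b b'))
  have h2 := h.left.excitation (h.condensate_ladder ((b' : ℤ) - b)) a a'
  refine (tendsto_norm_add h1 h2).congr fun i => congrArg _ ?_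
  simp only [modeVector, mul_apply_eq_comp, map_sub, Matrix.cons_val_zero, Matrix.cons_val_one]
  abel

/-- Moving one quantum from right to left, or back, changes the label by `±(1, -1)`. The operator of
the right layer is applied first, by commuting it through the left ladder; the left operator then
acts on a ladder built over a condensed state. -/
theorem CondensedJunction.hopping
    (h : CondensedJunction l E₁ P₁ D₁ Z₁ E₂ P₂ D₂ Z₂ τ₁ τ₂ Ω) (k : Fin 2 → ℤ) :
    Tendsto (fun i => ‖(E₁ i * star (E₂ i) + star (E₁ i) * E₂ i) (modeVector E₁ E₂ Ω i k)
      - (modeVector E₁ E₂ Ω i (k + ![1, -1]) + modeVector E₁ E₂ Ω i (k - ![1, -1]))‖) l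
      (𝓝 0) := by
  have hb := exists_norm_ladder_le h.left.bounded (k 0)
  have h1 := tendsto_norm_clm_apply h.left.bounded (tendsto_norm_clm_apply hb
    (h.right.lower_ladder h.condensate_right (k 1)))
  have h2 := h.left.raise_ladder (h.condensate_ladder (k 1 - 1)) (k 0)
  have h3 := tendsto_norm_clm_apply h.left.conj.bounded (tendsto_norm_clm_apply hb
    (h.right.raise_ladder h.condensate_right (k 1)))
  have h4 := h.left.lower_ladder (h.condensate_ladder (k 1 + 1)) (k 0)
  refine (tendsto_norm_add (tendsto_norm_add h1 h2) (tendsto_norm_add h3 h4)).congr fun i =>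
    congrArg _ ?_
  have hc1 : Commute (star (E₂ i)) (ladder (E₁ i) (k 0)) :=
    ladder_commute (h.commute_phase_star i).symm (h.commute_phase i).star_star.symm _
  have hc2 : Commute (E₂ i) (ladder (E₁ i) (k 0)) :=
    ladder_commute (h.commute_phase i).symm (by simpa using (h.commute_phase_star i).star_star.symm) _
  have e1 : star (E₂ i) (ladder (E₁ i) (k 0) (ladder (E₂ i) (k 1) (Ω i)))
      = ladder (E₁ i) (k 0) (star (E₂ i) (ladder (E₂ i) (k 1) (Ω i))) := by
    rw [clm_commute_apply hc1]
  have e2 : E₂ i (ladder (E₁ i) (k 0) (ladder (E₂ i) (k 1) (Ω i)))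
      = ladder (E₁ i) (k 0) (E₂ i (ladder (E₂ i) (k 1) (Ω i))) := by
    rw [clm_commute_apply hc2]
  simp only [modeVector, mul_apply_eq_comp, map_sub, Matrix.cons_val_zero, Matrix.cons_val_one,
    _root_.add_apply, Pi.add_apply, Pi.sub_apply, e1, e2, sub_neg_eq_add, ← sub_eq_add_neg]
  abel

/-- The Hamiltonian of two layers with tunnelling amplitude `g`. -/
def junctionHamiltonian {V : Type*} [NormedAddCommGroup V] [InnerProductSpace ℂ V]
    [CompleteSpace V] (E₁ P₁ D₁ E₂ P₂ D₂ : V →L[ℂ] V) (g EC ng : ℝ) : V →L[ℂ] V :=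
  D₁ + D₂ + (g : ℂ) • (E₁ * star E₂ + star E₁ * E₂)
    + (EC : ℂ) • ((1 / 2 : ℂ) • (P₁ - P₂) - (ng : ℂ) • (1 : V →L[ℂ] V)) ^ 2

theorem CondensedJunction.isSelfAdjoint_junctionHamiltonian
    (h : CondensedJunction l E₁ P₁ D₁ Z₁ E₂ P₂ D₂ Z₂ τ₁ τ₂ Ω) (g EC ng : ℝ) (i : I) :
    IsSelfAdjoint (junctionHamiltonian (E₁ i) (P₁ i) (D₁ i) (E₂ i) (P₂ i) (D₂ i) g EC ng) := by
  have hr : ∀ (c : ℝ) {T : 𝓗 i →L[ℂ] 𝓗 i}, IsSelfAdjoint T → IsSelfAdjoint ((c : ℂ) • T) :=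
    fun c T hT => IsSelfAdjoint.smul (Complex.conj_ofReal _) hT
  refine (((h.left.selfAdjoint_energy i).add (h.right.selfAdjoint_energy i)).add
    (hr g ?_)).add (hr EC (IsSelfAdjoint.pow (IsSelfAdjoint.sub ?_ (hr ng (IsSelfAdjoint.one _))) 2))
  · have h1 : star (E₁ i) * E₂ i = E₂ i * star (E₁ i) := by
      simpa using (h.commute_phase_star i).star_star.eq
    rw [IsSelfAdjoint, star_add, star_mul, star_mul, star_star, star_star, ← h1,
      ← (h.commute_phase_star i).eq, add_comm]
  · have := hr (1 / 2) ((h.left.selfAdjoint_momentum i).sub (h.right.selfAdjoint_momentum i))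
    simpa using this

/-- The charging term is exact, since the mode vectors are joint eigenvectors of the momenta; the
free energies and the hopping contribute the two errors. -/
theorem CondensedJunction.junctionHamiltonian_modeVector
    (h : CondensedJunction l E₁ P₁ D₁ Z₁ E₂ P₂ D₂ Z₂ τ₁ τ₂ Ω) (g EC ng : ℝ) (k : Fin 2 → ℤ) :
    Tendsto (fun i =>
      ‖junctionHamiltonian (E₁ i) (P₁ i) (D₁ i) (E₂ i) (P₂ i) (D₂ i) g EC ng
          (modeVector E₁ E₂ Ω i k)
        - ((chargingEnergy EC ng k : ℂ) • modeVector E₁ E₂ Ω i k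
          + (g : ℂ) • (modeVector E₁ E₂ Ω i (k + ![1, -1])
            + modeVector E₁ E₂ Ω i (k - ![1, -1])))‖) l (𝓝 0) := by
  refine (tendsto_norm_add (h.energy k) (tendsto_norm_smul (h.hopping k) g)).congr fun i =>
    congrArg _ ?_
  set v := modeVector E₁ E₂ Ω i k with hv
  have hQ : ((1 / 2 : ℂ) • (P₁ i - P₂ i) - (ng : ℂ) • (1 : 𝓗 i →L[ℂ] 𝓗 i)) v
      = (((k 0 : ℂ) - k 1) / 2 - ng) • v := by
    simp only [_root_.sub_apply, _root_.smul_apply, one_apply_eq_self, hv, h.momentum_left,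
      h.momentum_right]
    module
  have hQ2 : (((1 / 2 : ℂ) • (P₁ i - P₂ i) - (ng : ℂ) • (1 : 𝓗 i →L[ℂ] 𝓗 i)) ^ 2) v
      = ((((k 0 : ℂ) - k 1) / 2 - ng) ^ 2) • v := by
    rw [sq, mul_apply_eq_comp, hQ, map_smul, hQ, smul_smul, sq]
  simp only [junctionHamiltonian, _root_.add_apply, _root_.smul_apply] at hQ2 ⊢
  rw [hQ2, chargingEnergy]
  push_cast
  module

/-- The mesoscopic limit of two condensed layers. -/
theorem CondensedJunction.exists_mesoscopic_limit
    (h : CondensedJunction l E₁ P₁ D₁ Z₁ E₂ P₂ D₂ Z₂ τ₁ τ₂ Ω) (g EC ng : ℝ) {U : ℝ → MesoSpace →L[ℂ] MesoSpace}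
    (hU : ∀ ψ T, TendstoUniformlyOn
      (fun F t => evolution (cutoffHamiltonian planeWaves (chargingEnergy EC ng)
        (((2 * g : ℝ) : ℂ) • cosPhaseDiff) F) t ψ) (fun t => U t ψ) atTop (Set.Icc (-T) T))
    (a a' b b' c c' d d' : ℕ) (t : ℝ) :
    Tendsto (fun i => inner ℂ ((star (E₁ i) ^ a * E₁ i ^ a' * star (E₂ i) ^ b * E₂ i ^ b') (Ω i))
      (evolution (junctionHamiltonian (E₁ i) (P₁ i) (D₁ i) (E₂ i) (P₂ i) (D₂ i) g EC ng) t
        ((star (E₁ i) ^ c * E₁ i ^ c' * star (E₂ i) ^ d * E₂ i ^ d') (Ω i)))) l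
      (𝓝 (inner ℂ (planeWaves ![(a' : ℤ) - a, (b' : ℤ) - b])
        (U t (planeWaves ![(c' : ℤ) - c, (d' : ℤ) - d])))) := by
  refine tendsto_inner_evolution (δ := ![1, -1]) (g := g) ?_ ?_ hU
    (h.isSelfAdjoint_junctionHamiltonian g EC ng) h.tendsto_inner
    (h.junctionHamiltonian_modeVector g EC ng) (h.excitation a a' b b') (h.excitation c c' d d') t
  · exact IsSelfAdjoint.smul (Complex.conj_ofReal _) isSelfAdjoint_cosPhaseDiff
  · intro k
    rw [_root_.smul_apply, cosPhaseDiff_planeWaves, smul_smul]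
    congr 1
    push_cast
    ring

/-- The Josephson amplitude is `2 g` because the cosine is half the sum of the two shifts. The
convergence of the cut-off evolutions is kept beside the group property, since the comparison with
the microscopic evolution goes through it. -/
theorem exists_qubit_evolution (g EC ng : ℝ) :
    ∃ U : ℝ → MesoSpace →L[ℂ] MesoSpace, IsUnitaryGroupOf (qubitHamiltonian EC ng (2 * g)) U ∧
      ∀ ψ T, TendstoUniformlyOn
      (fun F t => evolution (cutoffHamiltonian planeWaves (chargingEnergy EC ng)
        (((2 * g : ℝ) : ℂ) • cosPhaseDiff) F) t ψ) (fun t => U t ψ) atTop (Set.Icc (-T) T) := by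
  have hs : IsSelfAdjoint (((2 * g : ℝ) : ℂ) • cosPhaseDiff) :=
    IsSelfAdjoint.smul (Complex.conj_ofReal _) isSelfAdjoint_cosPhaseDiff
  obtain ⟨U, hU⟩ := exists_limit_cutoff_evolution (e := planeWaves) (κ := chargingEnergy EC ng)
    (g := g) (δ := ![1, -1]) hs (fun k => by
      rw [_root_.smul_apply, cosPhaseDiff_planeWaves, smul_smul]
      congr 1
      push_cast
      ring)
  exact ⟨U, isUnitaryGroupOf_limit_evolution hs hU (mem_domain_qubitHamiltonian EC ng (2 * g))
    (repr_qubitHamiltonian EC ng (2 * g)), hU⟩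

end Junction

/-! ### Collective spin operators -/

section SiteOperators

variable {N : ℕ}

theorem siteOp_mulVec (a : Matrix (Fin 2) (Fin 2) ℂ) (k : Fin N) (v : Spins N → ℂ)
    (σ : Spins N) :
    (siteOp a k *ᵥ v) σ = ∑ i, a (σ k) i * v (Function.update σ k i) := by
  symm
  refine Finset.sum_of_injOn (Function.update σ k) ((Function.update_injective σ k).injOn)
    (fun _ _ => Finset.mem_coe.2 (Finset.mem_univ _)) (fun τ _ hτ => ?_) (fun i _ => ?_)
  · simp only [siteOp, Matrix.of_apply]
    rw [if_neg, zero_mul]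
    intro h
    refine hτ ⟨τ k, Finset.mem_coe.2 (Finset.mem_univ _), ?_⟩
    ext j
    by_cases hj : j = k
    · subst hj
      simp
    · simp [hj, h j hj]
  · simp only [siteOp, Matrix.of_apply]
    rw [if_pos]
    · simp
    · intro j hj
      simp [hj]

theorem siteOp_mul_self (a b : Matrix (Fin 2) (Fin 2) ℂ) (k : Fin N) :
    siteOp a k * siteOp b k = siteOp (a * b) k := by
  refine Matrix.ext_of_mulVec_single fun τ => ?_
  ext σ
  rw [← Matrix.mulVec_mulVec, siteOp_mulVec, siteOp_mulVec]
  simp only [siteOp_mulVec, Function.update_idem, Function.update_self, Matrix.mul_apply,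
    Finset.mul_sum, Finset.sum_mul]
  rw [Finset.sum_comm]
  simp only [mul_assoc]

theorem siteOp_commute (a b : Matrix (Fin 2) (Fin 2) ℂ) {k l : Fin N} (h : k ≠ l) :
    Commute (siteOp a k) (siteOp b l) := by
  refine Matrix.ext_of_mulVec_single fun τ => ?_
  ext σ
  rw [← Matrix.mulVec_mulVec, ← Matrix.mulVec_mulVec, siteOp_mulVec, siteOp_mulVec]
  simp only [siteOp_mulVec, Function.update_of_ne h, Function.update_of_ne h.symm, Finset.mul_sum]
  rw [Finset.sum_comm]
  refine Finset.sum_congr rfl fun i _ => Finset.sum_congr rfl fun j _ => ?_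
  rw [Function.update_comm h]
  ring

theorem siteOp_conjTranspose (a : Matrix (Fin 2) (Fin 2) ℂ) (k : Fin N) :
    (siteOp a k)ᴴ = siteOp aᴴ k := by
  ext σ τ
  simp only [siteOp, Matrix.conjTranspose_apply, Matrix.of_apply]
  by_cases h : ∀ j, j ≠ k → τ j = σ j
  · rw [if_pos h, if_pos fun j hj => (h j hj).symm]
  · rw [if_neg h, if_neg fun h' => h fun j hj => (h' j hj).symm, star_zero]

theorem siteOp_transpose (a : Matrix (Fin 2) (Fin 2) ℂ) (k : Fin N) :
    (siteOp a k)ᵀ = siteOp aᵀ k := by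
  ext σ τ
  simp only [siteOp, Matrix.transpose_apply, Matrix.of_apply]
  by_cases h : ∀ j, j ≠ k → τ j = σ j
  · rw [if_pos h, if_pos fun j hj => (h j hj).symm]
  · rw [if_neg h, if_neg fun h' => h fun j hj => (h' j hj).symm]

theorem siteOp_add (a b : Matrix (Fin 2) (Fin 2) ℂ) (k : Fin N) :
    siteOp (a + b) k = siteOp a k + siteOp b k := by
  ext σ τ
  simp only [siteOp, Matrix.add_apply, Matrix.of_apply]
  split_ifs <;> simp

theorem siteOp_smul (c : ℂ) (a : Matrix (Fin 2) (Fin 2) ℂ) (k : Fin N) :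
    siteOp (c • a) k = c • siteOp a k := by
  ext σ τ
  simp only [siteOp, Matrix.smul_apply, Matrix.of_apply]
  split_ifs <;> simp

/-- The sum over all sites of the one-site matrix `a`. -/
def siteSum (N : ℕ) (a : Matrix (Fin 2) (Fin 2) ℂ) : SpinOp N := ∑ k : Fin N, siteOp a k

theorem siteSum_add (a b : Matrix (Fin 2) (Fin 2) ℂ) :
    siteSum N (a + b) = siteSum N a + siteSum N b := by
  simp only [siteSum, siteOp_add, Finset.sum_add_distrib]

theorem siteSum_smul (c : ℂ) (a : Matrix (Fin 2) (Fin 2) ℂ) :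
    siteSum N (c • a) = c • siteSum N a := by
  simp only [siteSum, siteOp_smul, Finset.smul_sum]

/-- Different sites commute, so only the diagonal terms survive: `siteSum` carries one-site
commutators to collective ones. -/
theorem siteSum_mul_sub (a b : Matrix (Fin 2) (Fin 2) ℂ) :
    siteSum N a * siteSum N b = siteSum N b * siteSum N a + siteSum N (a * b - b * a) := by
  rw [← sub_eq_iff_eq_add', siteSum, siteSum, Finset.sum_mul_sum, Finset.sum_mul_sum,
    Finset.sum_comm (s := Finset.univ) (t := Finset.univ) (f := fun i j => siteOp b i * siteOp a j),
    ← Finset.sum_sub_distrib, siteSum]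
  refine Finset.sum_congr rfl fun k _ => ?_
  rw [← Finset.sum_sub_distrib, Finset.sum_eq_single k]
  · rw [siteOp_mul_self, siteOp_mul_self, sub_eq_add_neg, sub_eq_add_neg, siteOp_add,
      ← neg_one_smul ℂ (b * a), siteOp_smul, neg_one_smul]
  · intro j _ hj
    rw [(siteOp_commute a b hj.symm).eq, sub_self]
  · simp

/-- The one-site raising matrix. -/
def raising : Matrix (Fin 2) (Fin 2) ℂ := !![0, 1; 0, 0]

/-- The one-site lowering matrix. -/
def lowering : Matrix (Fin 2) (Fin 2) ℂ := !![0, 0; 1, 0]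

theorem Splus_eq (N : ℕ) : Splus N = siteSum N raising := by
  have h : raising = (1 / 2 : ℂ) • pauliX + (Complex.I * (1 / 2)) • pauliY := by
    ext i j
    fin_cases i <;> fin_cases j <;> simp [raising, pauliX, pauliY] <;> ring_nf <;> simp <;> ring
  rw [h, siteSum_add, siteSum_smul, siteSum_smul, mul_smul]
  rfl

theorem Sminus_eq (N : ℕ) : Sminus N = siteSum N lowering := by
  have h : lowering = (1 / 2 : ℂ) • pauliX + (-(Complex.I * (1 / 2))) • pauliY := by
    ext i j
    fin_cases i <;> fin_cases j <;> simp [lowering, pauliX, pauliY] <;> ring_nf <;> simp <;> ring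
  rw [h, siteSum_add, siteSum_smul, siteSum_smul, neg_smul, mul_smul, ← sub_eq_add_neg]
  rfl

theorem Sz_eq (N : ℕ) : Sz N = (1 / 2 : ℂ) • siteSum N pauliZ := rfl

theorem Splus_conjTranspose (N : ℕ) : (Splus N)ᴴ = Sminus N := by
  rw [Splus_eq, Sminus_eq, siteSum, Matrix.conjTranspose_sum]
  refine Finset.sum_congr rfl fun k _ => ?_
  rw [siteOp_conjTranspose]
  congr 1
  ext i j
  fin_cases i <;> fin_cases j <;> simp [raising, lowering]

theorem Sminus_conjTranspose (N : ℕ) : (Sminus N)ᴴ = Splus N := by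
  rw [← Splus_conjTranspose, Matrix.conjTranspose_conjTranspose]

theorem Splus_transpose (N : ℕ) : (Splus N)ᵀ = Sminus N := by
  rw [Splus_eq, Sminus_eq, siteSum, Matrix.transpose_sum]
  refine Finset.sum_congr rfl fun k _ => ?_
  rw [siteOp_transpose]
  congr 1
  ext i j
  fin_cases i <;> fin_cases j <;> simp [raising, lowering]

theorem Sz_transpose (N : ℕ) : (Sz N)ᵀ = Sz N := by
  rw [Sz_eq, Matrix.transpose_smul, siteSum, Matrix.transpose_sum]
  congr 1
  refine Finset.sum_congr rfl fun k _ => ?_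
  rw [siteOp_transpose]
  congr 1
  ext i j
  fin_cases i <;> fin_cases j <;> simp [pauliZ]

theorem Sz_conjTranspose (N : ℕ) : (Sz N)ᴴ = Sz N := by
  rw [Sz_eq, Matrix.conjTranspose_smul, siteSum, Matrix.conjTranspose_sum]
  congr 1
  · simp
  refine Finset.sum_congr rfl fun k _ => ?_
  rw [siteOp_conjTranspose]
  congr 1
  ext i j
  fin_cases i <;> fin_cases j <;> simp [pauliZ]

theorem Sz_mul_Splus (N : ℕ) : Sz N * Splus N = Splus N * Sz N + Splus N := by
  have h : pauliZ * raising - raising * pauliZ = (2 : ℂ) • raising := by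
    ext i j
    fin_cases i <;> fin_cases j <;> simp [pauliZ, raising] <;> norm_num
  rw [Splus_eq, Sz_eq, smul_mul_assoc, siteSum_mul_sub, h, siteSum_smul, smul_add,
    mul_smul_comm, smul_smul]
  norm_num

theorem Splus_mul_Sminus (N : ℕ) :
    Splus N * Sminus N = Sminus N * Splus N + (2 : ℂ) • Sz N := by
  have h : raising * lowering - lowering * raising = pauliZ := by
    ext i j
    fin_cases i <;> fin_cases j <;> simp [pauliZ, raising, lowering]
  rw [Splus_eq, Sminus_eq, Sz_eq, siteSum_mul_sub, h, smul_smul]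
  norm_num

theorem Sz_commute_Splus_mul_Sminus (N : ℕ) : Commute (Sz N) (Splus N * Sminus N) := by
  have h1 := Sz_mul_Splus N
  have h2 : Sz N * Sminus N = Sminus N * Sz N - Sminus N := by
    have := congrArg Matrix.conjTranspose h1
    simp only [Matrix.conjTranspose_mul, Matrix.conjTranspose_add, Splus_conjTranspose,
      Sz_conjTranspose] at this
    rw [this, add_sub_cancel_right]
  rw [Commute, SemiconjBy, ← mul_assoc, h1, add_mul, mul_assoc, h2, mul_sub, mul_assoc]
  abel

/-! Norm bounds in an arbitrary representation -/

/-- By the C*-identity `x = ‖T* T‖` satisfies `x = x²`. This covers the raising matrix and `σ_z` at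
one site; summing over sites gives bounds linear in `N`. -/
theorem norm_le_one_of_isIdempotentElem_star_mul_self {B : Type*} [NormedRing B] [StarRing B]
    [CStarRing B] {T : B} (h : IsIdempotentElem (star T * T)) : ‖T‖ ≤ 1 := by
  have h1 : ‖star T * T‖ = ‖star T * T‖ * ‖star T * T‖ := by
    conv_lhs => rw [← h.eq]
    have := CStarRing.norm_star_mul_self (x := star T * T)
    rwa [star_mul, star_star] at this
  rw [CStarRing.norm_star_mul_self] at h1
  by_contra! hT
  have hx : 1 < ‖T‖ * ‖T‖ := one_lt_mul_of_lt_of_le hT hT.le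
  nlinarith

variable {B : Type*} [NormedRing B] [NormedAlgebra ℂ B] [StarRing B] [CStarRing B]
  (φ : SpinOp N →⋆ₐ[ℂ] B)

theorem norm_map_siteOp_le_one {a : Matrix (Fin 2) (Fin 2) ℂ} (ha : IsIdempotentElem (aᴴ * a))
    (k : Fin N) : ‖φ (siteOp a k)‖ ≤ 1 := by
  refine norm_le_one_of_isIdempotentElem_star_mul_self ?_
  rw [IsIdempotentElem, ← map_star, ← map_mul, ← map_mul, Matrix.star_eq_conjTranspose,
    siteOp_conjTranspose, siteOp_mul_self, siteOp_mul_self, ha.eq]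

theorem norm_map_siteSum_le {a : Matrix (Fin 2) (Fin 2) ℂ} (ha : IsIdempotentElem (aᴴ * a)) :
    ‖φ (siteSum N a)‖ ≤ N := by
  rw [siteSum, map_sum]
  refine (norm_sum_le_of_le _ fun k _ => norm_map_siteOp_le_one φ ha k).trans ?_
  simp

theorem norm_map_Splus_le : ‖φ (Splus N)‖ ≤ N := by
  rw [Splus_eq]
  refine norm_map_siteSum_le φ ?_
  ext i j
  fin_cases i <;> fin_cases j <;> simp [raising, Matrix.mul_apply]

theorem norm_map_two_smul_Sz_le : ‖φ ((2 : ℂ) • Sz N)‖ ≤ N := by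
  have : (2 : ℂ) • Sz N = siteSum N pauliZ := by
    rw [Sz_eq, smul_smul]
    norm_num
  rw [this]
  refine norm_map_siteSum_le φ ?_
  ext i j
  fin_cases i <;> fin_cases j <;> simp [pauliZ, Matrix.mul_apply]

end SiteOperators

/-! ### Traces over the weight spaces -/

section Weights

variable {N : ℕ}

/-- The number of spins that point down. -/
def down (σ : Spins N) : ℕ := (Finset.univ.filter fun k => σ k = 1).card

/-- The projection onto the weight space with `k` spins down. -/
def weightProj (N k : ℕ) : SpinOp N := Matrix.diagonal fun σ => if down σ = k then 1 else 0

theorem card_down_eq (N k : ℕ) :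
    (Finset.univ.filter fun σ : Spins N => down σ = k).card = N.choose k := by
  have hcard : (Finset.powersetCard k (Finset.univ : Finset (Fin N))).card = N.choose k := by simp
  rw [← hcard]
  refine Finset.card_bij (fun σ _ => Finset.univ.filter fun j => σ j = 1) ?_ ?_ ?_
  · intro σ hσ
    rw [Finset.mem_filter] at hσ
    rw [Finset.mem_powersetCard]
    exact ⟨Finset.subset_univ _, hσ.2⟩
  · intro σ _ τ _ h
    ext j
    have := Finset.ext_iff.1 h j
    simp only [Finset.mem_filter, Finset.mem_univ, true_and] at this
    have h2 : ∀ x y : Fin 2, (x = 1 ↔ y = 1) → x = y := by decide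
    rw [h2 _ _ this]
  · intro s hs
    rw [Finset.mem_powersetCard] at hs
    have : (Finset.univ.filter fun j => (if j ∈ s then (1 : Fin 2) else 0) = 1) = s := by
      ext j
      by_cases hj : j ∈ s <;> simp [hj]
    refine ⟨fun j => if j ∈ s then 1 else 0, ?_, this⟩
    rw [Finset.mem_filter]
    refine ⟨Finset.mem_univ _, ?_⟩
    rw [down, this, hs.2]

theorem trace_weightProj (N k : ℕ) : (weightProj N k).trace = N.choose k := by
  rw [weightProj, Matrix.trace_diagonal, Finset.sum_boole, card_down_eq]

theorem down_le (σ : Spins N) : down σ ≤ N :=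
  (Finset.card_filter_le _ _).trans_eq (by simp)

theorem Sz_eq_diagonal (N : ℕ) :
    Sz N = Matrix.diagonal fun σ => (((N : ℝ) / 2 - down σ : ℝ) : ℂ) := by
  have h1 : ∀ k : Fin N, siteOp pauliZ k
      = Matrix.diagonal fun σ : Spins N => if σ k = 1 then (-1 : ℂ) else 1 := by
    intro k
    refine Matrix.ext_of_mulVec_single fun τ => ?_
    ext σ
    rw [siteOp_mulVec, Matrix.mulVec_diagonal, Fin.sum_univ_two]
    have h2 : ∀ x : Fin 2, x = 0 ∨ x = 1 := by decide
    rcases h2 (σ k) with h | h <;>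
    · have := Function.update_eq_self k σ
      rw [h] at this
      simp [h, pauliZ, this]
  have h3 : ∀ s : Spins N, (∑ k, if s k = 1 then (-1 : ℂ) else 1) = N - 2 * down s := by
    intro s
    have : ∀ k, (if s k = 1 then (-1 : ℂ) else 1) = 1 - 2 * (if s k = 1 then 1 else 0) := by
      intro k
      split_ifs <;> norm_num
    simp only [this]
    rw [Finset.sum_sub_distrib, ← Finset.mul_sum, Finset.sum_boole]
    simp [down]
  rw [Sz_eq, siteSum]
  simp only [h1]
  ext σ τ
  rw [Matrix.smul_apply, Matrix.sum_apply]
  by_cases h : σ = τ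
  · subst h
    simp only [Matrix.diagonal_apply_eq]
    rw [h3]
    push_cast
    rw [smul_eq_mul]
    ring
  · simp [Matrix.diagonal_apply_ne _ h]

theorem Sz_mul_weightProj (N k : ℕ) :
    Sz N * weightProj N k = (((N : ℝ) / 2 - k : ℝ) : ℂ) • weightProj N k := by
  rw [Sz_eq_diagonal, weightProj, Matrix.diagonal_mul_diagonal, ← Matrix.diagonal_smul]
  congr 1
  ext σ
  by_cases h : down σ = k <;> simp [h]

/-- Read off the matrix entries of `S_z S₊ = S₊ S_z + S₊` in the basis in which `S_z` is diagonal.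
-/
theorem Splus_apply_eq_zero {σ τ : Spins N} (h : down τ ≠ down σ + 1) : Splus N σ τ = 0 := by
  have h1 := congrFun (congrFun (Sz_mul_Splus N) σ) τ
  rw [Matrix.add_apply, Sz_eq_diagonal, Matrix.diagonal_mul, Matrix.mul_diagonal,
    ← sub_eq_iff_eq_add', mul_comm, ← mul_sub, ← sub_eq_zero, ← mul_sub_one, mul_eq_zero] at h1
  refine h1.resolve_right fun h2 => h ?_
  push_cast at h2
  have h3 : (down τ : ℂ) = ((down σ + 1 : ℕ) : ℂ) := by
    push_cast
    linear_combination h2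
  exact_mod_cast h3

theorem Splus_mul_weightProj_succ (N k : ℕ) :
    Splus N * weightProj N (k + 1) = weightProj N k * Splus N := by
  ext σ τ
  rw [weightProj, weightProj, Matrix.mul_diagonal, Matrix.diagonal_mul]
  by_cases h : down τ = down σ + 1
  · by_cases h' : down σ = k
    · simp [h, h']
    · simp [h, h']
  · simp [Splus_apply_eq_zero h]

theorem Splus_mul_weightProj_zero (N : ℕ) : Splus N * weightProj N 0 = 0 := by
  ext σ τ
  rw [weightProj, Matrix.mul_diagonal]
  by_cases h : down τ = down σ + 1
  · simp [h]
  · simp [Splus_apply_eq_zero h]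

theorem weightProj_conjTranspose (N k : ℕ) : (weightProj N k)ᴴ = weightProj N k := by
  rw [weightProj, Matrix.diagonal_conjTranspose]
  congr 1
  ext σ
  rw [Pi.star_apply]
  split_ifs <;> simp

theorem weightProj_mul_Sminus (N k : ℕ) :
    weightProj N (k + 1) * Sminus N = Sminus N * weightProj N k := by
  have := congrArg Matrix.conjTranspose (Splus_mul_weightProj_succ N k)
  simpa only [Matrix.conjTranspose_mul, weightProj_conjTranspose, Splus_conjTranspose] using this

theorem weightProj_commute (N k : ℕ) : Commute (weightProj N k) (Splus N * Sminus N) := by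
  have h : Commute (weightProj N k) (Sz N) := by
    rw [weightProj, Sz_eq_diagonal]
    exact Matrix.commute_diagonal _ _
  rw [Splus_mul_Sminus]
  refine Commute.add_right ?_ (h.smul_right _)
  cases k with
  | zero =>
    have h1 := congrArg Matrix.conjTranspose (Splus_mul_weightProj_zero N)
    simp only [Matrix.conjTranspose_mul, weightProj_conjTranspose, Splus_conjTranspose,
      Matrix.conjTranspose_zero] at h1
    rw [Commute, SemiconjBy, ← mul_assoc, h1, mul_assoc, Splus_mul_weightProj_zero, zero_mul,
      mul_zero]
  | succ k =>
    rw [Commute, SemiconjBy, ← mul_assoc, weightProj_mul_Sminus, mul_assoc, mul_assoc,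
      Splus_mul_weightProj_succ]

open Polynomial in
/-- Cyclicity of the trace relates neighbouring weight spaces. -/
theorem trace_weightProj_succ_aeval (N k : ℕ) (p : ℂ[X]) :
    (weightProj N (k + 1) * aeval (Splus N * Sminus N) p).trace
      = (weightProj N k * aeval (Splus N * Sminus N) (p.comp (X + C ((N : ℂ) - 2 * (k + 1))))).trace
        + ((N.choose (k + 1) : ℂ) - N.choose k) * p.eval ((N : ℂ) - 2 * (k + 1)) := by
  set A := Splus N * Sminus N with hA
  set c : ℂ := (N : ℂ) - 2 * (k + 1) with hc
  set P := weightProj N (k + 1) with hP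
  have hPA : Commute P A := weightProj_commute N (k + 1)
  -- On this weight space `2 S_z` is the scalar `c`, so `S₋ S₊ = S₊ S₋ - 2 S_z` becomes `A - c`.
  have hB : P * (Sminus N * Splus N) = P * (A - algebraMap ℂ _ c) := by
    have h1 : Sminus N * Splus N = A - (2 : ℂ) • Sz N := by
      rw [hA, Splus_mul_Sminus, add_sub_cancel_right]
    have h2 : P * Sz N = (((N : ℝ) / 2 - (k + 1 : ℕ) : ℝ) : ℂ) • P := by
      rw [← Sz_mul_weightProj, hP, weightProj, Sz_eq_diagonal]
      exact Matrix.commute_diagonal _ _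
    rw [h1, mul_sub, mul_sub, mul_smul_comm, h2, ← Algebra.commutes, ← Algebra.smul_def, smul_smul]
    congr 2
    push_cast
    rw [hc]
    ring
  have hPA' : Commute P (A - algebraMap ℂ _ c) := hPA.sub_right (Algebra.commutes c P).symm
  have hpow : ∀ n : ℕ, P * (Sminus N * Splus N) ^ n = P * (A - algebraMap ℂ _ c) ^ n := by
    intro n
    induction n with
    | zero => simp
    | succ n ih =>
      rw [pow_succ, ← mul_assoc, ih, (hPA'.pow_right n).eq, mul_assoc, hB, ← mul_assoc,
        ← (hPA'.pow_right n).eq, mul_assoc, ← pow_succ]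
  -- For a positive power, moving one `S₊` around the trace lands on the weight space `k`. The
  -- zeroth power sees only dimensions, and the two binomial coefficients differ; this is the trace
  -- of the new multiplets.
  have htr : ∀ n : ℕ, (P * (A - algebraMap ℂ _ c) ^ n).trace
      = (weightProj N k * A ^ n).trace + ((N.choose (k + 1) : ℂ) - N.choose k) * (0 : ℂ) ^ n := by
    intro n
    cases n with
    | zero => simp [hP, trace_weightProj]
    | succ n =>
      rw [← hpow, zero_pow (Nat.succ_ne_zero n), mul_zero, add_zero]
      have h1 : (Sminus N * Splus N) ^ (n + 1) = Sminus N * A ^ n * Splus N := by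
        clear_value c
        induction n with
        | zero => simp
        | succ n ih =>
          rw [pow_succ, ih, pow_succ A n]
          simp only [mul_assoc, hA]
      rw [h1, ← mul_assoc, ← mul_assoc, hP, weightProj_mul_Sminus, Matrix.trace_mul_comm,
        ← mul_assoc, ← mul_assoc, ← hA, (weightProj_commute N k).eq.symm, mul_assoc, ← pow_succ']
  have hlin : ∀ q : ℂ[X], (P * aeval (A - algebraMap ℂ _ c) q).trace
      = (weightProj N k * aeval A q).trace
        + ((N.choose (k + 1) : ℂ) - N.choose k) * q.eval 0 := by
    intro q
    induction q using Polynomial.induction_on' with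
    | add p q hp hq =>
      simp only [map_add, mul_add, Matrix.trace_add, hp, hq, eval_add]
      ring
    | monomial n a =>
      simp only [aeval_monomial, eval_monomial, ← Algebra.smul_def, mul_smul_comm,
        Matrix.trace_smul, htr, smul_eq_mul]
      ring
  have hcomp : aeval (A - algebraMap ℂ _ c) (p.comp (X + C c)) = aeval A p := by
    rw [aeval_comp]
    simp
  rw [← hcomp, hlin, eval_comp]
  simp

-- The top weight space is spanned by the state with all spins up, on which `S₊ S₋` has the
-- eigenvalue `N`.
open Polynomial in
theorem trace_weightProj_zero_aeval (N : ℕ) (p : ℂ[X]) :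
    (weightProj N 0 * aeval (Splus N * Sminus N) p).trace = p.eval (N : ℂ) := by
  have h1 : weightProj N 0 * (Splus N * Sminus N) = (N : ℂ) • weightProj N 0 := by
    have hz : weightProj N 0 * Sz N = Sz N * weightProj N 0 := by
      rw [weightProj, Sz_eq_diagonal]
      exact Matrix.commute_diagonal _ _
    have hl := congrArg Matrix.conjTranspose (Splus_mul_weightProj_zero N)
    simp only [Matrix.conjTranspose_mul, weightProj_conjTranspose, Splus_conjTranspose,
      Matrix.conjTranspose_zero] at hl
    rw [Splus_mul_Sminus, mul_add, ← mul_assoc, hl, zero_mul, zero_add, mul_smul_comm, hz,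
      Sz_mul_weightProj, smul_smul]
    congr 1
    push_cast
    ring
  have hpow : ∀ n : ℕ, weightProj N 0 * (Splus N * Sminus N) ^ n = (N : ℂ) ^ n • weightProj N 0 := by
    intro n
    induction n with
    | zero => simp
    | succ n ih => rw [pow_succ, ← mul_assoc, ih, smul_mul_assoc, h1, smul_smul, pow_succ]
  induction p using Polynomial.induction_on' with
  | add p q hp hq => simp only [map_add, mul_add, Matrix.trace_add, hp, hq, eval_add]
  | monomial n a =>
    simp only [aeval_monomial, eval_monomial, ← Algebra.smul_def, mul_smul_comm,
      Matrix.trace_smul, hpow, smul_eq_mul, trace_weightProj]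
    simp

/-- The eigenvalue of `S₊ S₋` in the multiplet of spin `N / 2 - j`, at weight `N / 2 - k`. -/
def pairNumber (N j k : ℕ) : ℝ := ((k : ℝ) - j + 1) * ((N : ℝ) - j - k)

/-- The number of multiplets of spin `N / 2 - j`. -/
def multiplicity (N : ℕ) : ℕ → ℝ
  | 0 => 1
  | j + 1 => (N.choose (j + 1) : ℝ) - N.choose j

-- This replaces a decomposition into irreducible representations. Passing from weight `k` to `k +
-- 1` shifts every old eigenvalue by `N - 2 (k + 1)` and adds one new multiplet family `j = k + 1`,
-- whose eigenvalue is that same number.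
open Polynomial in
theorem trace_weightProj_aeval (N k : ℕ) (p : ℂ[X]) :
    (weightProj N k * aeval (Splus N * Sminus N) p).trace
      = ∑ j ∈ Finset.range (k + 1), (multiplicity N j : ℂ) * p.eval (pairNumber N j k : ℂ) := by
  induction k generalizing p with
  | zero =>
    rw [trace_weightProj_zero_aeval]
    simp [multiplicity, pairNumber]
  | succ k ih =>
    rw [trace_weightProj_succ_aeval, ih, Finset.sum_range_succ _ (k + 1)]
    congr 1
    · refine Finset.sum_congr rfl fun j _ => ?_
      rw [eval_comp]
      congr 2
      simp only [eval_add, eval_X, eval_C, pairNumber]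
      push_cast
      ring
    · simp only [multiplicity, pairNumber]
      push_cast
      congr 2
      ring

/-- For `s = N / 2 - j` this is the reflection `s ↦ -s - 1`, which fixes `s (s + 1)`. Symmetry of
the binomial coefficients interchanges the two terms of the multiplicity. -/
theorem multiplicity_reflect {N j : ℕ} (h1 : 1 ≤ j) (h2 : j ≤ N) :
    multiplicity N (N + 1 - j) = -multiplicity N j := by
  obtain ⟨i, rfl⟩ := Nat.exists_eq_add_of_le' h1
  obtain ⟨d, rfl⟩ := Nat.exists_eq_add_of_le h2
  have h3 : i + 1 + d + 1 - (i + 1) = d + 1 := by omega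
  rw [h3]
  simp only [multiplicity]
  rw [Nat.choose_symm_of_eq_add (by omega : i + 1 + d = (d + 1) + i),
    Nat.choose_symm_of_eq_add (by omega : i + 1 + d = d + (i + 1))]
  ring

theorem pairNumber_reflect {N j k : ℕ} (h : j ≤ N) :
    pairNumber N (N + 1 - j) k = pairNumber N j k := by
  simp only [pairNumber]
  rw [Nat.cast_sub (by omega)]
  push_cast
  ring

/-- Only the spins `N / 2 - j ≥ |N / 2 - k|` contribute at the weight `N / 2 - k`. -/
theorem sum_multiplicity_restrict {N k : ℕ} (hk : k ≤ N) (f : ℝ → ℂ) :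
    ∑ j ∈ Finset.range (k + 1), (multiplicity N j : ℂ) * f (pairNumber N j k)
      = ∑ j ∈ (Finset.range (k + 1)).filter (fun j => j + k ≤ N),
          (multiplicity N j : ℂ) * f (pairNumber N j k) := by
  rw [← Finset.sum_filter_add_sum_filter_not (Finset.range (k + 1)) (fun j => j + k ≤ N)]
  refine add_eq_left.2 ?_
  -- The unphysical terms cancel in pairs under the reflection; a fixed point equals its own
  -- negative in multiplicity and contributes zero.
  refine Finset.sum_involution (fun j _ => N + 1 - j) ?_ ?_ ?_ ?_
  · intro j hj
    simp only [Finset.mem_filter, Finset.mem_range] at hj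
    rw [multiplicity_reflect (by omega) (by omega), pairNumber_reflect (by omega)]
    push_cast
    ring
  · intro j hj h0 h1
    simp only [Finset.mem_filter, Finset.mem_range] at hj
    refine h0 ?_
    have h2 := multiplicity_reflect (N := N) (j := j) (by omega) (by omega)
    rw [h1] at h2
    have h3 : multiplicity N j = 0 := by linarith
    rw [h3]
    simp
  · intro j hj
    simp only [Finset.mem_filter, Finset.mem_range] at hj ⊢
    omega
  · intro j hj
    simp only [Finset.mem_filter, Finset.mem_range] at hj
    omega

end Weights

/-! ### The Gibbs state of a layer as a probability distribution of spins and weights -/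

theorem hasSum_matrix_exp {n : Type*} [Fintype n] [DecidableEq n] (M : Matrix n n ℂ) :
    HasSum (fun i : ℕ => ((i.factorial : ℂ)⁻¹) • M ^ i) (NormedSpace.exp M) := by
  let _ : NormedRing (Matrix n n ℂ) := Matrix.linftyOpNormedRing
  let _ : NormedAlgebra ℂ (Matrix n n ℂ) := Matrix.linftyOpNormedAlgebra
  exact NormedSpace.exp_series_hasSum_exp' (𝕂 := ℂ) M

open Polynomial in
theorem trace_weightProj_exp_aeval {N k : ℕ} (hk : k ≤ N) (γ : ℂ) (q : ℂ[X]) :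
    (weightProj N k * NormedSpace.exp (γ • (Splus N * Sminus N))
        * aeval (Splus N * Sminus N) q).trace
      = ∑ j ∈ (Finset.range (k + 1)).filter (fun j => j + k ≤ N),
        (multiplicity N j : ℂ) *
          (Complex.exp (γ * pairNumber N j k) * q.eval (pairNumber N j k : ℂ)) := by
  set A := Splus N * Sminus N with hA
  have h1 : HasSum (fun i : ℕ => (weightProj N k * (((i.factorial : ℂ)⁻¹) • (γ • A) ^ i)
      * aeval A q).trace) (weightProj N k * NormedSpace.exp (γ • A) * aeval A q).trace :=
    (((hasSum_matrix_exp (γ • A)).mul_left (weightProj N k)).mul_right (aeval A q)).map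
      (Matrix.traceAddMonoidHom (Spins N) ℂ) (Continuous.matrix_trace continuous_id)
  have h2 : ∀ i : ℕ, (weightProj N k * (((i.factorial : ℂ)⁻¹) • (γ • A) ^ i) * aeval A q).trace
      = ∑ j ∈ Finset.range (k + 1), (multiplicity N j : ℂ) *
        ((γ * pairNumber N j k) ^ i / i.factorial * q.eval (pairNumber N j k : ℂ)) := by
    intro i
    have h3 : weightProj N k * (((i.factorial : ℂ)⁻¹) • (γ • A) ^ i) * aeval A q
        = (((i.factorial : ℂ)⁻¹) * γ ^ i) • (weightProj N k * aeval A (X ^ i * q)) := by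
      rw [map_mul, map_pow, aeval_X, _root_.smul_pow, smul_smul, mul_smul_comm, smul_mul_assoc, mul_assoc]
    rw [h3, Matrix.trace_smul, trace_weightProj_aeval, smul_eq_mul, Finset.mul_sum]
    refine Finset.sum_congr rfl fun j _ => ?_
    simp only [eval_mul, eval_pow, eval_X, mul_pow]
    field_simp
  simp only [h2] at h1
  have h4 : HasSum (fun i : ℕ => ∑ j ∈ Finset.range (k + 1), (multiplicity N j : ℂ) *
        ((γ * pairNumber N j k) ^ i / i.factorial * q.eval (pairNumber N j k : ℂ)))
      (∑ j ∈ Finset.range (k + 1), (multiplicity N j : ℂ) *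
        (Complex.exp (γ * pairNumber N j k) * q.eval (pairNumber N j k : ℂ))) := by
    refine hasSum_sum fun j _ => HasSum.mul_left _ (HasSum.mul_right _ ?_)
    rw [Complex.exp_eq_exp_ℂ]
    exact NormedSpace.expSeries_div_hasSum_exp _
  rw [h1.unique h4]
  exact sum_multiplicity_restrict hk fun x => Complex.exp (γ * x) * q.eval (x : ℂ)

/-- The labels `(j, k)` of the spins `N / 2 - j` and the weights `N / 2 - k` that occur. -/
def spinStates (N : ℕ) : Finset (ℕ × ℕ) :=
  (Finset.range (N + 1) ×ˢ Finset.range (N + 1)).filter fun p => p.1 ≤ p.2 ∧ p.1 + p.2 ≤ N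

/-- The statistical weight of the states with the label `(j, k)`. -/
def bcsWeight (β : ℝ) (l : BCSLayer) (N : ℕ) (p : ℕ × ℕ) : ℝ :=
  multiplicity N p.1 * Real.exp (2 * β * l.Tc / N * pairNumber N p.1 p.2
    + 2 * β * l.ε * ((N : ℝ) / 2 - p.2))

/-- The thermal average of a function of the label. -/
def bcsAverage (β : ℝ) (l : BCSLayer) (N : ℕ) (f : ℕ × ℕ → ℝ) : ℝ :=
  (∑ p ∈ spinStates N, bcsWeight β l N p * f p) / ∑ p ∈ spinStates N, bcsWeight β l N p

theorem neg_smul_bcsHamiltonian (β : ℝ) (l : BCSLayer) (N : ℕ) :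
    (-(β : ℂ)) • bcsHamiltonian l N = ((2 * β * l.ε : ℝ) : ℂ) • Sz N
      + ((2 * β * l.Tc / N : ℝ) : ℂ) • (Splus N * Sminus N) := by
  rw [bcsHamiltonian, smul_sub, smul_smul, smul_smul, sub_eq_add_neg, ← neg_smul]
  push_cast
  congr 2 <;> ring

theorem exp_bcsHamiltonian (β : ℝ) (l : BCSLayer) (N : ℕ) :
    NormedSpace.exp ((-(β : ℂ)) • bcsHamiltonian l N)
      = (Matrix.diagonal fun σ => Complex.exp ((2 * β * l.ε * ((N : ℝ) / 2 - down σ) : ℝ) : ℂ))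
        * NormedSpace.exp (((2 * β * l.Tc / N : ℝ) : ℂ) • (Splus N * Sminus N)) := by
  rw [neg_smul_bcsHamiltonian, Matrix.exp_add_of_commute _ _
    (((Sz_commute_Splus_mul_Sminus N).smul_left _).smul_right _), Sz_eq_diagonal,
    ← Matrix.diagonal_smul, Matrix.exp_diagonal]
  congr 2
  ext σ
  rw [Pi.coe_exp, Complex.exp_eq_exp_ℂ]
  simp

-- The `S_z` part of the Gibbs factor and the observable are diagonal, hence combinations of weight
-- projections; each of these leaves a trace of a function of `S₊ S₋` alone.
open Polynomial in
theorem trace_exp_bcsHamiltonian_mul (β : ℝ) (l : BCSLayer) (N : ℕ) (q : ℂ[X]) (h : ℕ → ℂ) :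
    (NormedSpace.exp ((-(β : ℂ)) • bcsHamiltonian l N) *
        (aeval (Splus N * Sminus N) q * Matrix.diagonal fun σ => h (down σ))).trace
      = ∑ p ∈ spinStates N,
        (bcsWeight β l N p : ℂ) * (q.eval (pairNumber N p.1 p.2 : ℂ) * h p.2) := by
  set A := Splus N * Sminus N with hA
  set γ : ℂ := ((2 * β * l.Tc / N : ℝ) : ℂ) with hγ
  have hd : (Matrix.diagonal fun σ : Spins N => h (down σ)) *
      (Matrix.diagonal fun σ => Complex.exp ((2 * β * l.ε * ((N : ℝ) / 2 - down σ) : ℝ) : ℂ))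
      = ∑ k ∈ Finset.range (N + 1),
        (h k * Complex.exp ((2 * β * l.ε * ((N : ℝ) / 2 - k) : ℝ) : ℂ)) • weightProj N k := by
    rw [Matrix.diagonal_mul_diagonal]
    ext σ τ
    rw [Matrix.sum_apply]
    by_cases hστ : σ = τ
    · subst hστ
      simp only [Matrix.smul_apply, weightProj, Matrix.diagonal_apply_eq, smul_eq_mul, mul_ite,
        mul_one, mul_zero]
      rw [Finset.sum_ite_eq, if_pos]
      exact Finset.mem_range.2 (Nat.lt_succ_of_le (down_le σ))
    · simp [weightProj, Matrix.diagonal_apply_ne _ hστ]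
  rw [exp_bcsHamiltonian, ← mul_assoc, Matrix.trace_mul_comm, ← mul_assoc, ← mul_assoc, hd,
    Finset.sum_mul, Finset.sum_mul, Matrix.trace_sum, spinStates, Finset.sum_filter,
    Finset.sum_product_right]
  refine Finset.sum_congr rfl fun k hk => ?_
  have hk' : k ≤ N := Nat.lt_succ_iff.1 (Finset.mem_range.1 hk)
  rw [smul_mul_assoc, smul_mul_assoc, Matrix.trace_smul, trace_weightProj_exp_aeval hk',
    ← Finset.sum_filter]
  have hs : (Finset.range (N + 1)).filter (fun j => j ≤ k ∧ j + k ≤ N)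
      = (Finset.range (k + 1)).filter (fun j => j + k ≤ N) := by
    ext j
    simp only [Finset.mem_filter, Finset.mem_range]
    omega
  rw [hs, smul_eq_mul, Finset.mul_sum]
  refine Finset.sum_congr rfl fun j _ => ?_
  rw [bcsWeight, Real.exp_add]
  push_cast
  ring

open Polynomial in
theorem gibbs_bcsHamiltonian (β : ℝ) (l : BCSLayer) (N : ℕ) (q : ℂ[X]) (h : ℕ → ℂ)
    {f : ℕ × ℕ → ℝ} (hf : ∀ p, q.eval (pairNumber N p.1 p.2 : ℂ) * h p.2 = f p) :
    gibbs β (bcsHamiltonian l N)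
      (aeval (Splus N * Sminus N) q * Matrix.diagonal fun σ => h (down σ))
      = (bcsAverage β l N f : ℂ) := by
  have h1 := trace_exp_bcsHamiltonian_mul β l N q h
  have h2 := trace_exp_bcsHamiltonian_mul β l N 1 fun _ => 1
  rw [map_one, Matrix.diagonal_one, one_mul, mul_one] at h2
  rw [gibbs, h1, h2, bcsAverage]
  push_cast
  simp only [hf, eval_one, mul_one]

theorem multiplicity_le (N j : ℕ) : multiplicity N j ≤ N.choose j := by
  cases j with
  | zero => simp [multiplicity]
  | succ j => simp [multiplicity]

/-- In the physical range the difference of neighbouring binomials loses at most a factor `N + 1`,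
which is invisible on the exponential scale. -/
theorem choose_le_mul_multiplicity {N j : ℕ} (hj : 2 * j ≤ N) :
    (N.choose j : ℝ) ≤ (N + 1) * multiplicity N j := by
  cases j with
  | zero => simp [multiplicity]
  | succ j =>
    have h1 : ((N.choose (j + 1) : ℕ) : ℝ) * (j + 1) = N.choose j * ((N : ℝ) - j) := by
      have := Nat.choose_succ_right_eq N j
      rw [← Nat.cast_sub (by omega : j ≤ N)]
      exact_mod_cast this
    have h2 : (0 : ℝ) ≤ N.choose j := by positivity
    have h3 : (2 * (j + 1) : ℝ) ≤ N := by exact_mod_cast hj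
    simp only [multiplicity]
    nlinarith [mul_nonneg h2 (by linarith : (0 : ℝ) ≤ (N : ℝ) - 2 * (j + 1))]

theorem multiplicity_pos {N j : ℕ} (hj : 2 * j ≤ N) : 0 < multiplicity N j := by
  have h1 := choose_le_mul_multiplicity hj
  have h2 : (0 : ℝ) < N.choose j := by exact_mod_cast Nat.choose_pos (by omega)
  by_contra! h3
  nlinarith [(by positivity : (0 : ℝ) < N + 1)]

/-! ### Concentration of the thermal distribution -/

/-- After writing `tanh` as a quotient, the numerator of the derivative is `z - sinh z cosh z`,
negative because `2 z < sinh (2 z)`. -/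
theorem strictAntiOn_tanh_div : StrictAntiOn (fun z : ℝ => Real.tanh z / z) (Set.Ioi 0) := by
  have hd : ∀ z ∈ Set.Ioi (0 : ℝ), HasDerivAt (fun z : ℝ => Real.sinh z / (Real.cosh z * z))
      ((Real.cosh z * (Real.cosh z * z) - Real.sinh z * (Real.sinh z * z + Real.cosh z * 1))
        / (Real.cosh z * z) ^ 2) z := fun z hz =>
    (Real.hasDerivAt_sinh z).div ((Real.hasDerivAt_cosh z).mul (hasDerivAt_id z))
      (mul_ne_zero (Real.cosh_pos z).ne' (ne_of_gt hz))
  have h : StrictAntiOn (fun z : ℝ => Real.sinh z / (Real.cosh z * z)) (Set.Ioi 0) := by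
    refine strictAntiOn_of_deriv_neg (convex_Ioi 0)
      (fun z hz => (hd z hz).continuousAt.continuousWithinAt) fun z hz => ?_
    rw [interior_Ioi] at hz
    rw [(hd z hz).deriv]
    refine div_neg_of_neg_of_pos ?_ (by have := Real.cosh_pos z; have : (0:ℝ) < z := hz; positivity)
    have h1 : 2 * z < Real.sinh (2 * z) := Real.self_lt_sinh_iff.2 (by simpa using hz)
    rw [Real.sinh_two_mul] at h1
    have h2 := Real.cosh_sq z
    have h3 : Real.cosh z * (Real.cosh z * z) - Real.sinh z * (Real.sinh z * z + Real.cosh z * 1)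
        = z - Real.sinh z * Real.cosh z := by
      linear_combination z * h2
    rw [h3]
    linarith
  refine h.congr fun z _ => ?_
  rw [Real.tanh_eq_sinh_div_cosh, div_div]

/-- The free energy of the multiplets, as a function of the spin per site. -/
def spinPressure (a y : ℝ) : ℝ := Real.log (2 * Real.cosh (a * y)) - a * y ^ 2 / 2

theorem hasDerivAt_spinPressure (a y : ℝ) :
    HasDerivAt (spinPressure a) (a * (Real.tanh (a * y) - y)) y := by
  have hc : 2 * Real.cosh (a * y) ≠ 0 := by have := Real.cosh_pos (a * y); positivity
  have h1 : HasDerivAt (fun y => Real.log (2 * Real.cosh (a * y))) _ y :=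
    (((Real.hasDerivAt_cosh (a * y)).comp y ((hasDerivAt_id y).const_mul a)).const_mul 2).log hc
  have h2 : HasDerivAt (fun y : ℝ => a * y ^ 2 / 2) _ y :=
    (((hasDerivAt_id y).pow 2).const_mul a).div_const 2
  refine (h1.sub h2).congr_deriv ?_
  rw [Real.tanh_eq_sinh_div_cosh]
  have := (Real.cosh_pos (a * y)).ne'
  simp only [id_eq, Function.comp_apply, Nat.cast_ofNat, Nat.add_one_sub_one, pow_one, mul_one]
  field_simp

theorem continuous_spinPressure (a : ℝ) : Continuous (spinPressure a) :=
  continuous_iff_continuousAt.2 fun y => (hasDerivAt_spinPressure a y).continuousAt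

/-- The sign of the derivative `a (tanh (a y) - y)` compares `tanh z / z` at `z = a y` with its
value `1 / a` at `a r`, so it is positive below `r` and negative above. -/
theorem spinPressure_lt {a r y : ℝ} (ha : 0 < a) (hr : 0 < r) (h : Real.tanh (a * r) = r)
    (hy : 0 ≤ y) (hne : y ≠ r) : spinPressure a y < spinPressure a r := by
  have hcont := continuous_spinPressure a
  have hdiv : Real.tanh (a * r) / (a * r) = 1 / a := by
    rw [h]
    field_simp
  rcases lt_or_gt_of_ne hne with hlt | hgt
  · have hm : StrictMonoOn (spinPressure a) (Set.Icc 0 r) := by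
      refine strictMonoOn_of_deriv_pos (convex_Icc 0 r) hcont.continuousOn fun z hz => ?_
      rw [interior_Icc] at hz
      rw [(hasDerivAt_spinPressure a z).deriv]
      have h1 := strictAntiOn_tanh_div (Set.mem_Ioi.2 (mul_pos ha hz.1))
        (Set.mem_Ioi.2 (mul_pos ha hr)) (mul_lt_mul_of_pos_left hz.2 ha)
      simp only [hdiv] at h1
      rw [div_lt_div_iff₀ ha (mul_pos ha hz.1)] at h1
      have : z < Real.tanh (a * z) := by nlinarith
      exact mul_pos ha (by linarith)
    exact hm ⟨hy, hlt.le⟩ ⟨hr.le, le_rfl⟩ hlt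
  · have hm : StrictAntiOn (spinPressure a) (Set.Ici r) := by
      refine strictAntiOn_of_deriv_neg (convex_Ici r) hcont.continuousOn fun z hz => ?_
      rw [interior_Ici] at hz
      have hz0 : 0 < z := hr.trans hz
      rw [(hasDerivAt_spinPressure a z).deriv]
      have h1 := strictAntiOn_tanh_div (Set.mem_Ioi.2 (mul_pos ha hr))
        (Set.mem_Ioi.2 (mul_pos ha hz0)) (mul_lt_mul_of_pos_left hz ha)
      simp only [hdiv] at h1
      rw [div_lt_div_iff₀ (mul_pos ha hz0) ha] at h1
      have : Real.tanh (a * z) < z := by nlinarith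
      exact mul_neg_of_pos_of_neg ha (by linarith)
    exact hm (Set.mem_Ici.2 le_rfl) hgt.le hgt

theorem exists_spinPressure_gap {a r δ : ℝ} (ha : 0 < a) (hr : 0 < r)
    (h : Real.tanh (a * r) = r) (hδ : 0 < δ) :
    ∃ c > 0, ∀ y ∈ Set.Icc (0 : ℝ) 1, δ ≤ |y - r| → spinPressure a y ≤ spinPressure a r - c := by
  have hK : IsCompact (Set.Icc (0 : ℝ) 1 ∩ {y | δ ≤ |y - r|}) :=
    isCompact_Icc.inter_right (isClosed_le continuous_const (by fun_prop))
  rcases (Set.Icc (0 : ℝ) 1 ∩ {y | δ ≤ |y - r|}).eq_empty_or_nonempty with he | hne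
  · refine ⟨1, one_pos, fun y hy hy' => ?_⟩
    have : y ∈ Set.Icc (0 : ℝ) 1 ∩ {y | δ ≤ |y - r|} := ⟨hy, hy'⟩
    rw [he] at this
    exact absurd this (Set.notMem_empty y)
  · obtain ⟨z, hz, hmax⟩ := hK.exists_isMaxOn hne (continuous_spinPressure a).continuousOn
    have hzr : z ≠ r := by
      rintro rfl
      have := hz.2
      simp only [Set.mem_ofPred_eq, sub_self, abs_zero] at this
      linarith
    have hlt := spinPressure_lt ha hr h hz.1.1 hzr
    refine ⟨spinPressure a r - spinPressure a z, by linarith, fun y hy hy' => ?_⟩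
    have := hmax (⟨hy, hy'⟩ : y ∈ Set.Icc (0 : ℝ) 1 ∩ {y | δ ≤ |y - r|})
    simp only [Set.mem_ofPred_eq] at this
    linarith

theorem exp_spinPressure (a y : ℝ) (N : ℕ) :
    Real.exp (N * spinPressure a y)
      = (2 * Real.cosh (a * y)) ^ N * Real.exp (-(N * (a * y ^ 2 / 2))) := by
  have hc : 0 < 2 * Real.cosh (a * y) := by have := Real.cosh_pos (a * y); positivity
  rw [spinPressure, mul_sub, sub_eq_add_neg, Real.exp_add, Real.exp_nat_mul, Real.exp_log hc]

theorem two_cosh_pow (z : ℝ) (N : ℕ) :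
    (2 * Real.cosh z) ^ N
      = ∑ j ∈ Finset.range (N + 1), (N.choose j : ℝ) * Real.exp (z * (N - 2 * j)) := by
  have h : 2 * Real.cosh z = Real.exp (-z) + Real.exp z := by
    rw [Real.cosh_eq]
    ring
  rw [h, add_pow]
  refine Finset.sum_congr rfl fun j hj => ?_
  have hj' : j ≤ N := Nat.lt_succ_iff.1 (Finset.mem_range.1 hj)
  rw [← Real.exp_nat_mul, ← Real.exp_nat_mul, ← Real.exp_add, mul_comm, Nat.cast_sub hj']
  congr 2
  ring

/-- An exponential tilt: the binomial coefficient is bounded by one term of the expansion of `(2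
cosh z) ^ N`, at the tilt `z = a y` adapted to the label. -/
theorem choose_mul_exp_le {N j : ℕ} (hN : 0 < N) (hj : j ≤ N) (a : ℝ) {y : ℝ}
    (hy : y = ((N : ℝ) - 2 * j) / N) :
    (N.choose j : ℝ) * Real.exp (N * (a * y ^ 2 / 2)) ≤ Real.exp (N * spinPressure a y) := by
  have hN' : (0 : ℝ) < N := by exact_mod_cast hN
  have h1 : (N.choose j : ℝ) * Real.exp (a * y * (N - 2 * j)) ≤ (2 * Real.cosh (a * y)) ^ N := by
    rw [two_cosh_pow]
    exact Finset.single_le_sum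
      (f := fun j : ℕ => (N.choose j : ℝ) * Real.exp (a * y * (N - 2 * j)))
      (fun i _ => by positivity) (Finset.mem_range.2 (Nat.lt_succ_of_le hj))
  have h2 : (N : ℝ) - 2 * j = N * y := by
    rw [hy]
    field_simp
  rw [h2] at h1
  rw [exp_spinPressure]
  calc (N.choose j : ℝ) * Real.exp (N * (a * y ^ 2 / 2))
      = (N.choose j : ℝ) * Real.exp (a * y * (N * y)) * Real.exp (-(N * (a * y ^ 2 / 2))) := by
        rw [mul_assoc, ← Real.exp_add]
        congr 2
        ring
    _ ≤ _ := by gcongr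

/-- Completing the square, `a r y - a r² / 2 ≤ a y² / 2`, bounds the expansion of `(2 cosh (a r)) ^
N`. One of its `N + 1` terms is at least the average, and `j ↦ N - j` brings it into the lower half.
-/
theorem exists_choose_mul_exp_ge {N : ℕ} (hN : 0 < N) {a r : ℝ} (ha : 0 < a) :
    ∃ j, 2 * j ≤ N ∧ Real.exp (N * spinPressure a r) / (N + 1)
      ≤ (N.choose j : ℝ) * Real.exp (N * (a * (((N : ℝ) - 2 * j) / N) ^ 2 / 2)) := by
  have hN' : (0 : ℝ) < N := by exact_mod_cast hN
  have h1 : Real.exp (N * spinPressure a r) ≤ ∑ j ∈ Finset.range (N + 1),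
      (N.choose j : ℝ) * Real.exp (N * (a * (((N : ℝ) - 2 * j) / N) ^ 2 / 2)) := by
    rw [exp_spinPressure, two_cosh_pow, Finset.sum_mul]
    refine Finset.sum_le_sum fun j _ => ?_
    rw [mul_assoc, ← Real.exp_add]
    gcongr
    set y := ((N : ℝ) - 2 * j) / N with hy
    have h2 : (N : ℝ) - 2 * j = N * y := by
      rw [hy]
      field_simp
    rw [h2]
    nlinarith [mul_nonneg (mul_nonneg hN'.le ha.le) (sq_nonneg (r - y))]
  obtain ⟨j, hj, hj'⟩ := Finset.exists_le_of_sum_le (s := Finset.range (N + 1))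
    (f := fun _ => Real.exp (N * spinPressure a r) / (N + 1))
    (g := fun j : ℕ => (N.choose j : ℝ) * Real.exp (N * (a * (((N : ℝ) - 2 * j) / N) ^ 2 / 2)))
    ⟨0, by simp⟩ (by
      refine le_trans (le_of_eq ?_) h1
      rw [Finset.sum_const, Finset.card_range, nsmul_eq_mul]
      push_cast
      field_simp)
  have hjN : j ≤ N := Nat.lt_succ_iff.1 (Finset.mem_range.1 hj)
  rcases le_or_gt (2 * j) N with h | h
  · exact ⟨j, h, hj'⟩
  · refine ⟨N - j, by omega, ?_⟩
    rw [Nat.choose_symm hjN, Nat.cast_sub hjN]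
    have : ((N : ℝ) - 2 * (N - j)) / N = -(((N : ℝ) - 2 * j) / N) := by ring
    rw [this, neg_sq]
    exact hj'

/-- Completing squares separates the labels: the spin variable `y` carries the exponent that pairs
with the binomial entropy, the weight variable `u` is Gaussian about `ε / T_c`, and the remaining
linear terms are bounded. -/
theorem bcsWeight_eq {β : ℝ} {l : BCSLayer} (hTc : 0 < l.Tc) {N : ℕ} (hN : 0 < N) (p : ℕ × ℕ)
    {y u : ℝ} (hy : y = ((N : ℝ) - 2 * p.1) / N) (hu : u = ((N : ℝ) - 2 * p.2) / N) :
    bcsWeight β l N p = multiplicity N p.1 * Real.exp (N * (β * l.Tc * y ^ 2 / 2)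
      + (N * (β * l.Tc * (l.ε / l.Tc) ^ 2 / 2) - N * (β * l.Tc * (u - l.ε / l.Tc) ^ 2 / 2)
        + (β * l.Tc * y + β * l.Tc * u))) := by
  have hN' : (N : ℝ) ≠ 0 := by exact_mod_cast hN.ne'
  rw [bcsWeight, hy, hu, pairNumber]
  congr 2
  field_simp
  ring

theorem mem_spinStates {N : ℕ} {p : ℕ × ℕ} :
    p ∈ spinStates N ↔ p.1 ≤ p.2 ∧ p.1 + p.2 ≤ N := by
  simp only [spinStates, Finset.mem_filter, Finset.mem_product, Finset.mem_range]
  omega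

theorem bcsWeight_pos {β : ℝ} {l : BCSLayer} {N : ℕ} {p : ℕ × ℕ} (hp : p ∈ spinStates N) :
    0 < bcsWeight β l N p := by
  rw [mem_spinStates] at hp
  exact mul_pos (multiplicity_pos (by omega)) (Real.exp_pos _)

theorem label_bounds {N : ℕ} (hN : 0 < N) {p : ℕ × ℕ} (hp : p ∈ spinStates N) :
    ((N : ℝ) - 2 * p.1) / N ∈ Set.Icc (0 : ℝ) 1 ∧
      |((N : ℝ) - 2 * p.2) / N| ≤ ((N : ℝ) - 2 * p.1) / N := by
  have hN' : (0 : ℝ) < N := by exact_mod_cast hN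
  rw [mem_spinStates] at hp
  have h1 : (p.1 : ℝ) ≤ p.2 := by exact_mod_cast hp.1
  have h2 : (p.1 : ℝ) + p.2 ≤ N := by exact_mod_cast hp.2
  have h3 : (0 : ℝ) ≤ p.1 := by positivity
  refine ⟨⟨div_nonneg (by linarith) hN'.le, (div_le_one hN').2 (by linarith)⟩, ?_⟩
  rw [abs_div, abs_of_pos hN']
  refine div_le_div_of_nonneg_right ?_ hN'.le
  rw [abs_le]
  constructor <;> linarith

theorem tendsto_poly_mul_exp_neg {c : ℝ} (hc : 0 < c) (n : ℕ) :
    Tendsto (fun N : ℕ => ((N : ℝ) + 1) ^ n * Real.exp (-(c * N))) atTop (𝓝 0) := by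
  have h1 : Tendsto (fun N : ℕ => c * ((N : ℝ) + 1)) atTop atTop :=
    (tendsto_atTop_add_const_right _ _ tendsto_natCast_atTop_atTop).const_mul_atTop hc
  have h2 := ((Real.tendsto_pow_mul_exp_neg_atTop_nhds_zero n).comp h1).const_mul
    (Real.exp c / c ^ n)
  rw [mul_zero] at h2
  refine h2.congr fun N => ?_
  have : Real.exp (-(c * N)) = Real.exp c * Real.exp (-(c * ((N : ℝ) + 1))) := by
    rw [← Real.exp_add]
    congr 1
    ring
  rw [this, Function.comp_apply, mul_pow]
  field_simp

section Concentration

variable {β : ℝ} {l : BCSLayer} {r : ℝ}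

/-- The exponential order of the partition function. -/
def bcsPressure (β : ℝ) (l : BCSLayer) (r : ℝ) : ℝ :=
  spinPressure (β * l.Tc) r + β * l.Tc * (l.ε / l.Tc) ^ 2 / 2

theorem bcsWeight_le (hβ : 0 < β) (hTc : 0 < l.Tc) (hr : 0 < r)
    (h : Real.tanh (β * l.Tc * r) = r) {δ : ℝ} (hδ : 0 < δ) :
    ∃ c > 0, ∀ N : ℕ, 0 < N → ∀ p ∈ spinStates N,
      (δ < |((N : ℝ) - 2 * p.1) / N - r| ∨ δ < |((N : ℝ) - 2 * p.2) / N - l.ε / l.Tc|) →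
      bcsWeight β l N p ≤
        Real.exp (N * bcsPressure β l r) * Real.exp (2 * (β * l.Tc)) * Real.exp (-(c * N)) := by
  have ha : 0 < β * l.Tc := mul_pos hβ hTc
  obtain ⟨c, hc, hgap⟩ := exists_spinPressure_gap ha hr h hδ
  -- The two rates belong to the two ways of being atypical: loss of spin pressure away from `r`,
  -- and the Gaussian cost of a wrong weight.
  refine ⟨min c (β * l.Tc * δ ^ 2 / 2), lt_min hc (by positivity), fun N hN p hp hbad => ?_⟩
  have hN' : (0 : ℝ) < N := by exact_mod_cast hN
  obtain ⟨hy01, hu⟩ := label_bounds hN hp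
  rw [bcsWeight_eq hTc hN p rfl rfl]
  set y := ((N : ℝ) - 2 * p.1) / N with hy
  set u := ((N : ℝ) - 2 * p.2) / N with hu'
  set u₀ := l.ε / l.Tc
  set a := β * l.Tc
  have hp' := mem_spinStates.1 hp
  have h1 := choose_mul_exp_le hN (by omega : p.1 ≤ N) a hy
  have hmax : spinPressure a y ≤ spinPressure a r := by
    by_cases hyr : y = r
    · rw [hyr]
    · exact (spinPressure_lt ha hr h hy01.1 hyr).le
  have hle : spinPressure a y - a * (u - u₀) ^ 2 / 2
      ≤ spinPressure a r - min c (a * δ ^ 2 / 2) := by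
    rcases hbad with hb | hb
    · have h2 := hgap y hy01 hb.le
      have h3 : 0 ≤ a * (u - u₀) ^ 2 / 2 := by positivity
      have := min_le_left c (a * δ ^ 2 / 2)
      linarith
    · have h3 : δ ^ 2 ≤ (u - u₀) ^ 2 := by
        rw [← sq_abs (u - u₀)]
        exact pow_le_pow_left₀ hδ.le hb.le 2
      have h4 : a * δ ^ 2 / 2 ≤ a * (u - u₀) ^ 2 / 2 := by gcongr
      have := min_le_right c (a * δ ^ 2 / 2)
      linarith
  have hyu : a * y + a * u ≤ 2 * a := by
    have := (abs_le.1 hu).2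
    have h5 := hy01.2
    nlinarith
  calc multiplicity N p.1 * Real.exp (N * (a * y ^ 2 / 2)
        + (N * (a * u₀ ^ 2 / 2) - N * (a * (u - u₀) ^ 2 / 2) + (a * y + a * u)))
      = multiplicity N p.1 * Real.exp (N * (a * y ^ 2 / 2)) *
        Real.exp (N * (a * u₀ ^ 2 / 2) - N * (a * (u - u₀) ^ 2 / 2) + (a * y + a * u)) := by
        rw [Real.exp_add, ← mul_assoc]
    _ ≤ Real.exp (N * spinPressure a y) *
        Real.exp (N * (a * u₀ ^ 2 / 2) - N * (a * (u - u₀) ^ 2 / 2) + (a * y + a * u)) := by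
        refine mul_le_mul_of_nonneg_right (le_trans ?_ h1) (Real.exp_pos _).le
        exact mul_le_mul_of_nonneg_right (multiplicity_le N p.1) (Real.exp_pos _).le
    _ ≤ _ := by
        rw [← Real.exp_add, ← Real.exp_add, ← Real.exp_add, Real.exp_le_exp, bcsPressure]
        nlinarith [mul_le_mul_of_nonneg_left hle hN'.le]

/-- A single label suffices. Its spin has a dominating binomial term and so lies near `r`; its
weight is rounded from `ε / T_c`. The assumption `|ε / T_c| < r` makes that weight admissible for
that spin. -/
theorem eventually_le_sum_bcsWeight (hβ : 0 < β) (hTc : 0 < l.Tc) (hr : 0 < r)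
    (h : Real.tanh (β * l.Tc * r) = r) (hu : |l.ε / l.Tc| < r) :
    ∀ᶠ N : ℕ in atTop, Real.exp (N * bcsPressure β l r) * Real.exp (-(4 * (β * l.Tc)))
      / ((N : ℝ) + 1) ^ 2 ≤ ∑ p ∈ spinStates N, bcsWeight β l N p := by
  have ha : 0 < β * l.Tc := mul_pos hβ hTc
  set u₀ := l.ε / l.Tc with hu₀
  have hδ : 0 < (r - |u₀|) / 2 := by linarith
  obtain ⟨c, hc, hgap⟩ := exists_spinPressure_gap ha hr h hδ
  have hr1 : r < 1 := h ▸ Real.tanh_lt_one _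
  have e1 := (tendsto_poly_mul_exp_neg hc 1).eventually (gt_mem_nhds one_pos)
  have e2 : ∀ᶠ N : ℕ in atTop, 2 / ((r - |u₀|) / 2) ≤ (N : ℝ) :=
    tendsto_natCast_atTop_atTop.eventually_ge_atTop _
  filter_upwards [e1, e2, eventually_gt_atTop 0] with N h1 h2 hN
  have hN' : (0 : ℝ) < N := by exact_mod_cast hN
  have hN1 : (1 : ℝ) ≤ N := by exact_mod_cast hN
  rw [div_le_iff₀ hδ] at h2
  obtain ⟨j, hj, hjle⟩ := exists_choose_mul_exp_ge hN (r := r) ha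
  set y := ((N : ℝ) - 2 * j) / N with hy
  have hyN : (N : ℝ) - 2 * j = N * y := by
    rw [hy]
    field_simp
  have hj0 : (0 : ℝ) ≤ j := by positivity
  have hj2 : (2 : ℝ) * j ≤ N := by exact_mod_cast hj
  have hy0 : 0 ≤ y := div_nonneg (by linarith) hN'.le
  have hy1 : y ≤ 1 := (div_le_one hN').2 (by linarith)
  -- Away from `r` the term found by averaging would be exponentially smaller than its lower bound,
  -- which loses only a factor `N + 1`.
  have hyr : |y - r| < (r - |u₀|) / 2 := by
    by_contra! hcon
    have h3 := hgap y ⟨hy0, hy1⟩ hcon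
    have h4 := hjle.trans (choose_mul_exp_le hN (by omega) (β * l.Tc) hy)
    have h5 : Real.exp (N * spinPressure (β * l.Tc) y)
        ≤ Real.exp (N * spinPressure (β * l.Tc) r) * Real.exp (-(c * N)) := by
      rw [← Real.exp_add, Real.exp_le_exp]
      nlinarith
    rw [div_le_iff₀ (by positivity)] at h4
    have h6 := Real.exp_pos (N * spinPressure (β * l.Tc) r)
    rw [pow_one] at h1
    nlinarith
  have habs := abs_lt.1 hyr
  have hu1 := neg_abs_le u₀
  have hu2 := le_abs_self u₀
  have ht : 0 ≤ (N : ℝ) * (1 - u₀) / 2 := by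
    have : 0 ≤ 1 - u₀ := by linarith
    positivity
  -- Rounding down puts `N (u - u₀)` between `0` and `2`; the threshold on `N` absorbs this `2` in
  -- the distance between `y` and `u₀`.
  set k := ⌊(N : ℝ) * (1 - u₀) / 2⌋₊ with hk
  have hk1 : (k : ℝ) ≤ N * (1 - u₀) / 2 := Nat.floor_le ht
  have hk2 : (N : ℝ) * (1 - u₀) / 2 < k + 1 := Nat.lt_floor_add_one _
  have hp : (j, k) ∈ spinStates N := by
    rw [mem_spinStates]
    constructor
    · have h3 : (r - |u₀|) / 2 ≤ y - u₀ := by linarith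
      have h4 := mul_le_mul_of_nonneg_left h3 hN'.le
      have : (j : ℝ) ≤ k := by linarith
      exact_mod_cast this
    · have h3 : 0 ≤ y + u₀ := by linarith
      have h4 := mul_nonneg hN'.le h3
      have : (j : ℝ) + k ≤ N := by linarith
      exact_mod_cast this
  refine le_trans ?_ (Finset.single_le_sum (fun p hp => (bcsWeight_pos hp).le) hp)
  obtain ⟨_, hub⟩ := label_bounds hN hp
  rw [bcsWeight_eq hTc hN (j, k) rfl rfl]
  simp only at hub ⊢
  rw [← hy] at hub ⊢
  set u := ((N : ℝ) - 2 * k) / N with hu'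
  have huN : (N : ℝ) - 2 * k = N * u := by
    rw [hu']
    field_simp
  have hclose : N * (β * l.Tc * (u - u₀) ^ 2 / 2) ≤ 2 * (β * l.Tc) := by
    have h5 : 0 ≤ N * (u - u₀) := by linarith
    have h6 : N * (u - u₀) ≤ 2 := by linarith
    have h7 : (N * (u - u₀)) ^ 2 ≤ 2 ^ 2 := pow_le_pow_left₀ h5 h6 2
    have h8 : 1 * (N * (u - u₀) ^ 2) ≤ N * (N * (u - u₀) ^ 2) :=
      mul_le_mul_of_nonneg_right hN1 (by positivity)
    have h9 : N * (u - u₀) ^ 2 ≤ 4 := by linarith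
    have h10 := mul_le_mul_of_nonneg_left h9 ha.le
    linarith
  have hlow : -(2 * (β * l.Tc)) ≤ β * l.Tc * y + β * l.Tc * u := by
    have h5 := (abs_le.1 hub).1
    have h6 : -2 ≤ y + u := by linarith
    have h7 := mul_le_mul_of_nonneg_left h6 ha.le
    linarith
  have hmult : (N.choose j : ℝ) / (N + 1) ≤ multiplicity N j := by
    rw [div_le_iff₀ (by positivity), mul_comm]
    exact choose_le_mul_multiplicity hj
  calc Real.exp (N * bcsPressure β l r) * Real.exp (-(4 * (β * l.Tc))) / ((N : ℝ) + 1) ^ 2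
      = (Real.exp (N * spinPressure (β * l.Tc) r) / (N + 1)) / (N + 1) *
          Real.exp (N * (β * l.Tc * u₀ ^ 2 / 2) - 4 * (β * l.Tc)) := by
        rw [bcsPressure, ← hu₀, mul_add, Real.exp_add, sub_eq_add_neg, Real.exp_add]
        clear_value u₀
        field_simp
    _ ≤ ((N.choose j : ℝ) * Real.exp (N * (β * l.Tc * y ^ 2 / 2))) / (N + 1) *
          Real.exp (N * (β * l.Tc * u₀ ^ 2 / 2) - N * (β * l.Tc * (u - u₀) ^ 2 / 2)
            + (β * l.Tc * y + β * l.Tc * u)) := by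
        gcongr
        linarith
    _ = ((N.choose j : ℝ) / (N + 1)) * Real.exp (N * (β * l.Tc * y ^ 2 / 2) +
          (N * (β * l.Tc * u₀ ^ 2 / 2) - N * (β * l.Tc * (u - u₀) ^ 2 / 2)
            + (β * l.Tc * y + β * l.Tc * u))) := by
        rw [Real.exp_add (N * (β * l.Tc * y ^ 2 / 2))]
        ring
    _ ≤ _ := by gcongr

/-- The thermal distribution of the spin and the weight per site concentrates. -/
theorem tendsto_bcsAverage_zero (hβ : 0 < β) (hTc : 0 < l.Tc) (hr : 0 < r)
    (h : Real.tanh (β * l.Tc * r) = r) (hu : |l.ε / l.Tc| < r) {f : ℕ → ℕ × ℕ → ℝ} {C : ℝ}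
    (hC : ∀ N, 0 < N → ∀ p ∈ spinStates N, |f N p| ≤ C)
    (hf : ∀ η > 0, ∃ δ > 0, ∀ᶠ N : ℕ in atTop, ∀ p ∈ spinStates N,
      |((N : ℝ) - 2 * p.1) / N - r| ≤ δ → |((N : ℝ) - 2 * p.2) / N - l.ε / l.Tc| ≤ δ →
        |f N p| ≤ η) :
    Tendsto (fun N => bcsAverage β l N (f N)) atTop (𝓝 0) := by
  rw [Metric.tendsto_nhds]
  intro η hη
  obtain ⟨δ, hδ, hgood⟩ := hf (η / 2) (half_pos hη)
  obtain ⟨c, hc, hbad⟩ := bcsWeight_le hβ hTc hr h hδ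
  have hC0 : 0 ≤ C := (abs_nonneg _).trans (hC 1 one_pos (0, 0) (by rw [mem_spinStates]; simp))
  -- Two powers of `N + 1` count labels and two come from the lower bound on the partition function.
  -- The exponent `6` combines its `4` with the `2` of the tail bound.
  have hlim := (tendsto_poly_mul_exp_neg hc 4).const_mul (C * Real.exp (6 * (β * l.Tc)))
  rw [mul_zero] at hlim
  filter_upwards [hgood, eventually_le_sum_bcsWeight hβ hTc hr h hu, eventually_gt_atTop 0,
    hlim.eventually (gt_mem_nhds (half_pos hη))] with N h1 h2 hN h3
  set Z := ∑ p ∈ spinStates N, bcsWeight β l N p with hZ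
  set K := Real.exp (N * bcsPressure β l r) with hK
  have hKpos : 0 < K := Real.exp_pos _
  have hZpos : 0 < Z := lt_of_lt_of_le (by positivity) h2
  have hterm : ∀ p ∈ spinStates N, |bcsWeight β l N p * f N p| ≤ bcsWeight β l N p * (η / 2)
      + C * (K * Real.exp (2 * (β * l.Tc)) * Real.exp (-(c * N))) := by
    intro p hp
    have hw := bcsWeight_pos (β := β) (l := l) hp
    rw [abs_mul, abs_of_pos hw]
    by_cases hb : |((N : ℝ) - 2 * p.1) / N - r| ≤ δ ∧ |((N : ℝ) - 2 * p.2) / N - l.ε / l.Tc| ≤ δ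
    · have := mul_le_mul_of_nonneg_left (h1 p hp hb.1 hb.2) hw.le
      have : 0 ≤ C * (K * Real.exp (2 * (β * l.Tc)) * Real.exp (-(c * N))) := by positivity
      linarith
    · rw [not_and_or, not_le, not_le] at hb
      have h4 := hbad N hN p hp hb
      have h5 : bcsWeight β l N p * |f N p| ≤ bcsWeight β l N p * C :=
        mul_le_mul_of_nonneg_left (hC N hN p hp) hw.le
      have h6 : bcsWeight β l N p * C
          ≤ C * (K * Real.exp (2 * (β * l.Tc)) * Real.exp (-(c * N))) := by
        rw [mul_comm]
        exact mul_le_mul_of_nonneg_left h4 hC0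
      have : 0 ≤ bcsWeight β l N p * (η / 2) := by positivity
      linarith
  have hcard : ((spinStates N).card : ℝ) ≤ ((N : ℝ) + 1) ^ 2 := by
    have : (spinStates N).card ≤ (N + 1) ^ 2 := by
      refine (Finset.card_filter_le _ _).trans_eq ?_
      rw [Finset.card_product, Finset.card_range, sq]
    exact_mod_cast this
  have hsum : |∑ p ∈ spinStates N, bcsWeight β l N p * f N p| ≤ Z * (η / 2)
      + ((N : ℝ) + 1) ^ 2 * (C * (K * Real.exp (2 * (β * l.Tc)) * Real.exp (-(c * N)))) := by
    refine (Finset.abs_sum_le_sum_abs _ _).trans ((Finset.sum_le_sum hterm).trans ?_)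
    rw [Finset.sum_add_distrib, ← Finset.sum_mul, Finset.sum_const, nsmul_eq_mul]
    gcongr
  have hZ2 : K * Real.exp (2 * (β * l.Tc)) * Real.exp (-(c * N)) * ((N : ℝ) + 1) ^ 2
      ≤ Z * (Real.exp (6 * (β * l.Tc)) * (((N : ℝ) + 1) ^ 4 * Real.exp (-(c * N)))) := by
    have h7 := mul_le_mul_of_nonneg_right h2 (by positivity :
      0 ≤ Real.exp (6 * (β * l.Tc)) * (((N : ℝ) + 1) ^ 4 * Real.exp (-(c * N))))
    refine le_trans (le_of_eq ?_) h7
    have h8 : Real.exp (2 * (β * l.Tc))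
        = Real.exp (-(4 * (β * l.Tc))) * Real.exp (6 * (β * l.Tc)) := by
      rw [← Real.exp_add]
      congr 1
      ring
    rw [h8]
    field_simp
  rw [dist_zero_right, Real.norm_eq_abs, bcsAverage, abs_div, abs_of_pos hZpos, div_lt_iff₀ hZpos]
  have h9 := mul_le_mul_of_nonneg_left hZ2 hC0
  have h10 := mul_lt_mul_of_pos_left h3 hZpos
  nlinarith

end Concentration

/-! ### The gap equation -/

/-- Since `M²` is scalar, the even and odd parts of the exponential series are those of `cosh` and
`sinh`. -/
theorem matrix_exp_of_mul_self_eq {n : Type*} [Fintype n] [DecidableEq n] {M : Matrix n n ℂ} {E : ℝ}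
    (hE : E ≠ 0) (h : M * M = ((E : ℂ) ^ 2) • 1) :
    NormedSpace.exp M = (Real.cosh E : ℂ) • 1 + ((Real.sinh E / E : ℝ) : ℂ) • M := by
  have hE' : (E : ℂ) ≠ 0 := Complex.ofReal_ne_zero.2 hE
  have hev : ∀ k : ℕ, M ^ (2 * k) = ((E : ℂ) ^ (2 * k)) • 1 := by
    intro k
    rw [pow_mul, sq, h, smul_pow, one_pow, ← pow_mul]
  refine (hasSum_matrix_exp M).unique (HasSum.even_add_odd ?_ ?_)
  · have h1 := (Complex.hasSum_cosh (E : ℂ)).smul_const (1 : Matrix n n ℂ)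
    rw [← Complex.ofReal_cosh] at h1
    refine h1.congr_fun fun k => ?_
    rw [hev, smul_smul, div_eq_inv_mul]
  · have h1 := (Complex.hasSum_sinh (E : ℂ)).smul_const ((E : ℂ)⁻¹ • M)
    rw [← Complex.ofReal_sinh, smul_smul, ← div_eq_mul_inv, ← Complex.ofReal_div] at h1
    refine h1.congr_fun fun k => ?_
    rw [pow_succ, hev, smul_mul_assoc, one_mul, smul_smul, smul_smul, pow_succ]
    congr 1
    field_simp

theorem trace_siteOp_one (a : Matrix (Fin 2) (Fin 2) ℂ) :
    (siteOp a (0 : Fin 1)).trace = a.trace := by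
  rw [Matrix.trace, Matrix.trace]
  refine Fintype.sum_equiv (Equiv.funUnique (Fin 1) (Fin 2)) _ _ fun σ => ?_
  simp [siteOp]

theorem siteSum_one (a : Matrix (Fin 2) (Fin 2) ℂ) : siteSum 1 a = siteOp a 0 := by
  simp [siteSum]

theorem siteOp_one_one : siteOp (1 : Matrix (Fin 2) (Fin 2) ℂ) (0 : Fin 1) = 1 := by
  ext σ τ
  simp [siteOp, Matrix.one_apply, funext_iff]

theorem neg_smul_meanFieldHamiltonian_one (β Δ : ℝ) (l : BCSLayer) :
    -(β : ℂ) • meanFieldHamiltonian l 1 Δ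
      = siteOp (((β : ℂ)) • !![(l.ε : ℂ), 2 * l.Tc * Δ; 2 * l.Tc * Δ, -l.ε]) (0 : Fin 1) := by
  have h : ((β : ℂ)) • !![(l.ε : ℂ), 2 * l.Tc * Δ; 2 * l.Tc * Δ, -l.ε]
      = ((β * l.ε : ℂ)) • pauliZ + (2 * β * l.Tc * Δ : ℂ) • (raising + lowering) := by
    ext i j
    fin_cases i <;> fin_cases j <;> simp [raising, lowering, pauliZ] <;> ring
  rw [h, siteOp_add, siteOp_smul, siteOp_smul, siteOp_add, ← siteSum_one, ← siteSum_one,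
    ← siteSum_one, ← Splus_eq, ← Sminus_eq, meanFieldHamiltonian]
  have hz : siteSum 1 pauliZ = (2 : ℂ) • Sz 1 := by
    rw [Sz_eq, smul_smul]
    norm_num
  rw [hz, Complex.star_def, Complex.conj_ofReal]
  push_cast
  module

/-- The gap equation. -/
theorem IsGap.tanh_eq {β : ℝ} (hβ : 0 < β) {l : BCSLayer} (hTc : 0 < l.Tc) {Δ : ℝ}
    (h : IsGap β l Δ) {E : ℝ} (hE : 0 < E) (hEsq : E ^ 2 = l.ε ^ 2 + (2 * l.Tc * Δ) ^ 2) :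
    Real.tanh (β * E) = E / l.Tc := by
  obtain ⟨hΔ, h⟩ := h
  -- One site and the phase zero already contain the gap equation; the mean-field Hamiltonian is
  -- then a two-by-two matrix with eigenvalues `±E`.
  have h1 := h 1 0 le_rfl
  have hβE : β * E ≠ 0 := (mul_pos hβ hE).ne'
  set m : Matrix (Fin 2) (Fin 2) ℂ :=
    (β : ℂ) • !![(l.ε : ℂ), 2 * l.Tc * Δ; 2 * l.Tc * Δ, -l.ε] with hm
  have hEc : (E : ℂ) ^ 2 = (l.ε : ℂ) ^ 2 + (2 * l.Tc * Δ : ℂ) ^ 2 := by exact_mod_cast hEsq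
  have hmm : m * m = (((β * E : ℝ) : ℂ) ^ 2) • 1 := by
    have : (((β * E : ℝ) : ℂ) ^ 2) = β ^ 2 * ((l.ε : ℂ) ^ 2 + (2 * l.Tc * Δ : ℂ) ^ 2) := by
      rw [← hEc]
      push_cast
      ring
    rw [this]
    ext i j
    fin_cases i <;> fin_cases j <;> simp [hm, Matrix.mul_apply] <;> ring
  have hexp := matrix_exp_of_mul_self_eq (M := siteOp m (0 : Fin 1)) hβE (by
    rw [siteOp_mul_self, hmm, siteOp_smul, siteOp_one_one])
  simp only [Complex.ofReal_zero, mul_zero, Complex.exp_zero, mul_one, Nat.cast_one, div_one,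
    gibbs] at h1
  rw [neg_smul_meanFieldHamiltonian_one, ← hm, hexp, Splus_eq, siteSum_one, ← siteOp_one_one,
    ← siteOp_smul, ← siteOp_smul, ← siteOp_add, siteOp_mul_self, trace_siteOp_one,
    trace_siteOp_one] at h1
  have hc := Real.cosh_pos (β * E)
  have t1 : ((((Real.cosh (β * E) : ℝ) : ℂ) • 1 + ((Real.sinh (β * E) / (β * E) : ℝ) : ℂ) • m)
      * raising).trace = ((Real.sinh (β * E) / (β * E) * (β * (2 * l.Tc * Δ)) : ℝ) : ℂ) := by
    simp [Matrix.trace, Matrix.mul_apply, hm, raising]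
  have t2 : (((Real.cosh (β * E) : ℝ) : ℂ) • 1 + ((Real.sinh (β * E) / (β * E) : ℝ) : ℂ) • m).trace
      = ((2 * Real.cosh (β * E) : ℝ) : ℂ) := by
    simp [Matrix.trace, hm]
    ring
  rw [t1, t2, ← Complex.ofReal_div] at h1
  have h2 := Complex.ofReal_injective h1
  rw [Real.tanh_eq_sinh_div_cosh, div_eq_div_iff hc.ne' hTc.ne']
  field_simp at h2
  linarith

/-- The spin per site of the dominating multiplet. -/
theorem IsGap.exists_spin {β : ℝ} (hβ : 0 < β) {l : BCSLayer} (hTc : 0 < l.Tc) {Δ : ℝ}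
    (h : IsGap β l Δ) :
    ∃ r, 0 < r ∧ Real.tanh (β * l.Tc * r) = r ∧ |l.ε / l.Tc| < r ∧
      Δ ^ 2 = (r ^ 2 - (l.ε / l.Tc) ^ 2) / 4 := by
  have hΔ := h.1
  have hpos : 0 < l.ε ^ 2 + (2 * l.Tc * Δ) ^ 2 := by positivity
  set E := Real.sqrt (l.ε ^ 2 + (2 * l.Tc * Δ) ^ 2) with hE
  have hE0 : 0 < E := Real.sqrt_pos.2 hpos
  have hEsq : E ^ 2 = l.ε ^ 2 + (2 * l.Tc * Δ) ^ 2 := Real.sq_sqrt hpos.le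
  refine ⟨E / l.Tc, by positivity, ?_, ?_, ?_⟩
  · have : β * l.Tc * (E / l.Tc) = β * E := by field_simp
    rw [this, h.tanh_eq hβ hTc hE0 hEsq]
  · rw [abs_div, abs_of_pos hTc]
    refine div_lt_div_of_pos_right (abs_lt_of_sq_lt_sq ?_ hE0.le) hTc
    rw [hEsq]
    have : 0 < (2 * l.Tc * Δ) ^ 2 := by positivity
    linarith
  · rw [div_pow, div_pow, hEsq]
    field_simp
    ring

/-! ### Thermodynamic limits -/

section Limits

variable {β : ℝ} {l : BCSLayer} {r : ℝ}

theorem tendsto_bcsAverage_zero_of_le (hβ : 0 < β) (hTc : 0 < l.Tc) (hr : 0 < r)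
    (h : Real.tanh (β * l.Tc * r) = r) (hu : |l.ε / l.Tc| < r) {f : ℕ → ℕ × ℕ → ℝ} {C : ℝ}
    (hC : 0 < C)
    (hf : ∀ N : ℕ, 0 < N → ∀ p ∈ spinStates N, |f N p| ≤ C * (|((N : ℝ) - 2 * p.1) / N - r| +
      |((N : ℝ) - 2 * p.2) / N - l.ε / l.Tc| + 1 / N)) :
    Tendsto (fun N => bcsAverage β l N (f N)) atTop (𝓝 0) := by
  have hr1 : r < 1 := h ▸ Real.tanh_lt_one _
  refine tendsto_bcsAverage_zero hβ hTc hr h hu (C := C * 4) (fun N hN p hp => ?_) fun η hη => ?_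
  · refine (hf N hN p hp).trans (mul_le_mul_of_nonneg_left ?_ hC.le)
    obtain ⟨⟨h0, h1⟩, h2⟩ := label_bounds hN hp
    have h3 : |((N : ℝ) - 2 * p.1) / N - r| ≤ 1 := abs_le.2 ⟨by linarith, by linarith⟩
    have h4 : |((N : ℝ) - 2 * p.2) / N - l.ε / l.Tc| ≤ 2 :=
      (abs_sub _ _).trans (by linarith)
    have h5 : 1 / (N : ℝ) ≤ 1 := by
      rw [div_le_one (by exact_mod_cast hN)]
      exact_mod_cast hN
    linarith
  · refine ⟨η / C / 3, by positivity, ?_⟩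
    filter_upwards [tendsto_one_div_atTop_nhds_zero_nat.eventually
      (gt_mem_nhds (by positivity : 0 < η / C / 3)), eventually_gt_atTop 0] with N h1 hN p hp h2 h3
    refine (hf N hN p hp).trans ?_
    calc _ ≤ C * (η / C / 3 + η / C / 3 + η / C / 3) := by gcongr
      _ = η := by field_simp; norm_num

/-- In the normalized labels the pair number is `(y² - u²) / 4 + (y + u) / (2 N)`, and each
difference from the limit has a coefficient of modulus at most one. -/
theorem abs_pairNumber_div_sub_le (hr : 0 < r) (hr1 : r < 1) (hu : |l.ε / l.Tc| < r) {N : ℕ}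
    (hN : 0 < N) {p : ℕ × ℕ} (hp : p ∈ spinStates N) :
    |pairNumber N p.1 p.2 / (N : ℝ) ^ 2 - (r ^ 2 - (l.ε / l.Tc) ^ 2) / 4|
      ≤ |((N : ℝ) - 2 * p.1) / N - r| + |((N : ℝ) - 2 * p.2) / N - l.ε / l.Tc| + 1 / N := by
  have hN' : (0 : ℝ) < N := by exact_mod_cast hN
  obtain ⟨⟨h0, h1⟩, h2⟩ := label_bounds hN hp
  set y := ((N : ℝ) - 2 * p.1) / N with hy
  set u := ((N : ℝ) - 2 * p.2) / N with hu'
  set u₀ := l.ε / l.Tc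
  have hid : pairNumber N p.1 p.2 / (N : ℝ) ^ 2 - (r ^ 2 - u₀ ^ 2) / 4
      = (y + r) / 4 * (y - r) - (u + u₀) / 4 * (u - u₀) + (y + u) / 2 * (1 / N) := by
    clear_value u₀
    rw [pairNumber, hy, hu']
    field_simp
    ring
  have a1 : |(y + r) / 4| ≤ 1 := abs_le.2 ⟨by linarith, by linarith⟩
  have a2 : |(u + u₀) / 4| ≤ 1 := by
    rw [abs_le] at h2 ⊢
    rw [abs_lt] at hu
    constructor <;> linarith [hu.1, hu.2, h2.1, h2.2]
  have a3 : |(y + u) / 2| ≤ 1 := by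
    rw [abs_le] at h2 ⊢
    constructor <;> linarith [h2.1, h2.2]
  rw [hid]
  refine (abs_add_le _ _).trans (add_le_add ((abs_sub _ _).trans (add_le_add ?_ ?_)) ?_)
  · rw [abs_mul]
    exact mul_le_of_le_one_left (abs_nonneg _) a1
  · rw [abs_mul]
    exact mul_le_of_le_one_left (abs_nonneg _) a2
  · rw [abs_mul, abs_of_pos (by positivity : 0 < 1 / (N : ℝ))]
    exact mul_le_of_le_one_left (by positivity) a3

theorem bcsAverage_div_sub {N : ℕ} (f : ℕ × ℕ → ℝ) (a b : ℝ) :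
    bcsAverage β l N (fun p => f p / a - b) = bcsAverage β l N f / a - b := by
  have hZ : 0 < ∑ p ∈ spinStates N, bcsWeight β l N p :=
    Finset.sum_pos (fun p hp => bcsWeight_pos hp) ⟨(0, 0), by rw [mem_spinStates]; simp⟩
  have h : ∑ p ∈ spinStates N, bcsWeight β l N p * (f p / a - b)
      = (∑ p ∈ spinStates N, bcsWeight β l N p * f p) / a
        - b * ∑ p ∈ spinStates N, bcsWeight β l N p := by
    rw [Finset.sum_div, Finset.mul_sum, ← Finset.sum_sub_distrib]
    refine Finset.sum_congr rfl fun p _ => ?_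
    ring
  rw [bcsAverage, bcsAverage, h, sub_div, mul_div_cancel_right₀ _ hZ.ne', div_right_comm]

open Polynomial in
/-- The order parameter is the gap. -/
theorem IsGap.tendsto_gibbs {Δ : ℝ} (hβ : 0 < β) (hTc : 0 < l.Tc) (hgap : IsGap β l Δ) :
    Tendsto (fun N : ℕ => gibbs β (bcsHamiltonian l N) (Splus N * Sminus N) / (N : ℂ) ^ 2)
      atTop (𝓝 ((Δ : ℂ) ^ 2)) := by
  obtain ⟨r, hr, h, hu, hΔ⟩ := hgap.exists_spin hβ hTc
  have hr1 : r < 1 := h ▸ Real.tanh_lt_one _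
  have h1 := tendsto_bcsAverage_zero_of_le hβ hTc hr h hu one_pos
    (f := fun N p => pairNumber N p.1 p.2 / (N : ℝ) ^ 2 - Δ ^ 2) fun N hN p hp => by
      rw [one_mul, hΔ]
      exact abs_pairNumber_div_sub_le hr hr1 hu hN hp
  simp only [bcsAverage_div_sub] at h1
  have h2 := (Complex.continuous_ofReal.tendsto _).comp (h1.add_const (Δ ^ 2))
  rw [zero_add, Complex.ofReal_pow] at h2
  refine h2.congr fun N => ?_
  have h3 := gibbs_bcsHamiltonian β l N (X : ℂ[X]) (fun _ => 1) (f := fun p => pairNumber N p.1 p.2)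
    fun p => by simp
  rw [Matrix.diagonal_one, mul_one, aeval_X] at h3
  rw [h3]
  simp

-- Mean-square convergence is what the purification turns into the vector statement `E E* Ω → Ω`;
-- convergence of the expectation alone would not suffice.
open Polynomial in
theorem IsGap.tendsto_gibbs_pairing {Δ : ℝ} (hβ : 0 < β) (hTc : 0 < l.Tc) (hgap : IsGap β l Δ) :
    Tendsto (fun N : ℕ => gibbs β (bcsHamiltonian l N)
      (((((Δ * N : ℝ) : ℂ) ^ 2)⁻¹ • (Splus N * Sminus N) - 1) ^ 2)) atTop (𝓝 0) := by
  obtain ⟨r, hr, h, hu, hΔ⟩ := hgap.exists_spin hβ hTc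
  have hr1 : r < 1 := h ▸ Real.tanh_lt_one _
  have hΔ0 := hgap.1
  have hb : ∀ N : ℕ, 0 < N → ∀ p ∈ spinStates N,
      |pairNumber N p.1 p.2 / (N : ℝ) ^ 2 - Δ ^ 2| ≤ 4 := by
    intro N hN p hp
    rw [hΔ]
    refine (abs_pairNumber_div_sub_le hr hr1 hu hN hp).trans ?_
    obtain ⟨⟨h0, h1⟩, h2⟩ := label_bounds hN hp
    have h3 : |((N : ℝ) - 2 * p.1) / N - r| ≤ 1 := abs_le.2 ⟨by linarith, by linarith⟩
    have h4 : |((N : ℝ) - 2 * p.2) / N - l.ε / l.Tc| ≤ 2 := (abs_sub _ _).trans (by linarith)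
    have h5 : 1 / (N : ℝ) ≤ 1 := by
      rw [div_le_one (by exact_mod_cast hN)]
      exact_mod_cast hN
    linarith
  have h1 := tendsto_bcsAverage_zero_of_le hβ hTc hr h hu (C := 4 / Δ ^ 4) (by positivity)
    (f := fun N p => (((Δ * N) ^ 2)⁻¹ * pairNumber N p.1 p.2 - 1) ^ 2) fun N hN p hp => by
      have hN' : (0 : ℝ) < N := by exact_mod_cast hN
      have e : (((Δ * N) ^ 2)⁻¹ * pairNumber N p.1 p.2 - 1) ^ 2
          = (pairNumber N p.1 p.2 / (N : ℝ) ^ 2 - Δ ^ 2) ^ 2 / Δ ^ 4 := by field_simp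
      -- One factor of the square is bounded by `4`; the other is of first order in the deviations.
      rw [e, abs_div, abs_pow, abs_of_pos (by positivity : 0 < Δ ^ 4), div_mul_eq_mul_div, sq]
      refine div_le_div_of_nonneg_right (mul_le_mul (hb N hN p hp) ?_ (abs_nonneg _) (by norm_num))
        (by positivity)
      rw [hΔ]
      exact abs_pairNumber_div_sub_le hr hr1 hu hN hp
  have h2 := (Complex.continuous_ofReal.tendsto _).comp h1
  rw [Complex.ofReal_zero] at h2
  refine h2.congr fun N => ?_
  have h3 := gibbs_bcsHamiltonian β l N ((C (((Δ * N : ℝ) : ℂ) ^ 2)⁻¹ * X - 1) ^ 2) (fun _ => 1)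
    (f := fun p => (((Δ * N) ^ 2)⁻¹ * pairNumber N p.1 p.2 - 1) ^ 2) fun p => by simp
  rw [Matrix.diagonal_one, mul_one] at h3
  rw [Function.comp_apply, ← h3]
  simp [Algebra.smul_def]

/-- The deviation of the weight from its thermal value. -/
def detuning (l : BCSLayer) (N : ℕ) : SpinOp N :=
  ((4 * l.Tc / N : ℝ) : ℂ) • Sz N - ((2 * l.ε : ℝ) : ℂ) • 1

open Polynomial in
theorem IsGap.tendsto_gibbs_detuning {Δ : ℝ} (hβ : 0 < β) (hTc : 0 < l.Tc)
    (hgap : IsGap β l Δ) :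
    Tendsto (fun N : ℕ => gibbs β (bcsHamiltonian l N) (detuning l N ^ 2)) atTop (𝓝 0) := by
  obtain ⟨r, hr, h, hu, hΔ⟩ := hgap.exists_spin hβ hTc
  have hr1 : r < 1 := h ▸ Real.tanh_lt_one _
  have h1 := tendsto_bcsAverage_zero_of_le hβ hTc hr h hu (C := 8 * l.Tc ^ 2) (by positivity)
    (f := fun N p => (4 * l.Tc / N * (N / 2 - p.2) - 2 * l.ε) ^ 2) fun N hN p hp => by
      have hN' : (0 : ℝ) < N := by exact_mod_cast hN
      have e : (4 * l.Tc / N * (N / 2 - p.2) - 2 * l.ε) ^ 2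
          = 4 * l.Tc ^ 2 * (((N : ℝ) - 2 * p.2) / N - l.ε / l.Tc) ^ 2 := by field_simp; ring
      obtain ⟨⟨h0, h1⟩, h2⟩ := label_bounds hN hp
      have h4 : |((N : ℝ) - 2 * p.2) / N - l.ε / l.Tc| ≤ 2 := (abs_sub _ _).trans (by linarith)
      rw [abs_of_nonneg (sq_nonneg _), e, ← sq_abs (((N : ℝ) - 2 * p.2) / N - l.ε / l.Tc)]
      set v := |((N : ℝ) - 2 * p.2) / N - l.ε / l.Tc|
      have h5 : v ^ 2 ≤ 2 * v := by
        rw [sq]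
        exact mul_le_mul_of_nonneg_right h4 (abs_nonneg _)
      have h6 := abs_nonneg (((N : ℝ) - 2 * p.1) / N - r)
      have h7 : 0 < 1 / (N : ℝ) := by positivity
      calc _ ≤ 4 * l.Tc ^ 2 * (2 * v) := by gcongr
        _ = 8 * l.Tc ^ 2 * v := by ring
        _ ≤ _ := by
          refine mul_le_mul_of_nonneg_left ?_ (by positivity)
          linarith
  have h2 := (Complex.continuous_ofReal.tendsto _).comp h1
  rw [Complex.ofReal_zero] at h2
  refine h2.congr fun N => ?_
  have h3 := gibbs_bcsHamiltonian β l N 1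
    (fun k => (4 * l.Tc / N * (N / 2 - k) - 2 * l.ε : ℂ) ^ 2)
    (f := fun p => (4 * l.Tc / N * (N / 2 - p.2) - 2 * l.ε) ^ 2) fun p => by simp
  rw [map_one, one_mul] at h3
  rw [Function.comp_apply, ← h3]
  congr 1
  rw [detuning, Sz_eq_diagonal, ← Matrix.diagonal_one, ← Matrix.diagonal_smul,
    ← Matrix.diagonal_smul, Matrix.diagonal_sub, Matrix.diagonal_pow]
  congr 1
  ext σ
  simp

end Limits

/-! ### The purification of the Gibbs state -/

theorem norm_toLp_tensor {n m : Type*} [Fintype n] [Fintype m] (v : n → ℂ) (w : m → ℂ) :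
    ‖WithLp.toLp 2 fun p : n × m => v p.1 * w p.2‖ = ‖WithLp.toLp 2 v‖ * ‖WithLp.toLp 2 w‖ := by
  rw [← sq_eq_sq₀ (norm_nonneg _) (by positivity), mul_pow, EuclideanSpace.norm_sq_eq,
    EuclideanSpace.norm_sq_eq, EuclideanSpace.norm_sq_eq, Finset.sum_mul_sum,
    Fintype.sum_prod_type]
  simp only [norm_mul, mul_pow]

theorem ofReal_norm_toLp_sq {n : Type*} [Fintype n] (v : n → ℂ) :
    ((‖WithLp.toLp 2 v‖ ^ 2 : ℝ) : ℂ) = star v ⬝ᵥ v := by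
  rw [EuclideanSpace.norm_sq_eq, dotProduct]
  push_cast
  refine Finset.sum_congr rfl fun i _ => ?_
  rw [Pi.star_apply, Complex.star_def, Complex.conj_mul']

/-! ### Matrix algebras on the two factors of a tensor product. -/

section Tensor

variable {n m : Type*} [Fintype n] [DecidableEq n] [Fintype m] [DecidableEq m]

/-- Matrices acting on the first factor of a tensor product. -/
def leftFactor (n m : Type*) [Fintype n] [DecidableEq n] [Fintype m] [DecidableEq m] :
    Matrix n n ℂ →⋆ₐ[ℂ] Matrix (n × m) (n × m) ℂ where
  toFun A := A ⊗ₖ 1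
  map_one' := Matrix.one_kronecker_one
  map_mul' A B := by rw [← Matrix.mul_kronecker_mul, mul_one]
  map_zero' := Matrix.zero_kronecker _
  map_add' A B := Matrix.add_kronecker _ _ _
  commutes' c := by
    rw [Algebra.algebraMap_eq_smul_one, Algebra.algebraMap_eq_smul_one, Matrix.smul_kronecker,
      Matrix.one_kronecker_one]
  map_star' A := by
    rw [Matrix.star_eq_conjTranspose, Matrix.star_eq_conjTranspose,
      Matrix.conjTranspose_kronecker, Matrix.conjTranspose_one]

/-- Matrices acting on the second factor of a tensor product. -/
def rightFactor (n m : Type*) [Fintype n] [DecidableEq n] [Fintype m] [DecidableEq m] :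
    Matrix m m ℂ →⋆ₐ[ℂ] Matrix (n × m) (n × m) ℂ where
  toFun A := 1 ⊗ₖ A
  map_one' := Matrix.one_kronecker_one
  map_mul' A B := by rw [← Matrix.mul_kronecker_mul, mul_one]
  map_zero' := Matrix.kronecker_zero _
  map_add' A B := Matrix.kronecker_add _ _ _
  commutes' c := by
    rw [Algebra.algebraMap_eq_smul_one, Algebra.algebraMap_eq_smul_one, Matrix.kronecker_smul,
      Matrix.one_kronecker_one]
  map_star' A := by
    rw [Matrix.star_eq_conjTranspose, Matrix.star_eq_conjTranspose,
      Matrix.conjTranspose_kronecker, Matrix.conjTranspose_one]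

theorem leftFactor_apply (A : Matrix n n ℂ) : leftFactor n m A = A ⊗ₖ 1 := rfl

theorem rightFactor_apply (A : Matrix m m ℂ) : rightFactor n m A = 1 ⊗ₖ A := rfl

theorem leftFactor_commute_rightFactor (A : Matrix n n ℂ) (B : Matrix m m ℂ) :
    Commute (leftFactor n m A) (rightFactor n m B) := by
  rw [Commute, SemiconjBy, leftFactor_apply, rightFactor_apply, ← Matrix.mul_kronecker_mul,
    ← Matrix.mul_kronecker_mul, one_mul, mul_one, one_mul, mul_one]

theorem leftFactor_mulVec_tensor (A : Matrix n n ℂ) (v : n → ℂ) (w : m → ℂ) :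
    (leftFactor n m A) *ᵥ (fun p : n × m => v p.1 * w p.2)
      = fun p : n × m => (A *ᵥ v) p.1 * w p.2 := by
  ext ⟨i, j⟩
  simp only [leftFactor_apply, Matrix.mulVec, dotProduct, Matrix.kroneckerMap_apply,
    Fintype.sum_prod_type, Matrix.one_apply, mul_ite, mul_one, mul_zero, ite_mul, zero_mul,
    Finset.sum_ite_eq, Finset.mem_univ, if_true, Finset.sum_mul, mul_assoc]

theorem rightFactor_mulVec_tensor (A : Matrix m m ℂ) (v : n → ℂ) (w : m → ℂ) :
    (rightFactor n m A) *ᵥ (fun p : n × m => v p.1 * w p.2)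
      = fun p : n × m => v p.1 * (A *ᵥ w) p.2 := by
  ext ⟨i, j⟩
  simp only [rightFactor_apply, Matrix.mulVec, dotProduct, Matrix.kroneckerMap_apply,
    Fintype.sum_prod_type, Matrix.one_apply, ite_mul, zero_mul, one_mul]
  rw [Finset.sum_comm]
  simp only [Finset.sum_ite_eq, Finset.mem_univ, if_true, Finset.mul_sum, mul_left_comm]

end Tensor

section Purification

variable {n : Type*} [Fintype n] [DecidableEq n] {β : ℝ} {H : Matrix n n ℂ}

/-- The square root of the Gibbs density matrix. -/
def sqrtGibbs (β : ℝ) (H : Matrix n n ℂ) : Matrix n n ℂ :=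
  ((Real.sqrt (NormedSpace.exp (-(β : ℂ) • H)).trace.re : ℂ))⁻¹ •
    NormedSpace.exp (-((β / 2 : ℝ) : ℂ) • H)

theorem purifiedGibbs_eq_vec : purifiedGibbs β H = Matrix.vec (sqrtGibbs β H)ᵀ := by
  ext p
  rw [purifiedGibbs, sqrtGibbs, Matrix.vec, Matrix.transpose_apply, Matrix.smul_apply,
    smul_eq_mul, div_eq_inv_mul]

theorem leftFactor_mulVec_purifiedGibbs (A : Matrix n n ℂ) :
    leftFactor n n A *ᵥ purifiedGibbs β H = Matrix.vec (A * sqrtGibbs β H)ᵀ := by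
  rw [purifiedGibbs_eq_vec, leftFactor_apply, Matrix.kronecker_mulVec_vec, one_mul,
    Matrix.transpose_mul]

theorem rightFactor_mulVec_purifiedGibbs (A : Matrix n n ℂ) :
    rightFactor n n A *ᵥ purifiedGibbs β H = Matrix.vec (sqrtGibbs β H * Aᵀ)ᵀ := by
  rw [purifiedGibbs_eq_vec, rightFactor_apply, Matrix.kronecker_mulVec_vec, Matrix.transpose_one,
    mul_one, Matrix.transpose_mul, Matrix.transpose_transpose]

theorem commute_sqrtGibbs {A : Matrix n n ℂ} (hA : Commute A H) : Commute A (sqrtGibbs β H) :=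
  (((hA.symm.smul_left _).exp_left).smul_left _).symm

/-- The algebra factor multiplies the square root of the density matrix from the left, the commutant
factor by the transpose from the right. They cancel for a symmetric matrix commuting with `H`. -/
theorem renormalized_mulVec_purifiedGibbs {N : ℕ} {A H : SpinOp N} (hAt : Aᵀ = A)
    (hA : Commute A H) : renormalized A *ᵥ purifiedGibbs β H = 0 := by
  rw [renormalized, Matrix.sub_mulVec, ← leftFactor_apply, ← rightFactor_apply,
    leftFactor_mulVec_purifiedGibbs, rightFactor_mulVec_purifiedGibbs, hAt,
    (commute_sqrtGibbs hA).eq, sub_self]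

theorem sqrtGibbs_conjTranspose (hH : Hᴴ = H) : (sqrtGibbs β H)ᴴ = sqrtGibbs β H := by
  rw [sqrtGibbs, Matrix.conjTranspose_smul, ← Matrix.exp_conjTranspose, Matrix.conjTranspose_smul,
    hH]
  simp

theorem ofReal_norm_leftFactor_purifiedGibbs_sq (hH : Hᴴ = H)
    {Z : ℝ} (hZ : 0 < Z) (hHZ : (NormedSpace.exp (-(β : ℂ) • H)).trace = Z) (A : Matrix n n ℂ) :
    ((‖WithLp.toLp 2 (leftFactor n n A *ᵥ purifiedGibbs β H)‖ ^ 2 : ℝ) : ℂ)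
      = gibbs β H (Aᴴ * A) := by
  have hVV : sqrtGibbs β H * sqrtGibbs β H = (Z : ℂ)⁻¹ • NormedSpace.exp (-(β : ℂ) • H) := by
    have h1 : (-((β / 2 : ℝ) : ℂ)) • H + (-((β / 2 : ℝ) : ℂ)) • H = -(β : ℂ) • H := by
      push_cast
      module
    rw [sqrtGibbs, hHZ, Complex.ofReal_re, smul_mul_smul_comm,
      ← Matrix.exp_add_of_commute _ _ (Commute.refl _), h1, ← mul_inv, ← Complex.ofReal_mul,
      Real.mul_self_sqrt hZ.le]
  have h2 : (((A * sqrtGibbs β H)ᵀ)ᴴ * (A * sqrtGibbs β H)ᵀ).trace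
      = ((A * sqrtGibbs β H)ᴴ * (A * sqrtGibbs β H)).trace := by
    have h3 : ((A * sqrtGibbs β H)ᵀ)ᴴ = ((A * sqrtGibbs β H)ᴴ)ᵀ := rfl
    rw [h3, ← Matrix.transpose_mul, Matrix.trace_transpose, Matrix.trace_mul_comm]
  rw [ofReal_norm_toLp_sq, leftFactor_mulVec_purifiedGibbs, Matrix.star_vec_dotProduct_vec, h2,
    Matrix.conjTranspose_mul, sqrtGibbs_conjTranspose hH, Matrix.mul_assoc, Matrix.trace_mul_comm,
    Matrix.mul_assoc, Matrix.mul_assoc, hVV, gibbs, hHZ, ← Matrix.mul_assoc, mul_smul_comm,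
    Matrix.trace_smul, Matrix.trace_mul_comm, smul_eq_mul, div_eq_inv_mul]

end Purification

/-! ### A layer in the GNS representation -/

theorem bcsHamiltonian_conjTranspose (l : BCSLayer) (N : ℕ) :
    (bcsHamiltonian l N)ᴴ = bcsHamiltonian l N := by
  simp [bcsHamiltonian, Matrix.conjTranspose_sub, Matrix.conjTranspose_smul,
    Matrix.conjTranspose_mul, Sz_conjTranspose, Splus_conjTranspose, Sminus_conjTranspose]

theorem bcsHamiltonian_transpose (l : BCSLayer) (N : ℕ) :
    (bcsHamiltonian l N)ᵀ = bcsHamiltonian l N := by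
  have h : (Sminus N)ᵀ = Splus N := by rw [← Splus_transpose, Matrix.transpose_transpose]
  rw [bcsHamiltonian, Matrix.transpose_sub, Matrix.transpose_smul, Matrix.transpose_smul,
    Matrix.transpose_mul, Sz_transpose, Splus_transpose, h]

theorem Sz_commute_bcsHamiltonian (l : BCSLayer) (N : ℕ) :
    Commute (Sz N) (bcsHamiltonian l N) :=
  ((Commute.refl _).smul_right _).sub_right ((Sz_commute_Splus_mul_Sminus N).smul_right _)

/-- The energy of an added pair is the operator `detuning`, which vanishes when twice the weight per
site has its thermal value `ε / T_c`. -/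
theorem bcsHamiltonian_mul_Splus (l : BCSLayer) (N : ℕ) :
    bcsHamiltonian l N * Splus N = Splus N * bcsHamiltonian l N + Splus N * detuning l N := by
  have h1 := Sz_mul_Splus N
  have h2 := Splus_mul_Sminus N
  have h3 : Splus N * Sminus N * Splus N
      = Splus N * (Splus N * Sminus N) - (2 : ℂ) • (Splus N * Sz N) := by
    rw [mul_assoc, eq_sub_of_add_eq h2.symm, mul_sub, mul_smul_comm]
  rw [bcsHamiltonian, detuning, sub_mul, smul_mul_assoc, smul_mul_assoc, h1, h3, mul_sub, mul_sub,
    mul_smul_comm, mul_smul_comm, mul_smul_comm, mul_smul_comm, mul_one]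
  push_cast
  module

theorem detuning_mul_Splus (l : BCSLayer) (N : ℕ) :
    detuning l N * Splus N = Splus N * detuning l N + ((4 * l.Tc / N : ℝ) : ℂ) • Splus N := by
  rw [detuning, sub_mul, mul_sub, smul_mul_assoc, mul_smul_comm, Sz_mul_Splus, smul_mul_assoc,
    mul_smul_comm, one_mul, mul_one]
  module

theorem detuning_conjTranspose (l : BCSLayer) (N : ℕ) : (detuning l N)ᴴ = detuning l N := by
  simp [detuning, Matrix.conjTranspose_sub, Matrix.conjTranspose_smul, Sz_conjTranspose]

theorem exists_trace_exp_bcsHamiltonian (β : ℝ) (l : BCSLayer) (N : ℕ) :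
    ∃ Z : ℝ, 0 < Z ∧ (NormedSpace.exp (-(β : ℂ) • bcsHamiltonian l N)).trace = Z := by
  have h := trace_exp_bcsHamiltonian_mul β l N 1 fun _ => 1
  rw [map_one, Matrix.diagonal_one, one_mul, mul_one] at h
  refine ⟨∑ p ∈ spinStates N, bcsWeight β l N p,
    Finset.sum_pos (fun p hp => bcsWeight_pos hp) ⟨(0, 0), by rw [mem_spinStates]; simp⟩, ?_⟩
  rw [h]
  push_cast
  simp

theorem renormalized_eq {N : ℕ} (A : SpinOp N) :
    renormalized A = leftFactor (Spins N) (Spins N) A - rightFactor (Spins N) (Spins N) A := rfl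

theorem isSelfAdjoint_renormalized {N : ℕ} {A : SpinOp N} (hA : Aᴴ = A) :
    IsSelfAdjoint (renormalized A) := by
  have h : IsSelfAdjoint A := hA
  rw [renormalized_eq]
  exact (h.map _).sub (h.map _)

theorem phaseFluct_eq {N : ℕ} (c : ℝ) (A : SpinOp N) :
    phaseFluct c A = ((c * N : ℝ) : ℂ)⁻¹ • leftFactor (Spins N) (Spins N) A := by
  rw [← map_smul]
  rfl

theorem star_phaseFluct_Splus (c : ℝ) (N : ℕ) :
    star (phaseFluct c (Splus N)) = phaseFluct c (Sminus N) := by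
  rw [phaseFluct_eq, phaseFluct_eq, star_smul, ← map_star, Matrix.star_eq_conjTranspose,
    Splus_conjTranspose, Complex.star_def, ← Complex.ofReal_inv, Complex.conj_ofReal]

theorem renormalized_mul_leftFactor {N : ℕ} {A B C : SpinOp N} (h : A * B = B * A + C) :
    renormalized A * leftFactor (Spins N) (Spins N) B
      = leftFactor (Spins N) (Spins N) B * renormalized A + leftFactor (Spins N) (Spins N) C := by
  rw [renormalized_eq, sub_mul, mul_sub, ← map_mul, h, map_add, map_mul,
    (leftFactor_commute_rightFactor B A).eq]
  abel

variable {β : ℝ} {l : BCSLayer} {c : ℝ}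

theorem tendsto_norm_of_tendsto_gibbs {A : ∀ N, SpinOp N}
    (hA : Tendsto (fun N => gibbs β (bcsHamiltonian l N) ((A N)ᴴ * A N)) atTop (𝓝 0)) :
    Tendsto (fun N => ‖WithLp.toLp 2 (leftFactor (Spins N) (Spins N) (A N) *ᵥ
      purifiedGibbs β (bcsHamiltonian l N))‖) atTop (𝓝 0) := by
  have h1 := (Complex.continuous_re.tendsto _).comp hA
  have h2 := (Real.continuous_sqrt.tendsto _).comp h1
  rw [Complex.zero_re, Real.sqrt_zero] at h2
  refine h2.congr fun N => ?_
  obtain ⟨Z, hZ, hHZ⟩ := exists_trace_exp_bcsHamiltonian β l N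
  rw [Function.comp_apply, Function.comp_apply, ← ofReal_norm_leftFactor_purifiedGibbs_sq
    (bcsHamiltonian_conjTranspose l N) hZ hHZ, Complex.ofReal_re, Real.sqrt_sq (norm_nonneg _)]

theorem norm_purifiedGibbs_bcsHamiltonian (β : ℝ) (l : BCSLayer) (N : ℕ) :
    ‖WithLp.toLp 2 (purifiedGibbs β (bcsHamiltonian l N))‖ = 1 := by
  obtain ⟨Z, hZ, hHZ⟩ := exists_trace_exp_bcsHamiltonian β l N
  have h := ofReal_norm_leftFactor_purifiedGibbs_sq (bcsHamiltonian_conjTranspose l N) hZ hHZ 1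
  rw [map_one, Matrix.one_mulVec, Matrix.conjTranspose_one, mul_one, gibbs, mul_one, hHZ,
    div_self (Complex.ofReal_ne_zero.2 hZ.ne'), Complex.ofReal_eq_one] at h
  exact (pow_eq_one_iff_of_nonneg (norm_nonneg _) two_ne_zero).1 h

/-! ### The condensate relations in a representation of the layer algebra. -/

section Representation

variable {𝓗 : ℕ → Type*} [∀ N, NormedAddCommGroup (𝓗 N)] [∀ N, InnerProductSpace ℂ (𝓗 N)]
  [∀ N, CompleteSpace (𝓗 N)] (φ : ∀ N, LayerOp N →⋆ₐ[ℂ] (𝓗 N →L[ℂ] 𝓗 N))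

/-- The algebraic relations come from spin commutators. Normality is asymptotic because `[S₊, S₋] =
2 S_z` has norm at most `N` and is divided by `(c N)²`. Any positive `c` is allowed here; only the
condensate property fixes it. -/
theorem phaseLayer_map (l : BCSLayer) (hc : 0 < c) :
    PhaseLayer atTop (fun N => φ N (phaseFluct c (Splus N)))
      (fun N => φ N (renormalized (Sz N))) (fun N => φ N (renormalized (bcsHamiltonian l N)))
      (fun N => φ N (leftFactor _ _ (detuning l N))) (fun N => 4 * l.Tc / N) where
  bounded := by
    refine ⟨1 / c, fun N => ?_⟩
    have h := norm_map_Splus_le ((φ N).comp (leftFactor (Spins N) (Spins N)))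
    rw [StarAlgHom.comp_apply] at h
    rw [phaseFluct_eq, map_smul, norm_smul, norm_inv, Complex.norm_real, Real.norm_eq_abs,
      abs_of_nonneg (by positivity)]
    rcases Nat.eq_zero_or_pos N with rfl | hN
    · simp [hc.le]
    · have hN' : (0 : ℝ) < N := by exact_mod_cast hN
      calc (c * N)⁻¹ * _ ≤ (c * N)⁻¹ * N := by gcongr
        _ = 1 / c := by field_simp
  normal := by
    have h0 : Tendsto (fun N : ℕ => 1 / c ^ 2 * (1 / (N : ℝ))) atTop (𝓝 0) := by
      rw [← mul_zero (1 / c ^ 2)]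
      exact tendsto_one_div_atTop_nhds_zero_nat.const_mul _
    refine squeeze_zero' (Eventually.of_forall fun _ => norm_nonneg _) ?_ h0
    filter_upwards [eventually_gt_atTop 0] with N hN
    have hN' : (0 : ℝ) < N := by exact_mod_cast hN
    have h := norm_map_two_smul_Sz_le ((φ N).comp (leftFactor (Spins N) (Spins N)))
    rw [StarAlgHom.comp_apply] at h
    have h1 : φ N (phaseFluct c (Splus N)) * star (φ N (phaseFluct c (Splus N)))
        - star (φ N (phaseFluct c (Splus N))) * φ N (phaseFluct c (Splus N))
        = (((c * N : ℝ) : ℂ)⁻¹ * ((c * N : ℝ) : ℂ)⁻¹) •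
          φ N (leftFactor _ _ ((2 : ℂ) • Sz N)) := by
      rw [← map_star, star_phaseFluct_Splus, ← map_mul, ← map_mul, ← map_sub, ← map_smul,
        phaseFluct_eq, phaseFluct_eq, smul_mul_smul_comm, smul_mul_smul_comm, ← smul_sub,
        ← map_mul, ← map_mul, ← map_sub, Splus_mul_Sminus, add_sub_cancel_left]
    rw [h1, norm_smul, norm_mul, norm_inv, Complex.norm_real, Real.norm_eq_abs,
      abs_of_nonneg (by positivity)]
    calc (c * N)⁻¹ * (c * N)⁻¹ * _ ≤ (c * N)⁻¹ * (c * N)⁻¹ * N := by gcongr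
      _ = 1 / c ^ 2 * (1 / (N : ℝ)) := by field_simp
  selfAdjoint_momentum N := (isSelfAdjoint_renormalized (Sz_conjTranspose N)).map _
  selfAdjoint_energy N := (isSelfAdjoint_renormalized (bcsHamiltonian_conjTranspose l N)).map _
  selfAdjoint_detuning N := by
    have h : IsSelfAdjoint (detuning l N) := detuning_conjTranspose l N
    exact (h.map _).map _
  momentum N := by
    rw [← map_mul, ← map_mul, ← map_add, phaseFluct_eq, mul_smul_comm, smul_mul_assoc,
      renormalized_mul_leftFactor (Sz_mul_Splus N), smul_add]
  energy N := by
    rw [← map_mul, ← map_mul, ← map_mul, ← map_add, phaseFluct_eq, mul_smul_comm, smul_mul_assoc,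
      smul_mul_assoc, renormalized_mul_leftFactor (bcsHamiltonian_mul_Splus l N), smul_add, map_mul]
  detuning N := by
    rw [← map_mul, ← map_mul, ← map_smul, ← map_add, phaseFluct_eq, mul_smul_comm, smul_mul_assoc,
      ← map_mul, detuning_mul_Splus, map_add, smul_add, map_mul, map_smul, smul_comm]
  tendsto_zero := by
    simpa [div_eq_mul_inv] using tendsto_inv_atTop_nhds_zero_nat.const_mul (4 * l.Tc)

/-- The norm hypothesis says only that `Ω` restricts to the thermal purification of this layer, so
the result serves either tensor factor of the junction. -/
theorem isCondensate_map (hβ : 0 < β) (hTc : 0 < l.Tc) (hc : IsGap β l c) {Ω : ∀ N, 𝓗 N}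
    (hΩ : ∀ N X, ‖φ N X (Ω N)‖
      = ‖WithLp.toLp 2 (X *ᵥ purifiedGibbs β (bcsHamiltonian l N))‖) :
    IsCondensate atTop (fun N => φ N (phaseFluct c (Splus N)))
      (fun N => φ N (renormalized (Sz N))) (fun N => φ N (renormalized (bcsHamiltonian l N)))
      (fun N => φ N (leftFactor _ _ (detuning l N))) Ω where
  norm := by
    refine tendsto_const_nhds.congr fun N => ?_
    have h := hΩ N 1
    rw [map_one, Matrix.one_mulVec, norm_purifiedGibbs_bcsHamiltonian] at h
    exact h.symm
  pairing := by
    have h := hc.tendsto_gibbs_pairing hβ hTc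
    refine (tendsto_norm_of_tendsto_gibbs (β := β) (l := l) (A := fun N =>
      (((c * N : ℝ) : ℂ) ^ 2)⁻¹ • (Splus N * Sminus N) - 1) (h.congr fun N => ?_)).congr fun N => ?_
    · rw [sq]
      congr 2
      simp [Matrix.conjTranspose_sub, Matrix.conjTranspose_smul, Matrix.conjTranspose_mul,
        Splus_conjTranspose, Sminus_conjTranspose]
    · rw [← hΩ, map_sub, map_one, map_sub, map_one, ← map_star, star_phaseFluct_Splus,
        phaseFluct_eq, phaseFluct_eq, sq, mul_inv, ← smul_mul_smul_comm, map_mul, map_smul,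
        map_smul, map_mul]
      rfl
  momentum N := by
    rw [← norm_eq_zero, hΩ, renormalized_mulVec_purifiedGibbs (Sz_transpose N)
      (Sz_commute_bcsHamiltonian l N), WithLp.toLp_zero, norm_zero]
  energy := by
    refine tendsto_const_nhds.congr fun N => ?_
    rw [hΩ, renormalized_mulVec_purifiedGibbs (bcsHamiltonian_transpose l N) (Commute.refl _),
      WithLp.toLp_zero, norm_zero]
  detuning := by
    refine (tendsto_norm_of_tendsto_gibbs (β := β) (l := l) (A := detuning l)
      ((hc.tendsto_gibbs_detuning hβ hTc).congr fun N => ?_)).congr fun N => ?_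
    · rw [sq, detuning_conjTranspose]
    · rw [← hΩ]

end Representation

/-! ### The junction in the GNS representation -/

/-- The Hilbert space of the two layers. -/
abbrev JunctionSpace (N : ℕ) : Type :=
  EuclideanSpace ℂ ((Spins N × Spins N) × (Spins N × Spins N))

/-- Junction matrices as operators of the Hilbert space. -/
def junctionRep (N : ℕ) : JunctionOp N →⋆ₐ[ℂ] (JunctionSpace N →L[ℂ] JunctionSpace N) :=
  (Matrix.toEuclideanCLM (𝕜 := ℂ) (n := (Spins N × Spins N) × (Spins N × Spins N)) :
    JunctionOp N ≃⋆ₐ[ℂ] (JunctionSpace N →L[ℂ] JunctionSpace N))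

theorem junctionRep_toLp {N : ℕ} (A : JunctionOp N)
    (v : (Spins N × Spins N) × (Spins N × Spins N) → ℂ) :
    junctionRep N A (WithLp.toLp 2 v) = WithLp.toLp 2 (A *ᵥ v) :=
  Matrix.toEuclideanCLM_toLp A v

/-- The exponential series is mapped term by term; continuity of the representation is automatic in
finite dimension. -/
theorem junctionRep_exp {N : ℕ} (A : JunctionOp N) :
    junctionRep N (NormedSpace.exp A) = NormedSpace.exp (junctionRep N A) := by
  have hc : Continuous (junctionRep N) :=
    LinearMap.continuous_of_finiteDimensional (junctionRep N).toAlgHom.toLinearMap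
  have h := (hasSum_matrix_exp A).map (junctionRep N) hc
  refine h.unique ((NormedSpace.exp_series_hasSum_exp' (𝕂 := ℂ) (junctionRep N A)).congr_fun
    fun i => ?_)
  rw [Function.comp_apply, map_smul, map_pow]

/-- The operators of the left layer. -/
def leftRep (N : ℕ) : LayerOp N →⋆ₐ[ℂ] (JunctionSpace N →L[ℂ] JunctionSpace N) :=
  (junctionRep N).comp (leftFactor (Spins N × Spins N) (Spins N × Spins N))

/-- The operators of the right layer. -/
def rightRep (N : ℕ) : LayerOp N →⋆ₐ[ℂ] (JunctionSpace N →L[ℂ] JunctionSpace N) :=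
  (junctionRep N).comp (rightFactor (Spins N × Spins N) (Spins N × Spins N))

theorem leftRep_commute_rightRep {N : ℕ} (A B : LayerOp N) :
    Commute (leftRep N A) (rightRep N B) :=
  (leftFactor_commute_rightFactor A B).map (junctionRep N)

/-- The GNS cyclic vector, as an element of the Hilbert space. -/
def cyclicVector (β : ℝ) (L R : BCSLayer) (N : ℕ) : JunctionSpace N :=
  WithLp.toLp 2 (gnsVector β L R N)

variable {β : ℝ} {L R : BCSLayer}

theorem norm_leftRep_cyclicVector (N : ℕ) (X : LayerOp N) :
    ‖leftRep N X (cyclicVector β L R N)‖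
      = ‖WithLp.toLp 2 (X *ᵥ purifiedGibbs β (bcsHamiltonian L N))‖ := by
  rw [cyclicVector, leftRep, StarAlgHom.comp_apply, junctionRep_toLp]
  unfold gnsVector
  rw [leftFactor_mulVec_tensor, norm_toLp_tensor, norm_purifiedGibbs_bcsHamiltonian, mul_one]

theorem norm_rightRep_cyclicVector (N : ℕ) (X : LayerOp N) :
    ‖rightRep N X (cyclicVector β L R N)‖
      = ‖WithLp.toLp 2 (X *ᵥ purifiedGibbs β (bcsHamiltonian R N))‖ := by
  rw [cyclicVector, rightRep, StarAlgHom.comp_apply, junctionRep_toLp]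
  unfold gnsVector
  rw [rightFactor_mulVec_tensor, norm_toLp_tensor, norm_purifiedGibbs_bcsHamiltonian, one_mul]

theorem condensedJunction (hβ : 0 < β) (hL : 0 < L.Tc) (hR : 0 < R.Tc) {cL cR : ℝ}
    (hcL : IsGap β L cL) (hcR : IsGap β R cR) :
    CondensedJunction atTop
      (fun N => leftRep N (phaseFluct cL (Splus N))) (fun N => leftRep N (renormalized (Sz N)))
      (fun N => leftRep N (renormalized (bcsHamiltonian L N)))
      (fun N => leftRep N (leftFactor _ _ (detuning L N)))
      (fun N => rightRep N (phaseFluct cR (Splus N))) (fun N => rightRep N (renormalized (Sz N)))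
      (fun N => rightRep N (renormalized (bcsHamiltonian R N)))
      (fun N => rightRep N (leftFactor _ _ (detuning R N)))
      (fun N => 4 * L.Tc / N) (fun N => 4 * R.Tc / N) (cyclicVector β L R) where
  left := phaseLayer_map leftRep L hcL.1
  right := phaseLayer_map rightRep R hcR.1
  condensate_left := isCondensate_map leftRep hβ hL hcL norm_leftRep_cyclicVector
  condensate_right := isCondensate_map rightRep hβ hR hcR norm_rightRep_cyclicVector
  commute_phase _ := leftRep_commute_rightRep _ _
  commute_phase_star N := by
    rw [← map_star]
    exact leftRep_commute_rightRep _ _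
  commute_momentum_left _ := leftRep_commute_rightRep _ _
  commute_energy_left _ := leftRep_commute_rightRep _ _
  commute_detuning_left _ := leftRep_commute_rightRep _ _
  commute_momentum_right _ := (leftRep_commute_rightRep _ _).symm
  commute_energy_right _ := (leftRep_commute_rightRep _ _).symm

theorem gnsExpect_eq_inner {N : ℕ} (X Y Z : JunctionOp N) :
    gnsExpect β L R N (Xᴴ * Y * Z)
      = inner ℂ (junctionRep N X (cyclicVector β L R N))
          (junctionRep N Y (junctionRep N Z (cyclicVector β L R N))) := by
  rw [cyclicVector, junctionRep_toLp, junctionRep_toLp, junctionRep_toLp,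
    EuclideanSpace.inner_eq_star_dotProduct, gnsExpect, Matrix.star_mulVec,
    dotProduct_comm (Y *ᵥ (Z *ᵥ gnsVector β L R N)), ← Matrix.dotProduct_mulVec,
    Matrix.mulVec_mulVec, Matrix.mulVec_mulVec, mul_assoc]

theorem junctionRep_excitation (cL cR : ℝ) (N a a' b b' : ℕ) :
    junctionRep N (excitation cL cR N a a' b b')
      = star (leftRep N (phaseFluct cL (Splus N))) ^ a * leftRep N (phaseFluct cL (Splus N)) ^ a'
        * star (rightRep N (phaseFluct cR (Splus N))) ^ b
        * rightRep N (phaseFluct cR (Splus N)) ^ b' := by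
  rw [excitation, map_mul, map_mul, map_mul, map_pow, map_pow, map_pow, map_pow, ← map_star,
    ← map_star, star_phaseFluct_Splus, star_phaseFluct_Splus]
  rfl

theorem junctionRep_microEvolution (L R : BCSLayer) (lam cL cR EC ng t : ℝ) (N : ℕ) :
    junctionRep N (microEvolution L R lam cL cR EC ng t N)
      = evolution (junctionHamiltonian
          (leftRep N (phaseFluct cL (Splus N))) (leftRep N (renormalized (Sz N)))
          (leftRep N (renormalized (bcsHamiltonian L N)))
          (rightRep N (phaseFluct cR (Splus N))) (rightRep N (renormalized (Sz N)))
          (rightRep N (renormalized (bcsHamiltonian R N))) (lam * cL * cR) EC ng) t := by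
  rw [microEvolution, junctionRep_exp, map_smul, evolution]
  congr 2
  rw [microHamiltonian, freeHamiltonian, tunnelHamiltonian, capacitiveHamiltonian,
    junctionHamiltonian, map_add, map_add, map_add, map_smul, map_smul, map_add, map_mul, map_mul,
    map_pow, map_sub, map_smul, map_sub, map_smul, map_one, ← map_star, ← map_star,
    star_phaseFluct_Splus, star_phaseFluct_Splus]
  rfl

end
end ChargeQubit

/-! ### Assembly of the theorem, with the gaps as the normalizations. -/

open ChargeQubit
theorem theorem3 (β : ℝ) (hβ : 0 < β) (L R : BCSLayer) (hL : 0 < L.Tc) (hR : 0 < R.Tc)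
    (ΔL ΔR : ℝ) (hΔL : IsGap β L ΔL) (hΔR : IsGap β R ΔR) (lam EC ng : ℝ) :
    ∃ cL cR : ℝ, 0 < cL ∧ 0 < cR ∧
      Tendsto (fun N : ℕ => gibbs β (bcsHamiltonian L N) (Splus N * Sminus N) / (N : ℂ) ^ 2)
        atTop (𝓝 ((cL : ℂ) ^ 2)) ∧
      Tendsto (fun N : ℕ => gibbs β (bcsHamiltonian R N) (Splus N * Sminus N) / (N : ℂ) ^ 2)
        atTop (𝓝 ((cR : ℂ) ^ 2)) ∧
      (∃ U : ℝ → MesoSpace →L[ℂ] MesoSpace,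
        IsUnitaryGroupOf (qubitHamiltonian EC ng (2 * lam * cL * cR)) U ∧
        ∀ t : ℝ, IsMesoscopicLimit β L R cL cR (microEvolution L R lam cL cR EC ng t) (U t)) ∧
      cL = ΔL ∧ cR = ΔR ∧ 2 * lam * cL * cR = 2 * lam * ΔL * ΔR := by
  obtain ⟨U, hU, hlim⟩ := exists_qubit_evolution (lam * ΔL * ΔR) EC ng
  refine ⟨ΔL, ΔR, hΔL.1, hΔR.1, hΔL.tendsto_gibbs hβ hL, hΔR.tendsto_gibbs hβ hR, ⟨U, ?_, ?_⟩,
    rfl, rfl, rfl⟩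
  · rwa [show 2 * lam * ΔL * ΔR = 2 * (lam * ΔL * ΔR) by ring]
  · intro t a a' b b' c c' d d'
    have h := (condensedJunction hβ hL hR hΔL hΔR).exists_mesoscopic_limit (lam * ΔL * ΔR) EC ng
      hlim a a' b b' c c' d d' t
    rw [mul_assoc _ (weylPhase 0 _), mul_apply_eq_comp, weylPhase_mul_vacuum,
      inner_vacuum_weylPhase]
    refine h.congr fun N => ?_
    rw [gnsExpect_eq_inner, junctionRep_excitation, junctionRep_excitation,
      junctionRep_microEvolution]
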